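/- For each integer $N\ge 2$ let $B^1(N),\dots,B^{\ell(N)}(N)$ be (upper triangular) Jordan blocks, $B^i$ having dimension $d_i=d_i(N)\ge 1$ and eigenvalue $c_i=c_i(N)\in\mathbb C$, with $\sum_{i=1}^{\ell(N)}d_i=N$, and let $M^N$ be the $N\times N$ block diagonal matrix with successive diagonal blocks $B^1,\dots,B^{\ell(N)}$. Write $d_i=a_i\log N$, i.e. $a_i=a_i(N)=d_i/\log N$. For $\gamma>1$ put $$r_i=r_i(N)=\exp\Big(\frac{-\gamma+1/2}{a_i}\Big),\qquad \mu_N=\sum_{i=1}^{\ell(N)}\frac{a_i\log N}{N}\,m_{c_i,r_i},$$ where $m_{c,r}$ denotes the uniform probability measure on the circle in $\mathbb C$ with centre $c$ and radius $r$. For each $N$ let $G^N$ be an $N\times N$ random matrix whose entries are i.i.d. (real) standard normal variables, the matrices $G^N$ being defined on a common probability space (no assumption is made on their joint law for different $N$). For an $N\times N$ complex matrix with eigenvalues $\lambda_1,\dots,\lambda_N$ (counted with algebraic multiplicity), its empirical spectral measure is $\frac1N\sum_{i=1}^N\delta_{\lambda_i}$. **Theorem 1.1.** Suppose that $\gamma>1$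 and $\ell(N)=o(N)$ as $N\to\infty$. Suppose further that there is a compact set $K\subseteq\mathbb C$ such that all $\mu_N$ are supported on $K$, and that there is a probability measure $\mu$ on $\mathbb C$ such that $\mu_N\Rightarrow\mu$ weakly. Then the empirical spectral measure $L_N$ of $M^N+N^{-\gamma}G^N$ converges to $\mu$ weakly in probability; that is, for every bounded continuous $f:\mathbb C\to\mathbb R$, $\int f\,dL_N\to\int f\,d\mu$ in probability as $N\to\infty$. -/

import Mathlib

open MeasureTheory ProbabilityTheory Filter Topology Asymptotics
open scoped ENNReal NNReal BoundedContinuousFunction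

/-- The `n × n` Jordan block with eigenvalue `c`: `c` on the diagonal, `1` on the first
superdiagonal, `0` elsewhere. -/
def jordanBlock (n : ℕ) (c : ℂ) : Matrix (Fin n) (Fin n) ℂ :=
  Matrix.of fun i j => if i = j then c else if (i : ℕ) + 1 = (j : ℕ) then 1 else 0

/-- A finite family of Jordan blocks (of positive dimension) whose dimensions sum to `N`. -/
structure JordanData (N : ℕ) where
  /-- the number `ℓ(N)` of blocks -/
  numBlocks : ℕ
  /-- the dimension of the `i`-th block -/
  dim : Fin numBlocks → ℕ
  /-- the eigenvalue `c_i` of the `i`-th block -/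
  eig : Fin numBlocks → ℂ
  dim_pos : ∀ i, 0 < dim i
  sum_dim : ∑ i, dim i = N

namespace JordanData

variable {N : ℕ} (J : JordanData N)

/-- The `N × N` block diagonal matrix whose successive diagonal blocks are the Jordan blocks. -/
def toMatrix : Matrix (Fin N) (Fin N) ℂ :=
  Matrix.reindex (finSigmaFinEquiv.trans (finCongr J.sum_dim))
    (finSigmaFinEquiv.trans (finCongr J.sum_dim))
    (Matrix.blockDiagonal' fun i => jordanBlock (J.dim i) (J.eig i))

/-- The number `a_i` for which the `i`-th block has dimension `a_i * log N` (for `2 ≤ N`). -/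
noncomputable def a (i : Fin J.numBlocks) : ℝ := (J.dim i : ℝ) / Real.log N

/-- The radius `r_i = exp ((-γ + 1/2) / a_i)`. -/
noncomputable def radius (γ : ℝ) (i : Fin J.numBlocks) : ℝ :=
  Real.exp ((-γ + 1 / 2) / J.a i)

end JordanData

/-- The uniform probability measure `m_{c,r}` on the circle with centre `c` and radius `r`: the law
of `c + r * exp (i θ)` for `θ` uniform on `(0, 2π]`. -/
noncomputable def circleUniform (c : ℂ) (r : ℝ) : Measure ℂ :=
  (volume[|Set.Ioc (0 : ℝ) (2 * Real.pi)]).map (circleMap c r)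

/-- The mixture `μ_N = ∑ i, (a_i log N / N) m_{c_i, r_i}`; here `a_i log N` is the dimension of the
`i`-th block. -/
noncomputable def JordanData.mixture {N : ℕ} (J : JordanData N) (γ : ℝ) : Measure ℂ :=
  ∑ i, ((J.dim i : ℝ≥0∞) / (N : ℝ≥0∞)) • circleUniform (J.eig i) (J.radius γ i)

instance circleUniform_isProbabilityMeasure (c : ℂ) (r : ℝ) :
    IsProbabilityMeasure (circleUniform c r) := by
  have h : IsProbabilityMeasure (volume[|Set.Ioc (0 : ℝ) (2 * Real.pi)]) := by
    apply cond_isProbabilityMeasure_of_finite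
    · simp [Real.pi_pos]
    · exact measure_Ioc_lt_top.ne
  exact Measure.isProbabilityMeasure_map (continuous_circleMap c r).measurable.aemeasurable

instance JordanData.mixture_isFiniteMeasure {N : ℕ} (J : JordanData N) (γ : ℝ) :
    IsFiniteMeasure (J.mixture γ) := by
  refine ⟨?_⟩
  simp only [JordanData.mixture, Measure.finsetSum_apply, Measure.smul_apply, measure_univ,
    smul_eq_mul, mul_one]
  refine ENNReal.sum_lt_top.2 fun i _ => ENNReal.div_lt_top (by simp) ?_
  have h1 := J.dim_pos i
  have h2 := Finset.single_le_sum (f := J.dim) (fun _ _ => Nat.zero_le _) (Finset.mem_univ i)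
  rw [J.sum_dim] at h2
  simp only [ne_eq, Nat.cast_eq_zero]
  omega

/-- `μ_N` as an element of the space of finite measures with the weak topology. -/
noncomputable def JordanData.mixtureFM {N : ℕ} (J : JordanData N) (γ : ℝ) : FiniteMeasure ℂ :=
  ⟨J.mixture γ, inferInstance⟩

/-- The empirical spectral measure of an `N × N` complex matrix: `1 / N` times the sum of the Dirac
masses at its eigenvalues, counted with algebraic multiplicity. -/
noncomputable def empiricalSpectralMeasure {N : ℕ} (A : Matrix (Fin N) (Fin N) ℂ) : Measure ℂ :=
  (N : ℝ≥0∞)⁻¹ • (A.charpoly.roots.map Measure.dirac).sum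

/-- `G` is a random `N × N` matrix whose entries are i.i.d. (real) standard normal variables. -/
structure IsStdGaussianMatrix {Ω : Type*} [MeasurableSpace Ω] {N : ℕ}
    (G : Ω → Matrix (Fin N) (Fin N) ℝ) (P : Measure Ω) : Prop where
  hasLaw : ∀ i j, HasLaw (fun ω => G ω i j) (gaussianReal 0 1) P
  indep : iIndepFun (fun (p : Fin N × Fin N) ω => G ω p.1 p.2) P

/-- The perturbed matrix `M + N^{-γ} G`. -/
noncomputable def perturb {N : ℕ} (γ : ℝ) (M : Matrix (Fin N) (Fin N) ℂ)
    (G : Matrix (Fin N) (Fin N) ℝ) : Matrix (Fin N) (Fin N) ℂ :=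
  M + (((N : ℝ) ^ (-γ) : ℝ) : ℂ) • G.map (fun x : ℝ => (x : ℂ))

/-- Random measures `L N` on `ℂ` converge to `μ` weakly in probability: for every bounded
continuous `f`, the integrals `∫ f dL_N` converge to `∫ f dμ` in probability. -/
def TendstoWeaklyInProbability {Ω : Type*} [MeasurableSpace Ω] (P : Measure Ω)
    (L : ℕ → Ω → Measure ℂ) (μ : Measure ℂ) : Prop :=
  ∀ f : ℂ →ᵇ ℝ,
    TendstoInMeasure P (fun N ω => ∫ z, f z ∂(L N ω)) atTop (fun _ => ∫ z, f z ∂μ)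

section LinearAlgebra

open Matrix
open scoped Matrix.Norms.L2Operator

theorem Matrix.norm_toLp_conjTranspose_mulVec_sq {m : Type*} [Fintype m]
    (A : Matrix m m ℂ) (v : m → ℂ) :
    ((‖WithLp.toLp 2 (Aᴴ *ᵥ v)‖ ^ 2 : ℝ) : ℂ) = star v ⬝ᵥ ((A * Aᴴ) *ᵥ v) := by
  rw [← Matrix.mulVec_mulVec, Matrix.dotProduct_mulVec, ← Matrix.conjTranspose_conjTranspose A,
    ← Matrix.star_mulVec, Matrix.conjTranspose_conjTranspose, dotProduct_comm]
  have h := EuclideanSpace.inner_toLp_toLp (𝕜 := ℂ) (Aᴴ *ᵥ v) (Aᴴ *ᵥ v)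
  rw [← h, inner_self_eq_norm_sq_to_K]
  simp

variable {n : Type*} [Fintype n] [DecidableEq n]

theorem Matrix.l2_opNorm_le_of_forall {A : Matrix n n ℂ} {M : ℝ} (hM : 0 ≤ M)
    (h : ∀ v : n → ℂ, ‖WithLp.toLp 2 (A *ᵥ v)‖ ≤ M * ‖WithLp.toLp 2 v‖) : ‖A‖ ≤ M := by
  rw [l2_opNorm_def]
  refine ContinuousLinearMap.opNorm_le_bound _ hM fun v => ?_
  exact h v.ofLp

theorem Matrix.norm_mulVec_le (A : Matrix n n ℂ) (v : n → ℂ) :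
    ‖WithLp.toLp 2 (A *ᵥ v)‖ ≤ ‖A‖ * ‖WithLp.toLp 2 v‖ :=
  l2_opNorm_mulVec A (WithLp.toLp 2 v)

theorem Matrix.norm_le_of_mem_roots_charpoly {A : Matrix n n ℂ} {z : ℂ}
    (hz : z ∈ A.charpoly.roots) : ‖z‖ ≤ ‖A‖ := by
  cases isEmpty_or_nonempty n
  · simp [Matrix.charpoly] at hz
  · exact spectrum.norm_le_norm_of_mem
      (mem_spectrum_of_isRoot_charpoly (Polynomial.isRoot_of_mem_roots hz))

theorem Matrix.card_roots_charpoly (A : Matrix n n ℂ) :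
    A.charpoly.roots.card = Fintype.card n := by
  rw [← A.charpoly_natDegree_eq_dim]
  exact (IsAlgClosed.splits A.charpoly).natDegree_eq_card_roots.symm

theorem Matrix.eval_charpoly_eq_prod (A : Matrix n n ℂ) (z : ℂ) :
    (scalar n z - A).det = (A.charpoly.roots.map fun l => z - l).prod := by
  rw [← Matrix.eval_charpoly]
  conv_lhs => rw [(IsAlgClosed.splits A.charpoly).eq_prod_roots_of_monic A.charpoly_monic]
  simp [Polynomial.eval_multiset_prod, Multiset.map_map]

theorem Multiset.norm_prod_le_pow {s : Multiset ℂ} {M : ℝ} (hs : ∀ z ∈ s, ‖z‖ ≤ M) :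
    ‖s.prod‖ ≤ M ^ s.card := by
  induction s using Multiset.induction_on with
  | empty => simp
  | cons a s ih =>
    have h1 := hs a (Multiset.mem_cons_self a s)
    have h2 := ih fun z hz => hs z (Multiset.mem_cons_of_mem hz)
    rw [Multiset.prod_cons, norm_mul, Multiset.card_cons, pow_succ']
    exact mul_le_mul h1 h2 (norm_nonneg _) ((norm_nonneg _).trans h1)

theorem Multiset.pow_le_norm_prod {s : Multiset ℂ} {m : ℝ} (hm : 0 ≤ m)
    (hs : ∀ z ∈ s, m ≤ ‖z‖) : m ^ s.card ≤ ‖s.prod‖ := by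
  induction s using Multiset.induction_on with
  | empty => simp
  | cons a s ih =>
    have h1 := hs a (Multiset.mem_cons_self a s)
    have h2 := ih fun z hz => hs z (Multiset.mem_cons_of_mem hz)
    rw [Multiset.prod_cons, norm_mul, Multiset.card_cons, pow_succ']
    exact mul_le_mul h1 h2 (pow_nonneg hm _) (norm_nonneg _)

theorem Matrix.norm_det_le_pow (A : Matrix n n ℂ) : ‖A.det‖ ≤ ‖A‖ ^ Fintype.card n := by
  rw [det_eq_prod_roots_charpoly, ← A.card_roots_charpoly]
  exact Multiset.norm_prod_le_pow fun z hz => norm_le_of_mem_roots_charpoly hz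

theorem Matrix.pow_le_norm_det_one_add {A : Matrix n n ℂ} {e : ℝ} (hA : ‖A‖ ≤ e) (he : e ≤ 1) :
    (1 - e) ^ Fintype.card n ≤ ‖(1 + A).det‖ := by
  have h : (1 + A) = scalar n 1 - (-A) := by simp
  rw [h, eval_charpoly_eq_prod, ← (-A).card_roots_charpoly,
    ← Multiset.card_map (fun l => (1 : ℂ) - l)]
  refine Multiset.pow_le_norm_prod (by linarith) fun z hz => ?_
  obtain ⟨l, hl, rfl⟩ := Multiset.mem_map.1 hz
  have h1 := norm_le_of_mem_roots_charpoly hl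
  have h2 := norm_sub_norm_le (1 : ℂ) l
  simp only [norm_neg, norm_one] at h1 h2
  linarith

/-- A perturbation bound from below for a determinant, `κ` being a bound for the inverse. -/
theorem Matrix.le_norm_det_add {B E : Matrix n n ℂ} {κ e : ℝ} (hκ : 0 ≤ κ)
    (hB : ∀ v : n → ℂ, ‖WithLp.toLp 2 v‖ ≤ κ * ‖WithLp.toLp 2 (B *ᵥ v)‖)
    (hE : ‖E‖ ≤ e) (he : κ * e ≤ 1) :
    ‖B.det‖ * (1 - κ * e) ^ Fintype.card n ≤ ‖(B + E).det‖ := by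
  have hu : IsUnit B := by
    rw [← Matrix.mulVec_injective_iff_isUnit]
    intro v w hvw
    have h1 := hB (v - w)
    have h2 : B *ᵥ (v - w) = 0 := by
      rw [Matrix.mulVec_sub]; exact sub_eq_zero.2 hvw
    rw [h2] at h1
    simp only [WithLp.toLp_zero, norm_zero, mul_zero] at h1
    have h3 : WithLp.toLp 2 (v - w) = 0 := norm_le_zero_iff.1 h1
    have h4 : v - w = 0 := (WithLp.toLp_injective 2) h3
    exact sub_eq_zero.1 h4
  have hdet : IsUnit B.det := (Matrix.isUnit_iff_isUnit_det B).1 hu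
  have h1 : B + E = B * (1 + B⁻¹ * E) := by
    rw [Matrix.mul_add, Matrix.mul_one, ← Matrix.mul_assoc, Matrix.mul_nonsing_inv B hdet,
      Matrix.one_mul]
  rw [h1, Matrix.det_mul, norm_mul]
  refine mul_le_mul_of_nonneg_left (pow_le_norm_det_one_add ?_ he) (norm_nonneg _)
  refine l2_opNorm_le_of_forall (mul_nonneg hκ ((norm_nonneg _).trans hE)) fun v => ?_
  refine (hB _).trans ?_
  rw [Matrix.mulVec_mulVec, ← Matrix.mul_assoc, Matrix.mul_nonsing_inv B hdet, Matrix.one_mul,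
    mul_assoc]
  refine mul_le_mul_of_nonneg_left ((norm_mulVec_le E v).trans ?_) hκ
  exact mul_le_mul_of_nonneg_right hE (norm_nonneg _)

open scoped MatrixOrder ComplexOrder in
/-- A perturbation bound from above for a determinant. -/
theorem Matrix.norm_det_add_sq_le {A E : Matrix n n ℂ} {τ e : ℝ} (hτ : 0 < τ) (hE : ‖E‖ ≤ e) :
    ‖(A + E).det‖ ^ 2 ≤ (1 + e / √τ) ^ (2 * Fintype.card n) *
      ‖(A * Aᴴ + (τ : ℂ) • 1).det‖ := by
  have he : 0 ≤ e := (norm_nonneg _).trans hE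
  have hpd : (A * Aᴴ + (τ : ℂ) • (1 : Matrix n n ℂ)).PosDef := by
    have h1 : ((τ : ℂ) • (1 : Matrix n n ℂ)).PosDef :=
      Matrix.PosDef.one.smul (by exact_mod_cast hτ)
    rw [add_comm]
    exact h1.add_posSemidef (posSemidef_self_mul_conjTranspose A)
  obtain ⟨S, hS⟩ := CStarAlgebra.nonneg_iff_eq_mul_star_self.1 hpd.posSemidef.nonneg
  rw [Matrix.star_eq_conjTranspose] at hS
  have hdet : (A * Aᴴ + (τ : ℂ) • (1 : Matrix n n ℂ)).det ≠ 0 := hpd.det_pos.ne'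
  have hSdet : S.det ≠ 0 := by
    intro h0
    rw [hS, Matrix.det_mul, h0, zero_mul] at hdet
    exact hdet rfl
  have hSu : IsUnit S.det := isUnit_iff_ne_zero.2 hSdet
  have hSHu : IsUnit Sᴴ.det := by
    rw [Matrix.det_conjTranspose]; exact hSu.star
  have key : ∀ u : n → ℂ, ‖WithLp.toLp 2 (Aᴴ *ᵥ u)‖ ^ 2 + τ * ‖WithLp.toLp 2 u‖ ^ 2
      = ‖WithLp.toLp 2 (Sᴴ *ᵥ u)‖ ^ 2 := by
    intro u
    have h1 := norm_toLp_conjTranspose_mulVec_sq A u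
    have h2 := norm_toLp_conjTranspose_mulVec_sq S u
    have h3 := norm_toLp_conjTranspose_mulVec_sq (1 : Matrix n n ℂ) u
    rw [← hS, Matrix.add_mulVec, dotProduct_add, ← h1, Matrix.smul_mulVec, dotProduct_smul] at h2
    simp only [Matrix.conjTranspose_one, Matrix.mul_one, Matrix.one_mulVec] at h3 h2
    rw [← h3, smul_eq_mul] at h2
    exact_mod_cast h2.symm
  have hinv : ∀ y : n → ℂ, Sᴴ *ᵥ (Sᴴ⁻¹ *ᵥ y) = y := fun y => by
    rw [Matrix.mulVec_mulVec, Matrix.mul_nonsing_inv _ hSHu, Matrix.one_mulVec]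
  have hnA : ‖S⁻¹ * A‖ ≤ 1 := by
    rw [← l2_opNorm_conjTranspose, Matrix.conjTranspose_mul, Matrix.conjTranspose_nonsing_inv]
    refine l2_opNorm_le_of_forall zero_le_one fun y => ?_
    have h1 := key (Sᴴ⁻¹ *ᵥ y)
    rw [hinv] at h1
    rw [one_mul, ← Matrix.mulVec_mulVec]
    refine le_of_sq_le_sq ?_ (norm_nonneg _)
    nlinarith [sq_nonneg ‖WithLp.toLp 2 (Sᴴ⁻¹ *ᵥ y)‖]
  have hnS : ‖S⁻¹‖ ≤ 1 / √τ := by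
    rw [← l2_opNorm_conjTranspose, Matrix.conjTranspose_nonsing_inv]
    refine l2_opNorm_le_of_forall (by positivity) fun y => ?_
    have h1 := key (Sᴴ⁻¹ *ᵥ y)
    rw [hinv] at h1
    have h2 : (√τ) ^ 2 = τ := Real.sq_sqrt hτ.le
    have h3 : 0 < √τ := Real.sqrt_pos.2 hτ
    rw [div_mul_eq_mul_div, one_mul, le_div_iff₀ h3]
    refine le_of_sq_le_sq ?_ (norm_nonneg _)
    rw [mul_pow, h2]
    nlinarith [sq_nonneg ‖WithLp.toLp 2 (Aᴴ *ᵥ (Sᴴ⁻¹ *ᵥ y))‖]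
  have hfac : A + E = S * (S⁻¹ * A + S⁻¹ * E) := by
    rw [← Matrix.mul_add, ← Matrix.mul_assoc, Matrix.mul_nonsing_inv S hSu, Matrix.one_mul]
  have hnX : ‖S⁻¹ * A + S⁻¹ * E‖ ≤ 1 + e / √τ := by
    refine (norm_add_le _ _).trans (add_le_add hnA ?_)
    refine (l2_opNorm_mul _ _).trans ?_
    calc ‖S⁻¹‖ * ‖E‖ ≤ 1 / √τ * e := mul_le_mul hnS hE (norm_nonneg _) (by positivity)
      _ = e / √τ := by ring
  rw [hS, hfac, Matrix.det_mul, Matrix.det_mul, Matrix.det_conjTranspose, norm_mul, norm_mul,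
    norm_star, mul_pow, mul_comm, ← sq]
  refine mul_le_mul_of_nonneg_right ?_ (sq_nonneg _)
  rw [mul_comm 2, pow_mul]
  refine pow_le_pow_left₀ (norm_nonneg _) ((norm_det_le_pow _).trans ?_) 2
  exact pow_le_pow_left₀ (norm_nonneg _) hnX _

end LinearAlgebra

section Bidiagonal

open Matrix
open scoped Matrix.Norms.L2Operator

/-- The upper bidiagonal `d × d` matrix with diagonal entries `x` and superdiagonal entries `-1`. -/
def bidiag (d : ℕ) (x : ℂ) : Matrix (Fin d) (Fin d) ℂ :=
  Matrix.of fun i j => if i = j then x else if (i : ℕ) + 1 = (j : ℕ) then -1 else 0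

theorem scalar_sub_jordanBlock (d : ℕ) (z c : ℂ) :
    scalar (Fin d) z - jordanBlock d c = bidiag d (z - c) := by
  ext i j
  by_cases h : i = j
  · subst h; simp [jordanBlock, bidiag]
  · by_cases h1 : (i : ℕ) + 1 = j <;> simp [jordanBlock, bidiag, h, h1]

/-- The tridiagonal matrix with constant diagonals except for the last diagonal entry. -/
def tridiag (d : ℕ) (q q' b c : ℂ) : Matrix (Fin d) (Fin d) ℂ :=
  Matrix.of fun i j => if i = j then (if (i : ℕ) + 1 = d then q' else q) else
    if (i : ℕ) + 1 = (j : ℕ) then b else if (j : ℕ) + 1 = (i : ℕ) then c else 0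

theorem det_tridiag_one (q q' b c : ℂ) : (tridiag 1 q q' b c).det = q' := by
  simp [tridiag]

theorem det_tridiag_succ_succ (d : ℕ) (q q' b c : ℂ) :
    (tridiag (d + 2) q q' b c).det =
      q * (tridiag (d + 1) q q' b c).det - b * c * (tridiag d q q' b c).det := by
  have h0 : (tridiag (d + 2) q q' b c).submatrix Fin.succ (Fin.succAbove 0) =
      tridiag (d + 1) q q' b c := by
    ext i j
    simp [tridiag, Fin.ext_iff]
  have h1 : ((tridiag (d + 2) q q' b c).submatrix Fin.succ (Fin.succAbove 1)).det =
      c * (tridiag d q q' b c).det := by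
    rw [det_succ_column_zero, Fin.sum_univ_succ, Finset.sum_eq_zero]
    · have h2 : (((tridiag (d + 2) q q' b c).submatrix Fin.succ (Fin.succAbove 1)).submatrix
          (Fin.succAbove 0) Fin.succ) = tridiag d q q' b c := by
        ext i j
        have : (Fin.succAbove (1 : Fin (d + 2)) j.succ) = j.succ.succ := by
          rw [← Fin.succ_zero_eq_one, Fin.succ_succAbove_succ]; simp
        simp [tridiag, Fin.ext_iff, this]
      rw [h2]
      simp [tridiag, Fin.ext_iff]
    · intro i _
      simp [tridiag, Fin.ext_iff]
  rw [det_succ_row_zero, Fin.sum_univ_succ, Fin.sum_univ_succ, Finset.sum_eq_zero]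
  · rw [h0, Fin.succ_zero_eq_one, h1]
    simp [tridiag, Fin.ext_iff]
    ring
  · intro i _
    simp [tridiag, Fin.ext_iff]

theorem bidiag_mul_conjTranspose_add (d : ℕ) (x : ℂ) (τ : ℂ) :
    bidiag d x * (bidiag d x)ᴴ + τ • 1 =
      tridiag d (x * star x + 1 + τ) (x * star x + τ) (-star x) (-x) := by
  ext i j
  simp only [Matrix.add_apply, mul_apply, conjTranspose_apply, Matrix.smul_apply, one_apply,
    smul_eq_mul]
  have hi : ∀ k : Fin d, bidiag d x i k = (if i = k then x else 0) +
      (if (i : ℕ) + 1 = (k : ℕ) then -1 else 0) := by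
    intro k
    simp only [bidiag, of_apply]
    by_cases h : i = k
    · subst h; simp
    · simp [h]
  simp only [hi, add_mul, ite_mul, zero_mul, Finset.sum_add_distrib]
  rw [Finset.sum_ite_eq]
  by_cases hd : (i : ℕ) + 1 < d
  · have h2 : ∀ k : Fin d, ((i : ℕ) + 1 = (k : ℕ)) ↔ (⟨i + 1, hd⟩ : Fin d) = k := by
      intro k; rw [Fin.ext_iff]
    simp only [h2, Finset.sum_ite_eq, Finset.mem_univ, if_true]
    simp only [bidiag, tridiag, of_apply, Fin.ext_iff]
    by_cases h3 : (i : ℕ) = j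
    · have h4 : (j : ℕ) ≠ i + 1 := by omega
      have h5 : ¬ ((j : ℕ) + 1 = i) := by omega
      have h6 : ¬ ((i : ℕ) + 1 = d) := by omega
      simp [h3]
      have : ¬ ((j : ℕ) + 1 = d) := by omega
      simp [this]
    · by_cases h4 : (i : ℕ) + 1 = j
      · have : ¬ ((j : ℕ) = i) := by omega
        have h5 : ¬ ((j : ℕ) + 1 = i) := by omega
        simp [← h4]
        omega
      · have h5 : ¬ ((j : ℕ) = i) := by omega
        have h6 : ¬ ((j : ℕ) = i + 1) := by omega
        by_cases h7 : (j : ℕ) + 1 = i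
        · simp [h3, h4, h5, h6, h7]
        · simp [h3, h4, h5, h6, h7]
  · have h2 : ∀ k : Fin d, ¬ ((i : ℕ) + 1 = (k : ℕ)) := by intro k; have := k.2; omega
    simp only [h2, if_false, Finset.sum_const_zero, Finset.mem_univ, if_true]
    simp only [bidiag, tridiag, of_apply, Fin.ext_iff]
    have h8 : (i : ℕ) + 1 = d := by have := i.2; omega
    have h9 := h2 j
    by_cases h3 : (i : ℕ) = j
    · simp [h3] at *
      simp [h8]
    · have h5 : ¬ ((j : ℕ) = i) := by omega
      by_cases h7 : (j : ℕ) + 1 = i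
      · simp [h3, h5, h7, h9]
      · simp [h3, h5, h7, h9]

/-- The determinants `det (B Bᴴ + τ)` for the bidiagonal matrix `B` of size `d` with diagonal
entries of squared modulus `w`. -/
noncomputable def gramDet (w τ : ℝ) : ℕ → ℝ
  | 0 => 1
  | 1 => w + τ
  | (d + 2) => (w + 1 + τ) * gramDet w τ (d + 1) - w * gramDet w τ d

theorem det_bidiag_gram (d : ℕ) (x : ℂ) (τ : ℝ) :
    (bidiag d x * (bidiag d x)ᴴ + (τ : ℂ) • 1).det = (gramDet (‖x‖ ^ 2) τ d : ℂ) := by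
  have hx : x * star x = ((‖x‖ ^ 2 : ℝ) : ℂ) := by
    rw [Complex.star_def, Complex.mul_conj, Complex.normSq_eq_norm_sq]
  rw [bidiag_mul_conjTranspose_add, hx]
  induction d using Nat.twoStepInduction with
  | zero => simp [gramDet]
  | one => rw [det_tridiag_one]; simp [gramDet]
  | more d ih1 ih2 =>
    rw [det_tridiag_succ_succ, ih1, ih2, gramDet, neg_mul_neg, mul_comm (star x), hx]
    push_cast; ring

theorem gramDet_succ (w τ : ℝ) (d : ℕ) :
    gramDet w τ (d + 1) = w * gramDet w τ d + τ * ∑ j ∈ Finset.range (d + 1), gramDet w τ j := by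
  induction d with
  | zero => simp [gramDet]
  | succ d ih =>
    rw [Finset.sum_range_succ, gramDet]
    linear_combination ih

theorem gramDet_nonneg {w τ : ℝ} (hw : 0 ≤ w) (hτ : 0 ≤ τ) (d : ℕ) : 0 ≤ gramDet w τ d := by
  induction d using Nat.strong_induction_on with
  | _ d ih =>
    cases d with
    | zero => simp [gramDet]
    | succ d =>
      rw [gramDet_succ]
      refine add_nonneg (mul_nonneg hw (ih d (by omega))) (mul_nonneg hτ ?_)
      exact Finset.sum_nonneg fun j hj => ih j (Finset.mem_range.1 hj)

/-- Growth of the partial sums of `gramDet`. -/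
theorem sum_gramDet_add_le {w τ ε m : ℝ} (hw : 0 ≤ w) (hτ : 0 ≤ τ) (hε : 0 < ε)
    (hτε : (1 + 1 / ε) * τ ≤ ε) (hm : 1 ≤ m) (hwm : w ≤ m) (d : ℕ) :
    (∑ j ∈ Finset.range (d + 1), gramDet w τ j) + 1 / ε * gramDet w τ d ≤
      (1 + 1 / ε) * ((1 + ε) * m) ^ d := by
  induction d with
  | zero => simp [gramDet]
  | succ d ih =>
    set T := ∑ j ∈ Finset.range (d + 1), gramDet w τ j with hT
    have hT0 : 0 ≤ T := Finset.sum_nonneg fun j _ => gramDet_nonneg hw hτ j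
    have hD0 := gramDet_nonneg hw hτ d
    rw [Finset.sum_range_succ, ← hT, gramDet_succ, ← hT, pow_succ]
    set D := gramDet w τ d
    have h1 : T + (w * D + τ * T) + 1 / ε * (w * D + τ * T)
        = T * (1 + (1 + 1 / ε) * τ) + (1 / ε * D) * ((1 + ε) * w) := by
      field_simp; ring
    have h2 : T * (1 + (1 + 1 / ε) * τ) ≤ T * ((1 + ε) * m) := by
      refine mul_le_mul_of_nonneg_left ?_ hT0
      nlinarith
    have h3 : (1 / ε * D) * ((1 + ε) * w) ≤ (1 / ε * D) * ((1 + ε) * m) := by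
      refine mul_le_mul_of_nonneg_left ?_ (by positivity)
      exact mul_le_mul_of_nonneg_left hwm (by positivity)
    rw [h1]
    calc _ ≤ (T + 1 / ε * D) * ((1 + ε) * m) := by linarith
      _ ≤ _ := by
        rw [← mul_assoc (1 + 1 / ε)]
        exact mul_le_mul_of_nonneg_right ih (mul_nonneg (by positivity) (by linarith))

theorem gramDet_le_of_le_one {w τ ε : ℝ} (hw : 0 ≤ w) (hτ : 0 ≤ τ) (hε : 0 < ε)
    (hτε : (1 + 1 / ε) * τ ≤ ε) (hw1 : w ≤ 1) (d : ℕ) :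
    gramDet w τ d ≤ w ^ d + τ * (d * ((1 + 1 / ε) * (1 + ε) ^ d)) := by
  induction d with
  | zero => simp [gramDet]
  | succ d ih =>
    have h1 := sum_gramDet_add_le hw hτ hε hτε le_rfl hw1 d
    rw [mul_one] at h1
    have h2 : 0 ≤ 1 / ε * gramDet w τ d := mul_nonneg (by positivity) (gramDet_nonneg hw hτ d)
    set M := (1 + 1 / ε) * (1 + ε) ^ d with hM
    have hM0 : 0 ≤ M := by positivity
    have h3 : M ≤ (1 + 1 / ε) * (1 + ε) ^ (d + 1) :=
      mul_le_mul_of_nonneg_left (pow_le_pow_right₀ (by linarith) (by omega)) (by positivity)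
    rw [gramDet_succ]
    have h4 : w * gramDet w τ d ≤ w ^ (d + 1) + τ * (d * M) := by
      calc w * gramDet w τ d ≤ w * (w ^ d + τ * (d * M)) := mul_le_mul_of_nonneg_left ih hw
        _ = w ^ (d + 1) + w * (τ * (d * M)) := by ring
        _ ≤ w ^ (d + 1) + 1 * (τ * (d * M)) := by
          have : 0 ≤ τ * (d * M) := by positivity
          nlinarith
        _ = _ := by ring
    have h5 : τ * ∑ j ∈ Finset.range (d + 1), gramDet w τ j ≤ τ * M :=
      mul_le_mul_of_nonneg_left (by linarith) hτ
    have h6 : τ * (((d + 1 : ℕ) : ℝ) * M) ≤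
        τ * (((d + 1 : ℕ) : ℝ) * ((1 + 1 / ε) * (1 + ε) ^ (d + 1))) := by gcongr
    push_cast at h6 ⊢
    linarith

theorem gramDet_le {w τ ε : ℝ} (hw : 0 ≤ w) (hτ : 0 ≤ τ) (hε : 0 < ε) (hε1 : ε ≤ 1)
    (hτε : (1 + 1 / ε) * τ ≤ ε) {d : ℕ} (hd : 0 < d) :
    gramDet w τ d ≤ 2 * d * (1 + 1 / ε) * (1 + ε) ^ d * max (w ^ d) τ := by
  have hd1 : (1 : ℝ) ≤ d := by exact_mod_cast hd
  have hε2 : (1 : ℝ) ≤ 1 + 1 / ε := by have : 0 < 1 / ε := by positivity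
                                       linarith
  have hM1 : 1 ≤ (1 + 1 / ε) * (1 + ε) ^ d :=
    one_le_mul_of_one_le_of_one_le hε2 (one_le_pow₀ (by linarith))
  have hm1 := le_max_left (w ^ d) τ
  have hm2 := le_max_right (w ^ d) τ
  set M := (1 + 1 / ε) * (1 + ε) ^ d
  set m := max (w ^ d) τ
  have hm0 : 0 ≤ m := hτ.trans hm2
  have hdM : 1 ≤ d * M := one_le_mul_of_one_le_of_one_le hd1 hM1
  have hgoal : 2 * d * (1 + 1 / ε) * (1 + ε) ^ d * m = 2 * (d * M) * m := by
    simp only [M]; ring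
  rw [hgoal]
  rcases le_total w 1 with h | h
  · have h1 := gramDet_le_of_le_one hw hτ hε hτε h d
    have h2 : τ * (d * M) ≤ m * (d * M) := mul_le_mul_of_nonneg_right hm2 (by linarith)
    have h3 : m * 1 ≤ m * (d * M) := mul_le_mul_of_nonneg_left hdM hm0
    change _ ≤ w ^ d + τ * (d * M) at h1
    linarith
  · have h1 := sum_gramDet_add_le hw hτ hε hτε h le_rfl d
    have h2 : 0 ≤ ∑ j ∈ Finset.range (d + 1), gramDet w τ j :=
      Finset.sum_nonneg fun j _ => gramDet_nonneg hw hτ j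
    have hD := gramDet_nonneg hw hτ d
    have h3 : gramDet w τ d ≤ 1 / ε * gramDet w τ d :=
      le_mul_of_one_le_left hD (by rw [le_div_iff₀ hε]; linarith)
    have h4 : (1 + 1 / ε) * ((1 + ε) * w) ^ d = M * w ^ d := by rw [mul_pow]; ring
    have h5 : M * w ^ d ≤ M * m := mul_le_mul_of_nonneg_left hm1 (by linarith)
    have h6 : M * m ≤ (d * M) * m :=
      mul_le_mul_of_nonneg_right (le_mul_of_one_le_left (by linarith) hd1) hm0
    have h7 : 0 ≤ (d * M) * m := mul_nonneg (by linarith) hm0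
    linarith

end Bidiagonal

section InverseBounds

open Matrix
open scoped Matrix.Norms.L2Operator

/-- The matrix `bidiag d x` with its last row replaced by the first unit vector. -/
def bidiagCyc (d : ℕ) (x : ℂ) : Matrix (Fin d) (Fin d) ℂ :=
  Matrix.of fun i j => if (i : ℕ) + 1 = d then (if (j : ℕ) = 0 then 1 else 0) else bidiag d x i j

theorem det_bidiag (d : ℕ) (x : ℂ) : (bidiag d x).det = x ^ d := by
  rw [Matrix.det_of_isUpperTriangular]
  · simp [bidiag]
  · intro i j hij
    have h : (j : ℕ) < i := hij
    have h1 : i ≠ j := by rintro rfl; omega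
    have h2 : ¬ ((i : ℕ) + 1 = j) := by omega
    simp [bidiag, h1, h2]

theorem norm_det_bidiagCyc {d : ℕ} (hd : 0 < d) (x : ℂ) : ‖(bidiagCyc d x).det‖ = 1 := by
  obtain ⟨n, rfl⟩ : ∃ n, d = n + 1 := ⟨d - 1, by omega⟩
  set P : Matrix (Fin (n + 1)) (Fin (n + 1)) ℂ := Matrix.of fun i j =>
    if (i : ℕ) = 0 then (if (j : ℕ) = 0 then 1 else 0) else
      if (j : ℕ) = i then -1 else if (j : ℕ) + 1 = i then x else 0 with hP
  have h : bidiagCyc (n + 1) x = P.submatrix (finRotate (n + 1)) id := by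
    ext i j
    rcases Fin.eq_castSucc_or_eq_last i with ⟨k, rfl⟩ | rfl
    · have h1 : (k : ℕ) ≠ n := k.2.ne
      have h2 : finRotate (n + 1) k.castSucc = k.succ := by
        rw [finRotate_apply]; exact Fin.coeSucc_eq_succ
      simp only [bidiagCyc, bidiag, hP, Matrix.of_apply, Matrix.submatrix_apply, id_eq, h2,
        Fin.val_castSucc, Fin.val_succ, Fin.ext_iff]
      have h3 : ¬ ((k : ℕ) + 1 = n + 1) := by omega
      by_cases h4 : (k : ℕ) = j
      · simp [← h4, h1]
      · by_cases h5 : (k : ℕ) + 1 = j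
        · simp [h1, ← h5]
        · have h6 : ¬ ((j : ℕ) = k + 1) := by omega
          have h7 : ¬ ((j : ℕ) = k) := by omega
          simp [h1, h4, h5, h6, h7]
    · simp [bidiagCyc, hP]
  have hPdet : ‖P.det‖ = 1 := by
    rw [Matrix.det_of_isLowerTriangular, norm_prod]
    · refine Finset.prod_eq_one fun i _ => ?_
      simp only [hP, Matrix.of_apply]
      split_ifs <;> simp
    · intro i j hij
      have hij : (i : ℕ) < j := hij
      have h1 : ¬ ((j : ℕ) = 0) := by omega
      have h2 : ¬ ((j : ℕ) = i) := by omega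
      have h3 : ¬ ((j : ℕ) + 1 = i) := by omega
      simp only [hP, Matrix.of_apply, h1, h2, h3, if_false, ite_self]
  rw [h, Matrix.det_permute, norm_mul, hPdet]
  rcases Int.units_eq_one_or (Equiv.Perm.sign (finRotate (n + 1))) with hs | hs <;> simp [hs]

/-- The extension by zero of a vector to a sequence. -/
noncomputable def extendZero {d : ℕ} (v : Fin d → ℂ) (k : ℕ) : ℂ := if h : k < d then v ⟨k, h⟩ else 0

theorem extendZero_coe {d : ℕ} (v : Fin d → ℂ) (i : Fin d) : extendZero v i = v i := by
  simp [extendZero]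

theorem extendZero_of_le {d : ℕ} (v : Fin d → ℂ) {k : ℕ} (hk : d ≤ k) : extendZero v k = 0 := by
  simp [extendZero, hk]

theorem norm_toLp_sq_eq_sum_extendZero {d : ℕ} (v : Fin d → ℂ) :
    ‖WithLp.toLp 2 v‖ ^ 2 = ∑ k ∈ Finset.range d, ‖extendZero v k‖ ^ 2 := by
  rw [EuclideanSpace.norm_sq_eq, ← Fin.sum_univ_eq_sum_range]
  simp [extendZero_coe]

theorem extendZero_bidiag_mulVec {d : ℕ} (x : ℂ) (v : Fin d → ℂ) {k : ℕ} (hk : k < d) :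
    extendZero (bidiag d x *ᵥ v) k = x * extendZero v k - extendZero v (k + 1) := by
  have h0 : extendZero (bidiag d x *ᵥ v) k = (bidiag d x *ᵥ v) ⟨k, hk⟩ :=
    extendZero_coe _ ⟨k, hk⟩
  have hi : ∀ j : Fin d, bidiag d x ⟨k, hk⟩ j * v j = (if ⟨k, hk⟩ = j then x * v j else 0) +
      (if k + 1 = (j : ℕ) then - v j else 0) := by
    intro j
    simp only [bidiag, of_apply]
    by_cases h : ⟨k, hk⟩ = j
    · subst h; simp
    · by_cases h1 : k + 1 = j <;> simp [h, h1]
  rw [h0, mulVec, dotProduct, Finset.sum_congr rfl fun j _ => hi j, Finset.sum_add_distrib,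
    Finset.sum_ite_eq]
  have hv : extendZero v k = v ⟨k, hk⟩ := extendZero_coe v ⟨k, hk⟩
  simp only [Finset.mem_univ, if_true, hv, sub_eq_add_neg]
  congr 1
  by_cases h2 : k + 1 < d
  · have h3 : ∀ j : Fin d, (k + 1 = (j : ℕ)) ↔ (⟨k + 1, h2⟩ : Fin d) = j := by
      intro j; rw [Fin.ext_iff]
    simp only [h3, Finset.sum_ite_eq, Finset.mem_univ, if_true, extendZero, h2, dif_pos]
  · rw [extendZero_of_le v (by omega), neg_zero]
    refine Finset.sum_eq_zero fun j _ => if_neg ?_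
    have := j.2; omega

theorem extendZero_bidiagCyc_mulVec {d : ℕ} (x : ℂ) (v : Fin d → ℂ) {k : ℕ} (hk : k + 1 < d) :
    extendZero (bidiagCyc d x *ᵥ v) k = x * extendZero v k - extendZero v (k + 1) := by
  have hk' : k < d := by omega
  rw [← extendZero_bidiag_mulVec x v hk']
  simp only [extendZero, hk', dif_pos, mulVec, dotProduct]
  refine Finset.sum_congr rfl fun j _ => ?_
  simp [bidiagCyc, hk.ne]

theorem extendZero_bidiagCyc_mulVec_last {n : ℕ} (x : ℂ) (v : Fin (n + 1) → ℂ) :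
    extendZero (bidiagCyc (n + 1) x *ᵥ v) n = extendZero v 0 := by
  simp only [extendZero, Nat.lt_succ_self, dif_pos, mulVec, dotProduct, Nat.succ_pos]
  rw [Fin.sum_univ_succ]
  simp [bidiagCyc]

theorem norm_toLp_le_of_forall_le_sum {d : ℕ} {v u : Fin d → ℂ} {C : ℝ} (hC : 0 ≤ C)
    (h : ∀ k < d, ‖extendZero v k‖ ≤ C * ∑ j ∈ Finset.range d, ‖extendZero u j‖) :
    ‖WithLp.toLp 2 v‖ ≤ C * d * ‖WithLp.toLp 2 u‖ := by
  refine le_of_sq_le_sq ?_ (by positivity)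
  rw [mul_pow, norm_toLp_sq_eq_sum_extendZero, norm_toLp_sq_eq_sum_extendZero]
  set s := ∑ j ∈ Finset.range d, ‖extendZero u j‖
  have h1 : s ^ 2 ≤ d * ∑ k ∈ Finset.range d, ‖extendZero u k‖ ^ 2 := by
    have := sq_sum_le_card_mul_sum_sq (s := Finset.range d) (f := fun k => ‖extendZero u k‖)
    simpa using this
  calc ∑ k ∈ Finset.range d, ‖extendZero v k‖ ^ 2 ≤ ∑ k ∈ Finset.range d, (C * s) ^ 2 :=
        Finset.sum_le_sum fun k hk =>
          pow_le_pow_left₀ (norm_nonneg _) (h k (Finset.mem_range.1 hk)) 2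
    _ = C ^ 2 * d * s ^ 2 := by simp; ring
    _ ≤ C ^ 2 * d * (d * ∑ k ∈ Finset.range d, ‖extendZero u k‖ ^ 2) :=
        mul_le_mul_of_nonneg_left h1 (by positivity)
    _ = _ := by ring

theorem norm_le_bidiag_mulVec {d : ℕ} {x : ℂ} {a : ℝ} (ha : 0 < a) (ha1 : a ≤ 1) (hax : a ≤ ‖x‖)
    (v : Fin d → ℂ) :
    ‖WithLp.toLp 2 v‖ ≤ (a ^ d)⁻¹ * d * ‖WithLp.toLp 2 (bidiag d x *ᵥ v)‖ := by
  refine norm_toLp_le_of_forall_le_sum (by positivity) ?_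
  set u := bidiag d x *ᵥ v
  have key : ∀ m ≤ d, a ^ m * ‖extendZero v (d - m)‖ ≤
      ∑ j ∈ Finset.Ico (d - m) d, ‖extendZero u j‖ := by
    intro m
    induction m with
    | zero => intro _; simp [extendZero_of_le v le_rfl]
    | succ m ih =>
      intro hm
      have ih := ih (by omega)
      have h1 := extendZero_bidiag_mulVec x v (show d - (m + 1) < d by omega)
      have h2 : d - (m + 1) + 1 = d - m := by omega
      rw [h2] at h1
      have h3 : x * extendZero v (d - (m + 1)) = extendZero u (d - (m + 1)) +
          extendZero v (d - m) := by rw [h1]; ring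
      have h4 : a * ‖extendZero v (d - (m + 1))‖ ≤ ‖extendZero u (d - (m + 1))‖ +
          ‖extendZero v (d - m)‖ := by
        refine (mul_le_mul_of_nonneg_right hax (norm_nonneg _)).trans ?_
        rw [← norm_mul, h3]
        exact norm_add_le _ _
      rw [Finset.sum_eq_sum_Ico_succ_bot (by omega), h2, pow_succ, mul_assoc]
      have h5 : a ^ m ≤ 1 := pow_le_one₀ ha.le ha1
      have h6 : 0 ≤ a ^ m := by positivity
      nlinarith [mul_le_mul_of_nonneg_left h4 h6, norm_nonneg (extendZero u (d - (m + 1)))]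
  intro k hk
  have h1 := key (d - k) (by omega)
  rw [show d - (d - k) = k by omega] at h1
  rw [← div_eq_inv_mul, le_div_iff₀ (by positivity), mul_comm]
  refine (mul_le_mul_of_nonneg_right (pow_le_pow_of_le_one ha.le ha1 (Nat.sub_le d k))
    (norm_nonneg _)).trans (h1.trans ?_)
  refine Finset.sum_le_sum_of_subset_of_nonneg ?_ fun _ _ _ => norm_nonneg _
  intro j hj
  exact Finset.mem_range.2 (Finset.mem_Ico.1 hj).2

theorem add_mul_sq_le {p q w : ℝ} (hw : 0 ≤ w) (hw1 : w < 1) :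
    (p + w * q) ^ 2 ≤ p ^ 2 / (1 - w) + w * q ^ 2 := by
  have h : 0 < 1 - w := by linarith
  rw [div_add' _ _ _ h.ne', le_div_iff₀ h]
  nlinarith [mul_nonneg hw (sq_nonneg (p - (1 - w) * q))]

theorem norm_le_bidiag_mulVec_of_one_lt {d : ℕ} {x : ℂ} (hx : 1 < ‖x‖) (v : Fin d → ℂ) :
    ‖WithLp.toLp 2 v‖ ≤ (‖x‖ - 1)⁻¹ * ‖WithLp.toLp 2 (bidiag d x *ᵥ v)‖ := by
  refine le_of_sq_le_sq ?_ (mul_nonneg (inv_nonneg.2 (by linarith)) (norm_nonneg _))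
  rw [mul_pow, norm_toLp_sq_eq_sum_extendZero, norm_toLp_sq_eq_sum_extendZero]
  set u := bidiag d x *ᵥ v
  set w := ‖x‖⁻¹ with hw
  have hx0 : 0 < ‖x‖ := by linarith
  have hw0 : 0 < w := inv_pos.2 hx0
  have hw1 : w < 1 := inv_lt_one_of_one_lt₀ hx
  have h1 : ∀ k ∈ Finset.range d, ‖extendZero v k‖ ^ 2 ≤
      w ^ 2 / (1 - w) * ‖extendZero u k‖ ^ 2 + w * ‖extendZero v (k + 1)‖ ^ 2 := by
    intro k hk
    have h2 := extendZero_bidiag_mulVec x v (Finset.mem_range.1 hk)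
    have h3 : x * extendZero v k = extendZero u k + extendZero v (k + 1) := by rw [h2]; ring
    have h4 : ‖x‖ * ‖extendZero v k‖ ≤ ‖extendZero u k‖ + ‖extendZero v (k + 1)‖ := by
      rw [← norm_mul, h3]; exact norm_add_le _ _
    have h5 : ‖extendZero v k‖ ≤ w * ‖extendZero u k‖ + w * ‖extendZero v (k + 1)‖ := by
      rw [← mul_add, hw, ← div_eq_inv_mul, le_div_iff₀ hx0]; linarith
    refine (pow_le_pow_left₀ (norm_nonneg _) h5 2).trans ((add_mul_sq_le hw0.le hw1).trans ?_)
    rw [mul_pow, div_mul_eq_mul_div]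
  have h2 := Finset.sum_le_sum h1
  rw [Finset.sum_add_distrib, ← Finset.mul_sum, ← Finset.mul_sum] at h2
  have h3 : ∑ k ∈ Finset.range d, ‖extendZero v (k + 1)‖ ^ 2 ≤
      ∑ k ∈ Finset.range d, ‖extendZero v k‖ ^ 2 := by
    have h4 := Finset.sum_range_succ (fun k => ‖extendZero v k‖ ^ 2) d
    rw [Finset.sum_range_succ', extendZero_of_le v le_rfl] at h4
    simp only [norm_zero] at h4
    have := sq_nonneg ‖extendZero v 0‖
    linarith
  set V := ∑ k ∈ Finset.range d, ‖extendZero v k‖ ^ 2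
  set U := ∑ k ∈ Finset.range d, ‖extendZero u k‖ ^ 2
  have h4 : V * (1 - w) ≤ w ^ 2 / (1 - w) * U := by nlinarith
  have h5 : 0 < 1 - w := by linarith
  have h6 : (‖x‖ - 1)⁻¹ = w / (1 - w) := by
    have h7 : ‖x‖ - 1 ≠ 0 := by linarith
    have h8 : 1 - ‖x‖⁻¹ ≠ 0 := by rw [← hw]; exact h5.ne'
    rw [hw]; field_simp
  rw [h6, div_pow, div_mul_eq_mul_div, le_div_iff₀ (by positivity)]
  rw [div_mul_eq_mul_div, le_div_iff₀ h5] at h4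
  nlinarith

theorem norm_le_bidiagCyc_mulVec {d : ℕ} (hd : 0 < d) {x : ℂ} (hx : ‖x‖ ≤ 1) (v : Fin d → ℂ) :
    ‖WithLp.toLp 2 v‖ ≤ d * ‖WithLp.toLp 2 (bidiagCyc d x *ᵥ v)‖ := by
  obtain ⟨n, rfl⟩ : ∃ n, d = n + 1 := ⟨d - 1, by omega⟩
  have h0 : ∀ k < n + 1, ‖extendZero v k‖ ≤
      (∑ j ∈ Finset.range k, ‖extendZero (bidiagCyc (n + 1) x *ᵥ v) j‖) +
        ‖extendZero (bidiagCyc (n + 1) x *ᵥ v) n‖ := by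
    intro k
    induction k with
    | zero => intro _; simp [extendZero_bidiagCyc_mulVec_last]
    | succ k ih =>
      intro hk
      have ih := ih (by omega)
      have h1 := extendZero_bidiagCyc_mulVec x v hk
      have h2 : extendZero v (k + 1) = x * extendZero v k -
          extendZero (bidiagCyc (n + 1) x *ᵥ v) k := by rw [h1]; ring
      rw [Finset.sum_range_succ, h2]
      have h3 := norm_sub_le (x * extendZero v k) (extendZero (bidiagCyc (n + 1) x *ᵥ v) k)
      have h4 : ‖x * extendZero v k‖ ≤ ‖extendZero v k‖ := by
        rw [norm_mul]; exact mul_le_of_le_one_left (norm_nonneg _) hx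
      linarith
  have h1 := norm_toLp_le_of_forall_le_sum (v := v) (u := bidiagCyc (n + 1) x *ᵥ v)
    zero_le_one fun k hk => by
      rw [one_mul, Finset.sum_range_succ]
      refine (h0 k hk).trans (add_le_add ?_ le_rfl)
      refine Finset.sum_le_sum_of_subset_of_nonneg ?_ fun _ _ _ => norm_nonneg _
      exact Finset.range_subset_range.2 (by omega)
  rwa [one_mul] at h1

theorem norm_le_bidiagCyc_mulVec_of_lt_one {d : ℕ} (hd : 0 < d) {x : ℂ} (hx : ‖x‖ < 1)
    (v : Fin d → ℂ) :
    ‖WithLp.toLp 2 v‖ ≤ (1 - ‖x‖)⁻¹ * ‖WithLp.toLp 2 (bidiagCyc d x *ᵥ v)‖ := by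
  obtain ⟨n, rfl⟩ : ∃ n, d = n + 1 := ⟨d - 1, by omega⟩
  have h5 : 0 < 1 - ‖x‖ := by linarith
  refine le_of_sq_le_sq ?_ (mul_nonneg (inv_nonneg.2 h5.le) (norm_nonneg _))
  rw [mul_pow, norm_toLp_sq_eq_sum_extendZero, norm_toLp_sq_eq_sum_extendZero]
  set u := bidiagCyc (n + 1) x *ᵥ v
  have h1 : ∀ k ∈ Finset.range n, ‖extendZero v (k + 1)‖ ^ 2 ≤
      ‖extendZero u k‖ ^ 2 / (1 - ‖x‖) + ‖x‖ * ‖extendZero v k‖ ^ 2 := by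
    intro k hk
    have h2 := extendZero_bidiagCyc_mulVec x v
      (show k + 1 < n + 1 by have := Finset.mem_range.1 hk; omega)
    have h3 : extendZero v (k + 1) = x * extendZero v k - extendZero u k := by rw [h2]; ring
    have h4 : ‖extendZero v (k + 1)‖ ≤ ‖extendZero u k‖ + ‖x‖ * ‖extendZero v k‖ := by
      rw [← norm_mul, h3, add_comm ‖extendZero u k‖]; exact norm_sub_le _ _
    exact (pow_le_pow_left₀ (norm_nonneg _) h4 2).trans (add_mul_sq_le (norm_nonneg _) hx)
  have h2 := Finset.sum_le_sum h1
  rw [Finset.sum_add_distrib, ← Finset.sum_div, ← Finset.mul_sum] at h2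
  have hV := Finset.sum_range_succ' (fun k => ‖extendZero v k‖ ^ 2) n
  have hV' := Finset.sum_range_succ (fun k => ‖extendZero v k‖ ^ 2) n
  have hU := Finset.sum_range_succ (fun k => ‖extendZero u k‖ ^ 2) n
  have hl : extendZero u n = extendZero v 0 := extendZero_bidiagCyc_mulVec_last x v
  set V := ∑ k ∈ Finset.range (n + 1), ‖extendZero v k‖ ^ 2
  set U := ∑ k ∈ Finset.range (n + 1), ‖extendZero u k‖ ^ 2
  have h7 : (1 - ‖x‖) * (∑ k ∈ Finset.range n, ‖extendZero v (k + 1)‖ ^ 2) ≤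
      (∑ k ∈ Finset.range n, ‖extendZero u k‖ ^ 2) +
        (1 - ‖x‖) * (‖x‖ * ∑ k ∈ Finset.range n, ‖extendZero v k‖ ^ 2) := by
    rw [div_add' _ _ _ h5.ne', le_div_iff₀ h5] at h2
    linarith
  rw [inv_pow, ← div_eq_inv_mul, le_div_iff₀ (by positivity)]
  rw [hl] at hU
  have h8 := norm_nonneg x
  have h9 := sq_nonneg ‖extendZero v n‖
  have h10 := sq_nonneg ‖extendZero v 0‖
  have h11 : (1 - ‖x‖) * ‖x‖ * (∑ k ∈ Finset.range n, ‖extendZero v k‖ ^ 2) ≤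
      (1 - ‖x‖) * ‖x‖ * V :=
    mul_le_mul_of_nonneg_left (by linarith) (mul_nonneg h5.le h8)
  have h12 : (1 - ‖x‖) * ‖extendZero v 0‖ ^ 2 ≤ 1 * ‖extendZero v 0‖ ^ 2 :=
    mul_le_mul_of_nonneg_right (by linarith) h10
  nlinarith

theorem norm_le_blockDiagonal'_mulVec {l : ℕ} {d : Fin l → ℕ}
    {B : ∀ i, Matrix (Fin (d i)) (Fin (d i)) ℂ} {κ : ℝ} (hκ : 0 ≤ κ)
    (hB : ∀ i, ∀ v : Fin (d i) → ℂ, ‖WithLp.toLp 2 v‖ ≤ κ * ‖WithLp.toLp 2 (B i *ᵥ v)‖)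
    (v : (Σ i, Fin (d i)) → ℂ) :
    ‖WithLp.toLp 2 v‖ ≤ κ * ‖WithLp.toLp 2 (blockDiagonal' B *ᵥ v)‖ := by
  have h : ∀ i p, (blockDiagonal' B *ᵥ v) ⟨i, p⟩ = (B i *ᵥ fun q => v ⟨i, q⟩) p := by
    intro i p
    simp only [mulVec, dotProduct, Fintype.sum_sigma]
    rw [Finset.sum_eq_single i]
    · simp [blockDiagonal'_apply_eq]
    · intro j _ hj
      exact Finset.sum_eq_zero fun q _ => by
        rw [blockDiagonal'_apply_ne _ _ _ hj.symm, zero_mul]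
    · simp
  refine le_of_sq_le_sq ?_ (mul_nonneg hκ (norm_nonneg _))
  rw [mul_pow, EuclideanSpace.norm_sq_eq, EuclideanSpace.norm_sq_eq, Fintype.sum_sigma,
    Fintype.sum_sigma, Finset.mul_sum]
  refine Finset.sum_le_sum fun i _ => ?_
  have h1 := pow_le_pow_left₀ (norm_nonneg _) (hB i fun q => v ⟨i, q⟩) 2
  rw [mul_pow, EuclideanSpace.norm_sq_eq, EuclideanSpace.norm_sq_eq] at h1
  simpa [h] using h1

end InverseBounds

section GaussianRow

/-- The law of a vector of independent standard real normal variables. -/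
noncomputable abbrev stdGaussianRow (ι : Type*) [Fintype ι] : Measure (ι → ℝ) :=
  Measure.pi fun _ => gaussianReal 0 1

theorem stdGaussianRow_map_sum {ι : Type*} [Fintype ι] (β : ι → ℝ) :
    (stdGaussianRow ι).map (fun g => ∑ j, β j * g j) =
      gaussianReal 0 (∑ j, β j ^ 2).toNNReal := by
  have hm : Measurable (fun g : ι → ℝ => ∑ j, β j * g j) := by fun_prop
  have : IsProbabilityMeasure ((stdGaussianRow ι).map (fun g => ∑ j, β j * g j)) :=
    Measure.isProbabilityMeasure_map hm.aemeasurable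
  refine Measure.ext_of_charFun ?_
  ext t
  rw [charFun_apply_real, integral_map hm.aemeasurable (by fun_prop)]
  have h1 : ∀ g : ι → ℝ, Complex.exp (t * ((∑ j, β j * g j : ℝ) : ℂ) * Complex.I) =
      ∏ j, Complex.exp (((t * β j : ℝ) : ℂ) * (g j : ℂ) * Complex.I) := by
    intro g
    rw [← Complex.exp_sum, Complex.ofReal_sum, Finset.mul_sum, Finset.sum_mul]
    congr 1
    refine Finset.sum_congr rfl fun j _ => ?_
    push_cast; ring
  simp_rw [h1]
  rw [integral_fintype_prod_eq_prod (𝕜 := ℂ)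
    (fun j (x : ℝ) => Complex.exp (((t * β j : ℝ) : ℂ) * (x : ℂ) * Complex.I))]
  simp_rw [← charFun_apply_real, charFun_gaussianReal]
  rw [← Complex.exp_sum]
  congr 1
  have h2 : 0 ≤ ∑ j, β j ^ 2 := Finset.sum_nonneg fun j _ => sq_nonneg _
  rw [Real.coe_toNNReal _ h2]
  push_cast
  rw [Finset.sum_mul, Finset.sum_div, mul_zero, zero_mul, zero_sub, ← Finset.sum_neg_distrib]
  refine Finset.sum_congr rfl fun j _ => ?_
  ring

theorem lintegral_abs_rpow_Ioo {s : ℝ} (hs : 0 < s) :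
    ∫⁻ u in Set.Ioo (-s) s, ENNReal.ofReal (|u| ^ (-1 / 2 : ℝ)) ≤
      ENNReal.ofReal (4 * s ^ (1 / 2 : ℝ)) := by
  have h0 : ∫⁻ u in Set.Ioc 0 s, ENNReal.ofReal (|u| ^ (-1 / 2 : ℝ)) =
      ENNReal.ofReal (2 * s ^ (1 / 2 : ℝ)) := by
    have h1 : ∫ u in (0 : ℝ)..s, u ^ (-1 / 2 : ℝ) = 2 * s ^ (1 / 2 : ℝ) := by
      rw [integral_rpow (Or.inl (by norm_num)), Real.zero_rpow (by norm_num)]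
      norm_num
      ring
    have hi : IntegrableOn (fun u : ℝ => u ^ (-1 / 2 : ℝ)) (Set.Ioc 0 s) :=
      (intervalIntegrable_iff_integrableOn_Ioc_of_le hs.le).1
        (intervalIntegral.intervalIntegrable_rpow' (by norm_num))
    rw [← h1, intervalIntegral.integral_of_le hs.le, ofReal_integral_eq_lintegral_ofReal hi]
    · refine setLIntegral_congr_fun measurableSet_Ioc fun u hu => ?_
      simp only [abs_of_pos hu.1]
    · exact (ae_restrict_iff' measurableSet_Ioc).2 (ae_of_all _ fun u hu =>
        Real.rpow_nonneg hu.1.le _)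
  have h2 : ∫⁻ u in Set.Ico (-s) 0, ENNReal.ofReal (|u| ^ (-1 / 2 : ℝ)) =
      ENNReal.ofReal (2 * s ^ (1 / 2 : ℝ)) := by
    rw [← h0]
    have := (Measure.measurePreserving_neg (volume : Measure ℝ)).setLIntegral_comp_preimage_emb
      (MeasurableEquiv.neg ℝ).measurableEmbedding
      (fun u : ℝ => ENNReal.ofReal (|u| ^ (-1 / 2 : ℝ))) (Set.Ioc 0 s)
    simpa using this
  have hsub : Set.Ioo (-s) s ⊆ (Set.Ico (-s) 0 ∪ {0}) ∪ Set.Ioc 0 s := by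
    intro u hu
    rcases lt_trichotomy u 0 with h | h | h
    · exact Or.inl (Or.inl ⟨hu.1.le, h⟩)
    · exact Or.inl (Or.inr h)
    · exact Or.inr ⟨h, hu.2.le⟩
  refine (lintegral_mono_set hsub).trans ((lintegral_union_le _ _ _).trans ?_)
  refine (add_le_add (lintegral_union_le _ _ _) le_rfl).trans ?_
  rw [h0, h2, Measure.restrict_singleton]
  simp only [Real.volume_singleton, zero_smul, lintegral_zero_measure, add_zero]
  rw [← ENNReal.ofReal_add (by positivity) (by positivity)]
  exact ENNReal.ofReal_le_ofReal (by linarith)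

theorem enorm_rpow_eq_ofReal {E : Type*} [NormedAddCommGroup E] {x : E} (hx : x ≠ 0) (p : ℝ) :
    ‖x‖ₑ ^ p = ENNReal.ofReal (‖x‖ ^ p) := by
  rw [← ofReal_norm, ENNReal.ofReal_rpow_of_pos (norm_pos_iff.2 hx)]

/-- Negative moments of order one half of a shifted real Gaussian variable. -/
theorem lintegral_gaussianReal_rpow_le (a : ℝ) {v : ℝ≥0} (hv : 0 < v) :
    ∫⁻ y, ‖a + y‖ₑ ^ (-1 / 2 : ℝ) ∂(gaussianReal 0 v) ≤
      ENNReal.ofReal (5 * (v : ℝ) ^ (-1 / 4 : ℝ)) := by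
  have hv' : (0 : ℝ) < v := by exact_mod_cast hv
  set s : ℝ := √v with hs
  have hs0 : 0 < s := Real.sqrt_pos.2 hv'
  have hspow : ∀ p : ℝ, s ^ p = (v : ℝ) ^ (p / 2) := by
    intro p
    rw [hs, Real.sqrt_eq_rpow, ← Real.rpow_mul hv'.le]
    congr 1; ring
  have hpdf : ∀ y, gaussianPDF 0 v y ≤ ENNReal.ofReal (s⁻¹) := by
    intro y
    rw [gaussianPDF]
    refine ENNReal.ofReal_le_ofReal ?_
    rw [gaussianPDFReal]
    have h1 : Real.exp (-(y - 0) ^ 2 / (2 * v)) ≤ 1 := by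
      rw [Real.exp_le_one_iff]
      exact div_nonpos_of_nonpos_of_nonneg (by nlinarith [sq_nonneg (y - 0)]) (by positivity)
    have h2 : (√(2 * Real.pi * v))⁻¹ ≤ s⁻¹ := by
      refine inv_anti₀ hs0 (Real.sqrt_le_sqrt ?_)
      nlinarith [Real.pi_gt_three]
    have h3 : 0 ≤ (√(2 * Real.pi * v))⁻¹ := by positivity
    calc _ ≤ (√(2 * Real.pi * v))⁻¹ * 1 := mul_le_mul_of_nonneg_left h1 h3
      _ ≤ _ := by rw [mul_one]; exact h2
  have hm : Measurable fun y : ℝ => ‖a + y‖ₑ ^ (-1 / 2 : ℝ) := by fun_prop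
  set c : ℝ≥0∞ := ENNReal.ofReal ((v : ℝ) ^ (-1 / 4 : ℝ)) with hc
  set f : ℝ → ℝ≥0∞ := fun y => (Set.Ioo (-s) s).indicator
    (fun u => ENNReal.ofReal (|u| ^ (-1 / 2 : ℝ))) (a + y) with hf
  have hfm : Measurable f := by
    have h1 : Measurable ((Set.Ioo (-s) s).indicator
      (fun u : ℝ => ENNReal.ofReal (|u| ^ (-1 / 2 : ℝ)))) :=
      Measurable.indicator (by fun_prop) measurableSet_Ioo
    exact h1.comp (measurable_const_add a)
  have hae : ∀ᵐ y ∂(gaussianReal 0 v), ‖a + y‖ₑ ^ (-1 / 2 : ℝ) ≤ c + f y := by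
    have := nullSingletonClass_gaussianReal (μ := 0) hv.ne'
    have h0 : ∀ᵐ y ∂(gaussianReal 0 v), y ≠ -a := by
      rw [ae_iff]; simp
    filter_upwards [h0] with y hy
    have hy0 : a + y ≠ 0 := fun h => hy (by linarith)
    rw [enorm_rpow_eq_ofReal hy0, Real.norm_eq_abs]
    by_cases h : a + y ∈ Set.Ioo (-s) s
    · simp only [hf, Set.indicator_of_mem h]; exact le_add_self
    · refine le_add_right ?_
      have h1 : s ≤ |a + y| := by
        by_contra hlt
        exact h (abs_lt.1 (not_le.1 hlt))
      refine ENNReal.ofReal_le_ofReal ?_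
      have h2 := Real.rpow_le_rpow_of_nonpos hs0 h1 (show (-1 / 2 : ℝ) ≤ 0 by norm_num)
      rw [hspow] at h2
      convert h2 using 2; norm_num
  refine (lintegral_mono_ae hae).trans ?_
  rw [lintegral_add_left measurable_const, lintegral_const, measure_univ, mul_one]
  have h4 : ∫⁻ y, f y ∂(gaussianReal 0 v) ≤ ENNReal.ofReal (4 * (v : ℝ) ^ (-1 / 4 : ℝ)) := by
    rw [gaussianReal_of_var_ne_zero 0 hv.ne',
      lintegral_withDensity_eq_lintegral_mul _ (measurable_gaussianPDF 0 v) hfm]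
    calc _ ≤ ∫⁻ y, ENNReal.ofReal (s⁻¹) * f y := lintegral_mono fun y =>
          mul_le_mul_left (hpdf y) _
      _ = ENNReal.ofReal (s⁻¹) * ∫⁻ y, f y := lintegral_const_mul _ hfm
      _ = ENNReal.ofReal (s⁻¹) *
          ∫⁻ u in Set.Ioo (-s) s, ENNReal.ofReal (|u| ^ (-1 / 2 : ℝ)) := by
        rw [← lintegral_indicator measurableSet_Ioo]
        congr 1
        exact lintegral_add_left_eq_self (fun u => (Set.Ioo (-s) s).indicator
          (fun u : ℝ => ENNReal.ofReal (|u| ^ (-1 / 2 : ℝ))) u) a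
      _ ≤ ENNReal.ofReal (s⁻¹) * ENNReal.ofReal (4 * s ^ (1 / 2 : ℝ)) := by
        gcongr; exact lintegral_abs_rpow_Ioo hs0
      _ = _ := by
        rw [← ENNReal.ofReal_mul (by positivity)]
        congr 1
        rw [← Real.rpow_neg_one s, hspow, hspow, mul_left_comm, ← Real.rpow_add hv']
        norm_num
  refine (add_le_add le_rfl h4).trans ?_
  rw [hc, ← ENNReal.ofReal_add (by positivity) (by positivity)]
  exact ENNReal.ofReal_le_ofReal (by linarith)

theorem rpow_sum_le_sum_rpow {κ : Type*} {J : Finset κ} (hJ : J.Nonempty) {x : κ → ℝ}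
    (hx : ∀ j ∈ J, 0 < x j) :
    (∑ j ∈ J, x j) ^ (-1 / 4 : ℝ) ≤
      (J.card : ℝ) ^ (-1 / 4 : ℝ) * ((J.card : ℝ)⁻¹ * ∑ j ∈ J, x j ^ (-1 / 4 : ℝ)) := by
  have hk : (0 : ℝ) < J.card := by exact_mod_cast hJ.card_pos
  have hw : ∑ _j ∈ J, (J.card : ℝ)⁻¹ = 1 := by
    simp [hk.ne']
  have g1 := Real.geom_mean_le_arith_mean_weighted J (fun _ => (J.card : ℝ)⁻¹) x
    (fun _ _ => by positivity) hw fun j hj => (hx j hj).le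
  have g2 := Real.geom_mean_le_arith_mean_weighted J (fun _ => (J.card : ℝ)⁻¹)
    (fun j => x j ^ (-1 / 4 : ℝ)) (fun _ _ => by positivity) hw
    fun j hj => Real.rpow_nonneg (hx j hj).le _
  rw [← Finset.mul_sum] at g1 g2
  have g3 : ∏ j ∈ J, (x j ^ (-1 / 4 : ℝ)) ^ (J.card : ℝ)⁻¹ =
      (∏ j ∈ J, x j ^ (J.card : ℝ)⁻¹) ^ (-1 / 4 : ℝ) := by
    rw [← Real.finsetProd_rpow _ _ fun j hj => Real.rpow_nonneg (hx j hj).le _]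
    refine Finset.prod_congr rfl fun j hj => ?_
    rw [← Real.rpow_mul (hx j hj).le, ← Real.rpow_mul (hx j hj).le, mul_comm]
  rw [g3] at g2
  have hp : 0 < ∏ j ∈ J, x j ^ (J.card : ℝ)⁻¹ :=
    Finset.prod_pos fun j hj => Real.rpow_pos_of_pos (hx j hj) _
  have g4 := Real.rpow_le_rpow_of_nonpos hp g1 (show (-1 / 4 : ℝ) ≤ 0 by norm_num)
  have hS : 0 < ∑ j ∈ J, x j := Finset.sum_pos hx hJ
  have g5 : (∑ j ∈ J, x j) ^ (-1 / 4 : ℝ) = (J.card : ℝ) ^ (-1 / 4 : ℝ) *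
      ((J.card : ℝ)⁻¹ * ∑ j ∈ J, x j) ^ (-1 / 4 : ℝ) := by
    rw [← Real.mul_rpow hk.le (by positivity)]
    congr 1
    field_simp
  rw [g5]
  exact mul_le_mul_of_nonneg_left (g4.trans g2) (by positivity)

theorem lintegral_stdGaussianRow_real_rpow_le {ι : Type*} [Fintype ι] (a : ℝ) (β : ι → ℝ) {V : ℝ}
    (hV : 0 < V) (hβ : V ≤ ∑ j, β j ^ 2) :
    ∫⁻ g, ‖a + ∑ j, β j * g j‖ₑ ^ (-1 / 2 : ℝ) ∂(stdGaussianRow ι) ≤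
      ENNReal.ofReal (5 * V ^ (-1 / 4 : ℝ)) := by
  have hm : Measurable (fun g : ι → ℝ => ∑ j, β j * g j) := by fun_prop
  have h1 : ∫⁻ g, ‖a + ∑ j, β j * g j‖ₑ ^ (-1 / 2 : ℝ) ∂(stdGaussianRow ι) =
      ∫⁻ y, ‖a + y‖ₑ ^ (-1 / 2 : ℝ) ∂((stdGaussianRow ι).map (fun g => ∑ j, β j * g j)) := by
    rw [lintegral_map (by fun_prop) hm]
  rw [h1, stdGaussianRow_map_sum]
  have h2 : 0 < ∑ j, β j ^ 2 := hV.trans_le hβ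
  refine (lintegral_gaussianReal_rpow_le a (Real.toNNReal_pos.2 h2)).trans ?_
  rw [Real.coe_toNNReal _ h2.le]
  refine ENNReal.ofReal_le_ofReal ?_
  have := Real.rpow_le_rpow_of_nonpos hV hβ (show (-1 / 4 : ℝ) ≤ 0 by norm_num)
  linarith

theorem enorm_rpow_neg_anti {x y : ℝ≥0∞} (h : x ≤ y) : y ^ (-1 / 2 : ℝ) ≤ x ^ (-1 / 2 : ℝ) := by
  rw [show (-1 / 2 : ℝ) = -(1 / 2) by norm_num, ENNReal.rpow_neg, ENNReal.rpow_neg]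
  exact ENNReal.inv_le_inv.2 (ENNReal.rpow_le_rpow h (by norm_num))

/-- Negative moments of order one half of a complex affine form in a Gaussian vector. -/
theorem lintegral_stdGaussianRow_rpow_le {ι : Type*} [Fintype ι] (a : ℂ) (b : ι → ℂ) {s : ℝ}
    (hs : s ≠ 0) {J : Finset ι} (hJ : J.Nonempty) :
    ∫⁻ g, ‖a + ∑ j, (s * g j : ℝ) * b j‖ₑ ^ (-1 / 2 : ℝ) ∂(stdGaussianRow ι) ≤
      ENNReal.ofReal (10 * |s| ^ (-1 / 2 : ℝ) * (J.card : ℝ) ^ (-1 / 4 : ℝ)) *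
        ((J.card : ℝ≥0∞)⁻¹ * ∑ j ∈ J, ‖b j‖ₑ ^ (-1 / 2 : ℝ)) := by
  have hk : (0 : ℝ) < J.card := by exact_mod_cast hJ.card_pos
  have hs0 : 0 < |s| := abs_pos.2 hs
  by_cases h0 : ∃ j ∈ J, b j = 0
  · obtain ⟨j, hj, hbj⟩ := h0
    have h1 : ∑ j ∈ J, ‖b j‖ₑ ^ (-1 / 2 : ℝ) = ⊤ := by
      refine ENNReal.sum_eq_top.2 ⟨j, hj, ?_⟩
      rw [hbj, enorm_zero, ENNReal.zero_rpow_of_neg (by norm_num)]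
    rw [h1, ENNReal.mul_top (by simp), ENNReal.mul_top]
    · exact le_top
    · rw [Ne, ENNReal.ofReal_eq_zero, not_le]; positivity
  · push Not at h0
    set V := ∑ j ∈ J, ‖b j‖ ^ 2 with hVdef
    have hVpos : 0 < V := Finset.sum_pos
      (fun j hj => pow_pos (norm_pos_iff.2 (h0 j hj)) 2) hJ
    have key : ∫⁻ g, ‖a + ∑ j, (s * g j : ℝ) * b j‖ₑ ^ (-1 / 2 : ℝ) ∂(stdGaussianRow ι) ≤
        ENNReal.ofReal (5 * (s ^ 2 * (V / 2)) ^ (-1 / 4 : ℝ)) := by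
      have hVs : V = (∑ j ∈ J, (b j).re ^ 2) + ∑ j ∈ J, (b j).im ^ 2 := by
        rw [hVdef, ← Finset.sum_add_distrib]
        refine Finset.sum_congr rfl fun j _ => ?_
        rw [← Complex.normSq_eq_norm_sq, Complex.normSq_apply]; ring
      have hs2 : 0 < s ^ 2 := by positivity
      have hsub : ∀ c : ι → ℝ, V / 2 ≤ ∑ j ∈ J, c j ^ 2 →
          s ^ 2 * (V / 2) ≤ ∑ j, (s * c j) ^ 2 := by
        intro c hc
        simp_rw [mul_pow, ← Finset.mul_sum]
        refine mul_le_mul_of_nonneg_left (hc.trans ?_) hs2.le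
        exact Finset.sum_le_sum_of_subset_of_nonneg (Finset.subset_univ _)
          fun _ _ _ => sq_nonneg _
      rcases le_total (V / 2) (∑ j ∈ J, (b j).re ^ 2) with h | h
      · refine le_trans (lintegral_mono fun g => ?_)
          (lintegral_stdGaussianRow_real_rpow_le a.re (fun j => s * (b j).re) (by positivity)
            (hsub (fun j => (b j).re) h))
        refine enorm_rpow_neg_anti ?_
        have : a.re + ∑ j, s * (b j).re * g j = (a + ∑ j, (s * g j : ℝ) * b j).re := by
          simp only [Complex.add_re, Complex.re_sum, Complex.re_ofReal_mul]
          congr 1; exact Finset.sum_congr rfl fun j _ => by ring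
        rw [this, enorm_le_iff_norm_le]
        exact Complex.abs_re_le_norm _
      · refine le_trans (lintegral_mono fun g => ?_)
          (lintegral_stdGaussianRow_real_rpow_le a.im (fun j => s * (b j).im) (by positivity)
            (hsub (fun j => (b j).im) (by linarith)))
        refine enorm_rpow_neg_anti ?_
        have : a.im + ∑ j, s * (b j).im * g j = (a + ∑ j, (s * g j : ℝ) * b j).im := by
          simp only [Complex.add_im, Complex.im_sum, Complex.im_ofReal_mul]
          congr 1; exact Finset.sum_congr rfl fun j _ => by ring
        rw [this, enorm_le_iff_norm_le]
        exact Complex.abs_im_le_norm _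
    refine key.trans ?_
    have h2 : (J.card : ℝ≥0∞)⁻¹ * ∑ j ∈ J, ‖b j‖ₑ ^ (-1 / 2 : ℝ) =
        ENNReal.ofReal ((J.card : ℝ)⁻¹ * ∑ j ∈ J, (‖b j‖ ^ 2) ^ (-1 / 4 : ℝ)) := by
      rw [ENNReal.ofReal_mul (by positivity), ENNReal.ofReal_inv_of_pos hk,
        ENNReal.ofReal_natCast, ENNReal.ofReal_sum_of_nonneg fun j _ => by positivity]
      congr 1
      refine Finset.sum_congr rfl fun j hj => ?_
      rw [enorm_rpow_eq_ofReal (h0 j hj), ← Real.rpow_natCast, ← Real.rpow_mul (norm_nonneg _)]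
      norm_num
    rw [h2, ← ENNReal.ofReal_mul (by positivity)]
    refine ENNReal.ofReal_le_ofReal ?_
    have h3 := rpow_sum_le_sum_rpow hJ (x := fun j => ‖b j‖ ^ 2)
      fun j hj => pow_pos (norm_pos_iff.2 (h0 j hj)) 2
    have h4 : (s ^ 2 * (V / 2)) ^ (-1 / 4 : ℝ) =
        |s| ^ (-1 / 2 : ℝ) * (2 ^ (1 / 4 : ℝ) * V ^ (-1 / 4 : ℝ)) := by
      rw [Real.mul_rpow (by positivity) (by positivity), Real.div_rpow hVpos.le (by norm_num),
        ← sq_abs, ← Real.rpow_natCast, ← Real.rpow_mul hs0.le]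
      rw [show (-1 / 4 : ℝ) = -(1 / 4) by norm_num, Real.rpow_neg (by norm_num : (0 : ℝ) ≤ 2),
        div_inv_eq_mul]
      norm_num
      left; ring
    have h5 : (2 : ℝ) ^ (1 / 4 : ℝ) ≤ 2 := by
      calc (2 : ℝ) ^ (1 / 4 : ℝ) ≤ 2 ^ (1 : ℝ) :=
            Real.rpow_le_rpow_of_exponent_le (by norm_num) (by norm_num)
        _ = 2 := Real.rpow_one 2
    rw [h4]
    have h6 : 0 ≤ |s| ^ (-1 / 2 : ℝ) := by positivity
    have h7 : 0 ≤ V ^ (-1 / 4 : ℝ) := by positivity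
    calc 5 * (|s| ^ (-1 / 2 : ℝ) * (2 ^ (1 / 4 : ℝ) * V ^ (-1 / 4 : ℝ)))
        ≤ 5 * (|s| ^ (-1 / 2 : ℝ) * (2 * V ^ (-1 / 4 : ℝ))) := by gcongr
      _ = 10 * |s| ^ (-1 / 2 : ℝ) * V ^ (-1 / 4 : ℝ) := by ring
      _ ≤ 10 * |s| ^ (-1 / 2 : ℝ) * _ := mul_le_mul_of_nonneg_left h3 (by positivity)
      _ = _ := by ring

end GaussianRow

section NegativeMoment

variable {ι : Type*} [Fintype ι] [DecidableEq ι]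

/-- The matrix `A` with noise of amplitude `s p` in the row `p`. -/
noncomputable def rowNoise (A : Matrix ι ι ℂ) (s : ι → ℝ) (X : ι → ι → ℝ) : Matrix ι ι ℂ :=
  Matrix.of fun p q => A p q + ((s p * X p q : ℝ) : ℂ)

/-- The matrix `Y` with the rows in `I` replaced by unit vectors, according to `π`. -/
def unitRows (I : Finset ι) (π : Equiv.Perm ι) (Y : Matrix ι ι ℂ) : Matrix ι ι ℂ :=
  Matrix.of fun p q => if p ∈ I then (if π p = q then 1 else 0) else Y p q

theorem measurable_det_rowNoise (A : Matrix ι ι ℂ) (s : ι → ℝ) :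
    Measurable fun X : ι → ι → ℝ => (rowNoise A s X).det := by
  refine Continuous.measurable (Continuous.matrix_det ?_)
  refine continuous_matrix fun p q => ?_
  simp only [rowNoise, Matrix.of_apply]
  fun_prop

/-- The constant in the bound for negative moments of determinants. -/
noncomputable def negMomentConst (σ : ℝ) (k : ℕ) : ℝ :=
  ∏ j ∈ Finset.range k, (10 * |σ| ^ (-1 / 2 : ℝ) * ((j + 1 : ℕ) : ℝ) ^ (-1 / 4 : ℝ))

theorem negMomentConst_nonneg (σ : ℝ) (k : ℕ) : 0 ≤ negMomentConst σ k :=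
  Finset.prod_nonneg fun _ _ => by positivity

theorem norm_det_unitRows_swap {I : Finset ι} {π : Equiv.Perm ι} {Y : Matrix ι ι ℂ} {i k : ι}
    (hi : i ∈ I) (hk : k ∈ I) :
    ‖(unitRows I ((Equiv.swap i k).trans π) Y).det‖ₑ = ‖(unitRows I π Y).det‖ₑ := by
  have h : unitRows I ((Equiv.swap i k).trans π) Y =
      (unitRows I π Y).submatrix (Equiv.swap i k) id := by
    ext p q
    simp only [unitRows, Matrix.of_apply, Matrix.submatrix_apply, id_eq, Equiv.trans_apply]
    by_cases hp : p ∈ I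
    · have h1 : Equiv.swap i k p ∈ I := by
        rw [Equiv.swap_apply_def]; split_ifs <;> assumption
      simp only [hp, h1, if_true]
      rfl
    · have h1 : Equiv.swap i k p = p :=
        Equiv.swap_apply_of_ne_of_ne (fun h => hp (h ▸ hi)) (fun h => hp (h ▸ hk))
      simp [hp, h1]
  rw [h, Matrix.det_permute, enorm_mul]
  rcases Int.units_eq_one_or (Equiv.Perm.sign (Equiv.swap i k)) with hs | hs <;> simp [hs]

theorem lintegral_det_update_row_le (A : Matrix ι ι ℂ) (s : ι → ℝ) {i : ι} (hs : s i ≠ 0)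
    {J : Finset ι} (hJ : J.Nonempty) (X : ι → ι → ℝ) :
    ∫⁻ g, ‖(rowNoise A s (Function.update X i g)).det‖ₑ ^ (-1 / 2 : ℝ) ∂(stdGaussianRow ι) ≤
      ENNReal.ofReal (10 * |s i| ^ (-1 / 2 : ℝ) * (J.card : ℝ) ^ (-1 / 4 : ℝ)) *
        ((J.card : ℝ≥0∞)⁻¹ * ∑ j ∈ J,
          ‖(rowNoise (A.updateRow i (Pi.single j 1)) (Function.update s i 0) X).det‖ₑ ^
            (-1 / 2 : ℝ)) := by
  set b : ι → ℂ := fun j =>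
    (rowNoise (A.updateRow i (Pi.single j 1)) (Function.update s i 0) X).det with hb
  have h1 : ∀ g : ι → ℝ, (rowNoise A s (Function.update X i g)).det =
      (∑ j, A i j * b j) + ∑ j, (s i * g j : ℝ) * b j := by
    intro g
    rw [Matrix.det_eq_sum_mul_adjugate_row _ i, ← Finset.sum_add_distrib]
    refine Finset.sum_congr rfl fun j _ => ?_
    rw [Matrix.adjugate_apply]
    have h2 : (rowNoise A s (Function.update X i g)).updateRow i (Pi.single j 1) =
        rowNoise (A.updateRow i (Pi.single j 1)) (Function.update s i 0) X := by
      ext p q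
      by_cases hp : p = i
      · subst hp; simp [rowNoise]
      · simp [rowNoise, hp]
    rw [h2, ← add_mul]
    simp [rowNoise, hb]
  simp_rw [h1]
  exact lintegral_stdGaussianRow_rpow_le _ b hs hJ

/-- Averaging over the Gaussian rows in `I` replaces them by unit vectors. -/
theorem lmarginal_det_rowNoise_le {σ : ℝ} (hσ : σ ≠ 0) (I : Finset ι) :
    ∀ (A : Matrix ι ι ℂ) (s : ι → ℝ) (_ : ∀ i ∈ I, s i = σ) (π : Equiv.Perm ι) (X : ι → ι → ℝ),
      lmarginal (fun _ => stdGaussianRow ι) I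
          (fun X => ‖(rowNoise A s X).det‖ₑ ^ (-1 / 2 : ℝ)) X ≤
        ENNReal.ofReal (negMomentConst σ I.card) *
          ‖(unitRows I π (rowNoise A s X)).det‖ₑ ^ (-1 / 2 : ℝ) := by
  induction I using Finset.induction_on with
  | empty =>
    intro A s _ π X
    simp [negMomentConst, unitRows]
    rfl
  | insert i I hi ih =>
    intro A s hs π X
    have hmeas : ∀ (A : Matrix ι ι ℂ) (s : ι → ℝ), Measurable fun X : ι → ι → ℝ =>
        ‖(rowNoise A s X).det‖ₑ ^ (-1 / 2 : ℝ) := fun A s =>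
      (measurable_det_rowNoise A s).enorm.pow_const _
    set J := (insert i I).map π.toEmbedding with hJ
    have hJc : J.card = I.card + 1 := by rw [hJ, Finset.card_map, Finset.card_insert_of_notMem hi]
    have hJne : J.Nonempty := Finset.card_pos.1 (by omega)
    have hsi : s i = σ := hs i (Finset.mem_insert_self i I)
    rw [lmarginal_insert' _ (hmeas A s) hi]
    have step : ∀ X : ι → ι → ℝ, _ := fun X =>
      lintegral_det_update_row_le A s (i := i) (by rw [hsi]; exact hσ) hJne X
    refine (lmarginal_mono step X).trans ?_
    have hlin : lmarginal (fun _ => stdGaussianRow ι) I (fun X : ι → ι → ℝ =>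
        ENNReal.ofReal (10 * |s i| ^ (-1 / 2 : ℝ) * (J.card : ℝ) ^ (-1 / 4 : ℝ)) *
        ((J.card : ℝ≥0∞)⁻¹ * ∑ j ∈ J,
          ‖(rowNoise (A.updateRow i (Pi.single j 1)) (Function.update s i 0) X).det‖ₑ ^
            (-1 / 2 : ℝ))) X =
        ENNReal.ofReal (10 * |s i| ^ (-1 / 2 : ℝ) * (J.card : ℝ) ^ (-1 / 4 : ℝ)) *
        ((J.card : ℝ≥0∞)⁻¹ * ∑ j ∈ J, lmarginal (fun _ => stdGaussianRow ι) I (fun X =>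
          ‖(rowNoise (A.updateRow i (Pi.single j 1)) (Function.update s i 0) X).det‖ₑ ^
            (-1 / 2 : ℝ)) X) := by
      have hm : ∀ j ∈ J, Measurable fun y : I → ι → ℝ =>
          ‖(rowNoise (A.updateRow i (Pi.single j 1)) (Function.update s i 0)
            (Function.updateFinset X I y)).det‖ₑ ^ (-1 / 2 : ℝ) := fun j _ =>
        (hmeas _ _).comp measurable_updateFinset
      simp only [lmarginal]
      rw [lintegral_const_mul _ ((Finset.measurable_fun_sum _ hm).const_mul _),
        lintegral_const_mul _ (Finset.measurable_fun_sum _ hm), lintegral_finsetSum _ hm]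
    rw [hlin]
    have hterm : ∀ j ∈ J, lmarginal (fun _ => stdGaussianRow ι) I (fun X =>
          ‖(rowNoise (A.updateRow i (Pi.single j 1)) (Function.update s i 0) X).det‖ₑ ^
            (-1 / 2 : ℝ)) X ≤ ENNReal.ofReal (negMomentConst σ I.card) *
          ‖(unitRows (insert i I) π (rowNoise A s X)).det‖ₑ ^ (-1 / 2 : ℝ) := by
      intro j hj
      obtain ⟨k, hk, rfl⟩ := Finset.mem_map.1 hj
      refine (ih _ _ ?_ ((Equiv.swap i k).trans π) X).trans (le_of_eq ?_)
      · intro p hp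
        have : p ≠ i := fun h => hi (h ▸ hp)
        rw [Function.update_of_ne this]
        exact hs p (Finset.mem_insert_of_mem hp)
      · rw [← norm_det_unitRows_swap (Finset.mem_insert_self i I) hk]
        congr 4
        ext p q
        simp only [unitRows, Matrix.of_apply]
        by_cases hp : p = i
        · subst hp
          simp [hi, rowNoise, Pi.single_apply, eq_comm]
        · simp [hp, rowNoise]
    calc _ ≤ ENNReal.ofReal (10 * |s i| ^ (-1 / 2 : ℝ) * (J.card : ℝ) ^ (-1 / 4 : ℝ)) *
        ((J.card : ℝ≥0∞)⁻¹ * ∑ j ∈ J, ENNReal.ofReal (negMomentConst σ I.card) *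
          ‖(unitRows (insert i I) π (rowNoise A s X)).det‖ₑ ^ (-1 / 2 : ℝ)) := by
          gcongr with j hj; exact hterm j hj
      _ = _ := by
        rw [Finset.sum_const, nsmul_eq_mul, ← mul_assoc (_⁻¹), ENNReal.inv_mul_cancel, one_mul,
          ← mul_assoc, ← ENNReal.ofReal_mul (by positivity), hJc, hsi,
          Finset.card_insert_of_notMem hi, negMomentConst, negMomentConst,
          Finset.prod_range_succ, mul_comm (∏ j ∈ _, _)]
        · simp [hJc]
        · simp

end NegativeMoment

section OperatorNorm

open Matrix
open scoped Matrix.Norms.L2Operator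

variable {ι : Type*} [Fintype ι]

/-- The law of a matrix with independent standard real normal entries. -/
noncomputable abbrev stdGaussianMatrix (ι : Type*) [Fintype ι] : Measure (ι → ι → ℝ) :=
  Measure.pi fun _ => stdGaussianRow ι

/-- A real matrix as a complex matrix. -/
def complexify {ι : Type*} (X : ι → ι → ℝ) : Matrix ι ι ℂ := Matrix.of fun p q => (X p q : ℂ)

theorem continuous_complexify {ι : Type*} :
    Continuous (complexify : (ι → ι → ℝ) → Matrix ι ι ℂ) :=
  continuous_matrix fun p q => by simp only [complexify, Matrix.of_apply]; fun_prop

/-- The bilinear form of a matrix. -/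
noncomputable def bilinSum (X : ι → ι → ℝ) (x y : EuclideanSpace ℝ ι) : ℝ :=
  ∑ p, ∑ q, (x p * y q) * X p q

theorem lintegral_exp_bilinSum (x y : EuclideanSpace ℝ ι) (t : ℝ) :
    ∫⁻ X, ENNReal.ofReal (Real.exp (t * bilinSum X x y)) ∂(stdGaussianMatrix ι) =
      ENNReal.ofReal (Real.exp (t ^ 2 * (‖x‖ ^ 2 * ‖y‖ ^ 2) / 2)) := by
  have h1 : ∀ X : ι → ι → ℝ, Real.exp (t * bilinSum X x y) =
      ∏ p, ∏ q, Real.exp ((t * (x p * y q)) * X p q) := by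
    intro X
    simp only [bilinSum, ← Real.exp_sum, Finset.mul_sum, mul_assoc]
  have hint1 : ∀ p, Integrable (fun r : ι → ℝ => ∏ q, Real.exp ((t * (x p * y q)) * r q))
      (stdGaussianRow ι) := fun p =>
    Integrable.fintype_prod (f := fun q (u : ℝ) => Real.exp ((t * (x p * y q)) * u))
      fun q => integrable_exp_mul_gaussianReal _
  have hint : Integrable (fun X : ι → ι → ℝ => ∏ p, ∏ q, Real.exp ((t * (x p * y q)) * X p q))
      (stdGaussianMatrix ι) :=
    Integrable.fintype_prod (f := fun p (r : ι → ℝ) => ∏ q, Real.exp ((t * (x p * y q)) * r q))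
      hint1
  simp_rw [h1]
  rw [← ofReal_integral_eq_lintegral_ofReal hint (ae_of_all _ fun X =>
    Finset.prod_nonneg fun p _ => Finset.prod_nonneg fun q _ => (Real.exp_pos _).le)]
  congr 1
  rw [integral_fintype_prod_eq_prod (𝕜 := ℝ)
    (fun p (r : ι → ℝ) => ∏ q, Real.exp ((t * (x p * y q)) * r q))]
  have h2 : ∀ p, ∫ r, ∏ q, Real.exp ((t * (x p * y q)) * r q) ∂(stdGaussianRow ι) =
      ∏ q, Real.exp ((t * (x p * y q)) ^ 2 / 2) := by
    intro p
    rw [integral_fintype_prod_eq_prod (𝕜 := ℝ)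
      (fun q (u : ℝ) => Real.exp ((t * (x p * y q)) * u))]
    refine Finset.prod_congr rfl fun q _ => ?_
    have h3 := congrFun (mgf_fun_id_gaussianReal (μ := 0) (v := 1)) (t * (x p * y q))
    rw [mgf] at h3
    rw [h3]; norm_num
  simp_rw [h2, ← Real.exp_sum]
  congr 1
  rw [EuclideanSpace.norm_sq_eq, EuclideanSpace.norm_sq_eq, Finset.sum_mul_sum, Finset.mul_sum,
    Finset.sum_div]
  refine Finset.sum_congr rfl fun p _ => ?_
  rw [Finset.mul_sum, Finset.sum_div]
  refine Finset.sum_congr rfl fun q _ => ?_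
  simp only [Real.norm_eq_abs, sq_abs]; ring

theorem continuous_bilinSum :
    Continuous fun z : (ι → ι → ℝ) × (EuclideanSpace ℝ ι × EuclideanSpace ℝ ι) =>
      bilinSum z.1 z.2.1 z.2.2 := by
  unfold bilinSum
  fun_prop

variable [DecidableEq ι]

theorem norm_complexify_le (X : ι → ι → ℝ) :
    ‖complexify X‖ ≤ 2 * ‖toEuclideanCLM (n := ι) (𝕜 := ℝ) (Matrix.of X)‖ := by
  set T := toEuclideanCLM (n := ι) (𝕜 := ℝ) (Matrix.of X)
  refine l2_opNorm_le_of_forall (by positivity) fun v => ?_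
  set a : ι → ℝ := fun p => (v p).re
  set b : ι → ℝ := fun p => (v p).im
  have hre : ∀ w : ι → ℂ, ‖WithLp.toLp 2 w‖ ^ 2 =
      ‖WithLp.toLp 2 (fun p => (w p).re)‖ ^ 2 + ‖WithLp.toLp 2 (fun p => (w p).im)‖ ^ 2 := by
    intro w
    simp only [EuclideanSpace.norm_sq_eq, ← Finset.sum_add_distrib]
    refine Finset.sum_congr rfl fun p _ => ?_
    rw [← Complex.normSq_eq_norm_sq, Complex.normSq_apply, Real.norm_eq_abs, Real.norm_eq_abs,
      sq_abs, sq_abs]; ring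
  have h1 : (fun p => ((complexify X *ᵥ v) p).re) = (Matrix.of X *ᵥ a) := by
    ext p
    simp only [mulVec, dotProduct, complexify, Matrix.of_apply, Complex.re_sum,
      Complex.re_ofReal_mul, a]
  have h2 : (fun p => ((complexify X *ᵥ v) p).im) = (Matrix.of X *ᵥ b) := by
    ext p
    simp only [mulVec, dotProduct, complexify, Matrix.of_apply, Complex.im_sum,
      Complex.im_ofReal_mul, b]
  have h3 : ∀ c : ι → ℝ, ‖WithLp.toLp 2 (Matrix.of X *ᵥ c)‖ ≤ ‖T‖ * ‖WithLp.toLp 2 c‖ := fun c =>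
    T.le_opNorm (WithLp.toLp 2 c)
  refine le_of_sq_le_sq ?_ (by positivity)
  rw [hre, h1, h2, mul_pow, hre v]
  have h4 := pow_le_pow_left₀ (norm_nonneg _) (h3 a) 2
  have h5 := pow_le_pow_left₀ (norm_nonneg _) (h3 b) 2
  rw [mul_pow] at h4 h5
  have h6 := sq_nonneg ‖WithLp.toLp 2 a‖
  have h7 := sq_nonneg ‖WithLp.toLp 2 b‖
  have h8 := sq_nonneg ‖T‖
  nlinarith [mul_nonneg h8 h6, mul_nonneg h8 h7]

theorem bilinSum_eq_inner (X : ι → ι → ℝ) (x y : EuclideanSpace ℝ ι) :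
    bilinSum X x y = inner ℝ x (toEuclideanCLM (n := ι) (𝕜 := ℝ) (Matrix.of X) y) := by
  rw [PiLp.inner_apply]
  refine Finset.sum_congr rfl fun p _ => ?_
  have : (toEuclideanCLM (n := ι) (𝕜 := ℝ) (Matrix.of X) y) p = ∑ q, X p q * y q := rfl
  rw [this]
  simp only [RCLike.inner_apply, conj_trivial, Finset.sum_mul]
  exact Finset.sum_congr rfl fun q _ => by ring

theorem exists_bilinSum_large (X : ι → ι → ℝ) :
    ∃ x₀ y₀ : EuclideanSpace ℝ ι, ‖x₀‖ ≤ 1 ∧ ‖y₀‖ ≤ 1 ∧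
      ∀ x ∈ Metric.closedBall x₀ (1 / 4), ∀ y ∈ Metric.closedBall y₀ (1 / 4),
        ‖toEuclideanCLM (n := ι) (𝕜 := ℝ) (Matrix.of X)‖ / 4 ≤ bilinSum X x y := by
  set T := toEuclideanCLM (n := ι) (𝕜 := ℝ) (Matrix.of X)
  rcases (norm_nonneg T).eq_or_lt with h0 | h0
  · refine ⟨0, 0, by simp, by simp, fun x _ y _ => ?_⟩
    have hT : T = 0 := norm_eq_zero.1 h0.symm
    rw [bilinSum_eq_inner]
    change _ ≤ inner ℝ x (T y)
    rw [hT]; simp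
  · obtain ⟨y₀, hy₀, hT⟩ := T.exists_lt_apply_of_lt_opNorm (show 9 / 10 * ‖T‖ < ‖T‖ by linarith)
    have hTy : 0 < ‖T y₀‖ := by linarith
    refine ⟨(‖T y₀‖)⁻¹ • T y₀, y₀, ?_, hy₀.le, fun x hx y hy => ?_⟩
    · rw [norm_smul, norm_inv, norm_norm, inv_mul_cancel₀ hTy.ne']
    · rw [Metric.mem_closedBall, dist_eq_norm] at hx hy
      rw [bilinSum_eq_inner]
      set x₀ := (‖T y₀‖)⁻¹ • T y₀
      have hx₀ : ‖x₀‖ = 1 := by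
        rw [norm_smul, norm_inv, norm_norm, inv_mul_cancel₀ hTy.ne']
      have e1 : inner ℝ x₀ (T y₀) = ‖T y₀‖ := by
        rw [real_inner_smul_left, real_inner_self_eq_norm_sq, sq, inv_mul_cancel_left₀ hTy.ne']
      have e2 : inner ℝ x (T y) = inner ℝ x₀ (T y₀) + inner ℝ (x - x₀) (T y₀) +
          inner ℝ x (T (y - y₀)) := by
        rw [map_sub, inner_sub_left, inner_sub_right]; ring
      have e3 : |inner ℝ (x - x₀) (T y₀)| ≤ 1 / 4 * ‖T‖ := by
        refine (abs_real_inner_le_norm _ _).trans (mul_le_mul hx ?_ (norm_nonneg _) (by norm_num))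
        exact (T.le_opNorm _).trans (mul_le_of_le_one_right (norm_nonneg _) hy₀.le)
      have hxn : ‖x‖ ≤ 5 / 4 := by
        have := norm_add_le x₀ (x - x₀)
        rw [add_sub_cancel] at this; linarith
      have e4 : |inner ℝ x (T (y - y₀))| ≤ 5 / 4 * (‖T‖ * (1 / 4)) := by
        refine (abs_real_inner_le_norm _ _).trans (mul_le_mul hxn ?_ (norm_nonneg _) (by norm_num))
        exact (T.le_opNorm _).trans (mul_le_mul_of_nonneg_left hy (norm_nonneg _))
      have e5 := (abs_le.1 e3).1
      have e6 := (abs_le.1 e4).1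
      rw [e2, e1]
      linarith

theorem stdGaussianMatrix_opNorm_tail :
    stdGaussianMatrix ι {X | 60 * √(Fintype.card ι) ≤
        ‖toEuclideanCLM (n := ι) (𝕜 := ℝ) (Matrix.of X)‖} ≤
      ENNReal.ofReal (Real.exp (-(Fintype.card ι : ℝ))) := by
  set n := Fintype.card ι with hn
  set E := EuclideanSpace ℝ ι
  set t : ℝ := √n with ht
  have ht0 : 0 ≤ t := Real.sqrt_nonneg _
  have ht2 : t ^ 2 = n := Real.sq_sqrt (Nat.cast_nonneg _)
  set B : Set (E × E) := Metric.closedBall 0 2 ×ˢ Metric.closedBall 0 2 with hB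
  set v : ℝ≥0∞ := volume (Metric.closedBall (0 : E) (1 / 4)) with hv
  have hv0 : v ≠ 0 := (Metric.measure_closedBall_pos _ _ (by norm_num)).ne'
  have hvt : v ≠ ⊤ := measure_closedBall_lt_top.ne
  have hvol : volume (Metric.closedBall (0 : E) 2) = 8 ^ n * v := by
    have h := Measure.addHaar_closedBall_mul (volume : Measure E) (0 : E)
      (show (0 : ℝ) ≤ 8 by norm_num) (show (0 : ℝ) ≤ 1 / 4 by norm_num)
    rw [show (8 : ℝ) * (1 / 4) = 2 by norm_num] at h
    rw [h, finrank_euclideanSpace, ← hn, ENNReal.ofReal_pow (by norm_num)]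
    norm_num
    rfl
  have hBvol : volume B = (8 ^ n * v) * (8 ^ n * v) := by
    rw [hB, Measure.volume_eq_prod, Measure.prod_prod, hvol]
  set F : (ι → ι → ℝ) → E × E → ℝ≥0∞ := fun X z =>
    ENNReal.ofReal (Real.exp (t * bilinSum X z.1 z.2)) with hF
  have hFm : Measurable (Function.uncurry F) := by
    have := (continuous_bilinSum (ι := ι)).measurable
    exact ((this.const_mul t).exp).ennreal_ofReal
  set Z : (ι → ι → ℝ) → ℝ≥0∞ := fun X => ∫⁻ z in B, F X z with hZ
  have hup : ∫⁻ X, Z X ∂(stdGaussianMatrix ι) ≤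
      ENNReal.ofReal (Real.exp (8 * n)) * ((8 ^ n * v) * (8 ^ n * v)) := by
    rw [hZ, lintegral_lintegral_swap hFm.aemeasurable, ← hBvol, ← setLIntegral_const]
    refine setLIntegral_mono measurable_const fun z hz => ?_
    rw [hF, lintegral_exp_bilinSum]
    refine ENNReal.ofReal_le_ofReal (Real.exp_le_exp.2 ?_)
    have h1 : ‖z.1‖ ≤ 2 := by simpa using hz.1
    have h2 : ‖z.2‖ ≤ 2 := by simpa using hz.2
    have h3 : ‖z.1‖ ^ 2 * ‖z.2‖ ^ 2 ≤ 2 ^ 2 * 2 ^ 2 := by gcongr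
    rw [ht2]
    have : (0 : ℝ) ≤ n := Nat.cast_nonneg _
    nlinarith
  have hlow : ∀ X, 60 * t ≤ ‖toEuclideanCLM (n := ι) (𝕜 := ℝ) (Matrix.of X)‖ →
      ENNReal.ofReal (Real.exp (15 * n)) * (v * v) ≤ Z X := by
    intro X hX
    obtain ⟨x₀, y₀, hx₀, hy₀, h⟩ := exists_bilinSum_large X
    set S : Set (E × E) := Metric.closedBall x₀ (1 / 4) ×ˢ Metric.closedBall y₀ (1 / 4) with hS
    have hSB : S ⊆ B := by
      refine Set.prod_mono ?_ ?_ <;>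
      · refine Metric.closedBall_subset_closedBall' ?_
        rw [dist_zero_right]; linarith
    have hSvol : volume S = v * v := by
      rw [hS, Measure.volume_eq_prod, Measure.prod_prod,
        Measure.addHaar_closedBall_center _ x₀, Measure.addHaar_closedBall_center _ y₀]
    have hSm : MeasurableSet S := Metric.isClosed_closedBall.measurableSet.prod
      Metric.isClosed_closedBall.measurableSet
    calc _ = ∫⁻ _z in S, ENNReal.ofReal (Real.exp (15 * n)) := by rw [setLIntegral_const, hSvol]
      _ ≤ ∫⁻ z in S, F X z := by
        refine setLIntegral_mono' hSm fun z hz => ?_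
        refine ENNReal.ofReal_le_ofReal (Real.exp_le_exp.2 ?_)
        have h1 := h z.1 hz.1 z.2 hz.2
        have h2 : 15 * t ≤ bilinSum X z.1 z.2 := by linarith
        rw [← ht2]
        nlinarith
      _ ≤ Z X := lintegral_mono_set hSB
  have hmarkov := mul_meas_ge_le_lintegral₀ (μ := stdGaussianMatrix ι) (f := Z)
    (Measurable.lintegral_prod_right hFm).aemeasurable
    (ENNReal.ofReal (Real.exp (15 * n)) * (v * v))
  have hsub : stdGaussianMatrix ι {X | 60 * t ≤
      ‖toEuclideanCLM (n := ι) (𝕜 := ℝ) (Matrix.of X)‖} ≤ stdGaussianMatrix ι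
        {X | ENNReal.ofReal (Real.exp (15 * n)) * (v * v) ≤ Z X} :=
    measure_mono fun X hX => hlow X hX
  have hc0 : ENNReal.ofReal (Real.exp (15 * n)) * (v * v) ≠ 0 :=
    mul_ne_zero (by simp [Real.exp_pos]) (mul_ne_zero hv0 hv0)
  have hct : ENNReal.ofReal (Real.exp (15 * n)) * (v * v) ≠ ⊤ :=
    ENNReal.mul_ne_top ENNReal.ofReal_ne_top (ENNReal.mul_ne_top hvt hvt)
  have h8 : (8 : ℝ≥0∞) ^ n * 8 ^ n ≤ ENNReal.ofReal (Real.exp (6 * n)) := by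
    rw [← mul_pow]
    have h1 : ((8 : ℝ≥0∞) * 8) = ENNReal.ofReal 64 := by norm_num
    rw [h1, ← ENNReal.ofReal_pow (by norm_num), mul_comm (6 : ℝ), Real.exp_nat_mul]
    refine ENNReal.ofReal_le_ofReal (pow_le_pow_left₀ (by norm_num) ?_ n)
    have h2 : (64 : ℝ) ≤ 2.7 ^ 6 := by norm_num
    have h3 : Real.exp 6 = Real.exp 1 ^ 6 := by rw [← Real.exp_nat_mul]; norm_num
    rw [h3]
    refine h2.trans (pow_le_pow_left₀ (by norm_num) ?_ 6)
    have := Real.exp_one_gt_d9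
    linarith
  refine hsub.trans ((ENNReal.mul_le_mul_iff_right hc0 hct).1 ((hmarkov.trans hup).trans ?_))
  calc ENNReal.ofReal (Real.exp (8 * n)) * ((8 ^ n * v) * (8 ^ n * v))
      = ENNReal.ofReal (Real.exp (8 * n)) * (8 ^ n * 8 ^ n) * (v * v) := by ring
    _ ≤ ENNReal.ofReal (Real.exp (8 * n)) * ENNReal.ofReal (Real.exp (6 * n)) * (v * v) := by
      gcongr
    _ = ENNReal.ofReal (Real.exp (15 * n)) * ENNReal.ofReal (Real.exp (-n)) * (v * v) := by
      rw [← ENNReal.ofReal_mul (Real.exp_pos _).le, ← ENNReal.ofReal_mul (Real.exp_pos _).le,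
        ← Real.exp_add, ← Real.exp_add]
      congr 3; ring
    _ = _ := by ring

theorem stdGaussianMatrix_norm_complexify_tail :
    stdGaussianMatrix ι {X | 120 * √(Fintype.card ι) < ‖complexify X‖} ≤
      ENNReal.ofReal (Real.exp (-(Fintype.card ι : ℝ))) := by
  refine (measure_mono fun X hX => ?_).trans stdGaussianMatrix_opNorm_tail
  have h1 := norm_complexify_le X
  have h2 : 120 * √(Fintype.card ι) < ‖complexify X‖ := hX
  change 60 * √(Fintype.card ι) ≤ _
  linarith

end OperatorNorm

section UpperBound

open Matrix
open scoped Matrix.Norms.L2Operator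

namespace JordanData

variable {N : ℕ} (J : JordanData N)

/-- The index type of the rows of a family of Jordan blocks. -/
abbrev Idx : Type := Σ i, Fin (J.dim i)

theorem card_idx : Fintype.card J.Idx = N := by
  simp [Idx, Fintype.card_sigma, J.sum_dim]

theorem sum_dim_real : ∑ i, (J.dim i : ℝ) = N := by
  rw [← Nat.cast_sum, J.sum_dim]

/-- The matrix `z - M` in block form. -/
noncomputable def shifted (z : ℂ) : Matrix J.Idx J.Idx ℂ :=
  blockDiagonal' fun i => bidiag (J.dim i) (z - J.eig i)

/-- `N` times the logarithmic potential of the mixture of circle measures. -/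
noncomputable def logPot (γ : ℝ) (z : ℂ) : ℝ :=
  ∑ i, (J.dim i : ℝ) * Real.log (max ‖z - J.eig i‖ (J.radius γ i))

/-- The positive part of the logarithmic energy at `z`. -/
noncomputable def logPlus (z : ℂ) : ℝ :=
  ∑ i, (J.dim i : ℝ) * max 0 (-Real.log ‖z - J.eig i‖)

theorem logPlus_nonneg (z : ℂ) : 0 ≤ J.logPlus z :=
  Finset.sum_nonneg fun _ _ => mul_nonneg (Nat.cast_nonneg _) (le_max_left _ _)

theorem radius_pos (γ : ℝ) (i : Fin J.numBlocks) : 0 < J.radius γ i := Real.exp_pos _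

theorem dim_mul_log_radius (γ : ℝ) (hN : 2 ≤ N) (i : Fin J.numBlocks) :
    (J.dim i : ℝ) * Real.log (J.radius γ i) = -(γ - 1 / 2) * Real.log N := by
  have h1 : (0 : ℝ) < J.dim i := by exact_mod_cast J.dim_pos i
  have h2 : 0 < Real.log N := Real.log_pos (by exact_mod_cast hN)
  rw [radius, Real.log_exp, a]
  field_simp
  ring

end JordanData

theorem gramDet_le_exp {d : ℕ} (hd : 0 < d) {w r β δ L ε : ℝ} (hw : 0 < w) (hr : 0 < r)
    (hL : 0 ≤ L) (hdr : d * Real.log r = -β * L) (hδ : 0 ≤ δ) (hβ : 1 / 4 ≤ β - δ)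
    (hε : 0 < ε) (hε1 : ε ≤ 1)
    (hτ : (1 + 1 / ε) * Real.exp (-2 * (β - δ) * L) ≤ ε) :
    gramDet (w ^ 2) (Real.exp (-2 * (β - δ) * L)) d ≤
      Real.exp (2 * (d * Real.log (max w r)) + 2 * ε * d + Real.log (2 * (1 + 1 / ε) / ε) +
        8 * δ * (d * max 0 (-Real.log w))) := by
  set τ := Real.exp (-2 * (β - δ) * L) with hτdef
  have hd0 : (0 : ℝ) < d := by exact_mod_cast hd
  have h1 := gramDet_le (sq_nonneg w) (Real.exp_pos _).le hε hε1 hτ hd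
  have hmax : max ((w ^ 2) ^ d) τ ≤
      Real.exp (2 * (d * Real.log (max w r)) + 8 * δ * (d * max 0 (-Real.log w))) := by
    have hm0 : 0 ≤ 8 * δ * (d * max 0 (-Real.log w)) := by positivity
    have hlw : d * Real.log w ≤ d * Real.log (max w r) :=
      mul_le_mul_of_nonneg_left (Real.log_le_log hw (le_max_left _ _)) hd0.le
    have hlr : d * Real.log r ≤ d * Real.log (max w r) :=
      mul_le_mul_of_nonneg_left (Real.log_le_log hr (le_max_right _ _)) hd0.le
    have hw2 : (w ^ 2) ^ d = Real.exp (2 * (d * Real.log w)) := by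
      rw [← pow_mul, ← Real.exp_log (pow_pos hw _), Real.log_pow]
      congr 1; push_cast; ring
    refine max_le ?_ ?_
    · rw [hw2]
      exact Real.exp_le_exp.2 (by linarith)
    · by_cases hc : τ ≤ (w ^ 2) ^ d
      · refine hc.trans ?_
        rw [hw2]
        exact Real.exp_le_exp.2 (by linarith)
      · rw [not_le, hw2, hτdef, Real.exp_lt_exp] at hc
        refine Real.exp_le_exp.2 ?_
        have h2 : (β - δ) * L ≤ d * max 0 (-Real.log w) := by
          have : d * (-Real.log w) ≤ d * max 0 (-Real.log w) :=
            mul_le_mul_of_nonneg_left (le_max_right _ _) hd0.le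
          linarith
        have h3 : L ≤ 4 * (d * max 0 (-Real.log w)) := by
          have := mul_le_mul_of_nonneg_right hβ hL
          linarith
        have h4 := mul_le_mul_of_nonneg_left h3 hδ
        linarith
  have h2 : (1 + ε) ^ d ≤ Real.exp (ε * d) := by
    rw [mul_comm, Real.exp_nat_mul]
    exact pow_le_pow_left₀ (by linarith) (by linarith [Real.add_one_le_exp ε]) d
  have h3 : 2 * (d : ℝ) * (1 + 1 / ε) ≤ Real.exp (ε * d + Real.log (2 * (1 + 1 / ε) / ε)) := by
    rw [Real.exp_add, Real.exp_log (by positivity)]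
    have : ε * d ≤ Real.exp (ε * d) := by linarith [Real.add_one_le_exp (ε * d)]
    calc 2 * (d : ℝ) * (1 + 1 / ε) = (ε * d) * (2 * (1 + 1 / ε) / ε) := by field_simp
      _ ≤ _ := mul_le_mul_of_nonneg_right this (by positivity)
  refine h1.trans ?_
  calc 2 * (d : ℝ) * (1 + 1 / ε) * (1 + ε) ^ d * max ((w ^ 2) ^ d) τ
      ≤ Real.exp (ε * d + Real.log (2 * (1 + 1 / ε) / ε)) * Real.exp (ε * d) *
        Real.exp (2 * (d * Real.log (max w r)) + 8 * δ * (d * max 0 (-Real.log w))) := by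
        refine mul_le_mul (mul_le_mul h3 h2 (by positivity) (by positivity)) hmax ?_ (by positivity)
        exact (Real.exp_pos _).le.trans (le_max_right _ _)
    _ = _ := by
        rw [← Real.exp_add, ← Real.exp_add]
        congr 1; ring

/-- The noise level. -/
noncomputable def noiseBound (γ : ℝ) (N : ℕ) : ℝ := (N : ℝ) ^ (-γ) * (120 * √N)

theorem noiseBound_eq (γ : ℝ) {N : ℕ} (hN : 0 < N) :
    noiseBound γ N = 120 * Real.exp (-(γ - 1 / 2) * Real.log N) := by
  have hN' : (0 : ℝ) < N := by exact_mod_cast hN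
  rw [noiseBound, Real.sqrt_eq_rpow, Real.rpow_def_of_pos hN', Real.rpow_def_of_pos hN',
    mul_left_comm, ← Real.exp_add]
  congr 2; ring

theorem tendsto_exp_neg_mul_log {c : ℝ} (hc : 0 < c) :
    Tendsto (fun N : ℕ => Real.exp (-c * Real.log N)) atTop (𝓝 0) := by
  have h1 : Tendsto (fun N : ℕ => Real.log N) atTop atTop :=
    Real.tendsto_log_atTop.comp tendsto_natCast_atTop_atTop
  have h2 : Tendsto (fun N : ℕ => -c * Real.log N) atTop atBot :=
    h1.const_mul_atTop_of_neg (by linarith)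
  exact Real.tendsto_exp_atBot.comp h2

theorem Matrix.det_blockDiagonal'_eq_prod {l : ℕ} {d : Fin l → ℕ}
    (B : ∀ i, Matrix (Fin (d i)) (Fin (d i)) ℂ) : (blockDiagonal' B).det = ∏ i, (B i).det := by
  rw [(blockTriangular_blockDiagonal' B).det_fintype]
  refine Finset.prod_congr rfl fun k _ => ?_
  have hbij : Function.Bijective
      (fun p : Fin (d k) => (⟨⟨k, p⟩, rfl⟩ : {a : Σ i, Fin (d i) // a.1 = k})) := by
    constructor
    · intro p q hpq
      simpa using hpq
    · rintro ⟨⟨i, p⟩, rfl⟩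
      exact ⟨p, rfl⟩
  rw [← det_submatrix_equiv_self (Equiv.ofBijective _ hbij)]
  congr 1
  ext p q
  simp [toSquareBlock, toSquareBlockProp, blockDiagonal'_apply_eq]

theorem det_shifted_gram {N : ℕ} (J : JordanData N) (z : ℂ) (τ : ℝ) :
    (J.shifted z * (J.shifted z)ᴴ + (τ : ℂ) • 1).det =
      ∏ i, (gramDet (‖z - J.eig i‖ ^ 2) τ (J.dim i) : ℂ) := by
  have h : J.shifted z * (J.shifted z)ᴴ + (τ : ℂ) • 1 = blockDiagonal' fun i =>
      bidiag (J.dim i) (z - J.eig i) * (bidiag (J.dim i) (z - J.eig i))ᴴ + (τ : ℂ) • 1 := by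
    rw [JordanData.shifted, blockDiagonal'_conjTranspose, ← blockDiagonal'_mul]
    have h1 : (1 : Matrix J.Idx J.Idx ℂ) = blockDiagonal' fun _ => 1 := blockDiagonal'_one.symm
    rw [h1, ← blockDiagonal'_smul, ← blockDiagonal'_add]
    rfl
  rw [h, det_blockDiagonal'_eq_prod]
  exact Finset.prod_congr rfl fun i _ => det_bidiag_gram _ _ _

/-- The determinant of `z - M` plus a small perturbation is at most as large as predicted. -/
theorem norm_det_shifted_add_le {γ : ℝ} (hγ : 1 < γ) {ε : ℝ} (hε : 0 < ε) (hε1 : ε < 1) :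
    ∃ κ > 0, ∀ᶠ N : ℕ in atTop, ∀ J : JordanData N, (J.numBlocks : ℝ) ≤ κ * N →
      ∀ z : ℂ, (∀ i, z ≠ J.eig i) → ∀ E : Matrix J.Idx J.Idx ℂ, ‖E‖ ≤ noiseBound γ N →
        ‖(J.shifted z + E).det‖ ≤ Real.exp (J.logPot γ z + ε * (N + J.logPlus z)) := by
  set ε₁ := ε / 4 with hε₁
  have hε₁0 : 0 < ε₁ := by positivity
  set β := γ - 1 / 2 with hβ
  set δ := ε / 4 with hδ
  set K := Real.log (2 * (1 + 1 / ε₁) / ε₁) with hK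
  have hK0 : 0 < K := by
    refine Real.log_pos ?_
    rw [lt_div_iff₀ hε₁0]
    have : 0 < 1 / ε₁ := by positivity
    linarith
  have hβδ : 1 / 4 ≤ β - δ := by simp only [hβ, hδ]; linarith
  refine ⟨ε / K, by positivity, ?_⟩
  have t1 : Tendsto (fun N : ℕ => 120 * Real.exp (-δ * Real.log N)) atTop (𝓝 0) := by
    simpa using (tendsto_exp_neg_mul_log (c := δ) (by positivity)).const_mul 120
  have t2 : Tendsto (fun N : ℕ => (1 + 1 / ε₁) * Real.exp (-2 * (β - δ) * Real.log N)) atTop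
      (𝓝 0) := by
    have := (tendsto_exp_neg_mul_log (c := 2 * (β - δ)) (by linarith)).const_mul (1 + 1 / ε₁)
    simpa [neg_mul] using this
  filter_upwards [t1.eventually (ge_mem_nhds hε₁0), t2.eventually (ge_mem_nhds hε₁0),
    eventually_ge_atTop 2] with N h1 h2 hN J hJ z hz E hE
  set L := Real.log N with hL
  have hL0 : 0 ≤ L := Real.log_natCast_nonneg N
  set τ := Real.exp (-2 * (β - δ) * L) with hτ
  have hs : √τ = Real.exp (-(β - δ) * L) := by
    rw [hτ, show -2 * (β - δ) * L = -(β - δ) * L + -(β - δ) * L by ring, Real.exp_add,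
      Real.sqrt_mul_self (Real.exp_pos _).le]
  have h3 := norm_det_add_sq_le (A := J.shifted z) (τ := τ) (Real.exp_pos _) hE
  have h4 : noiseBound γ N / √τ ≤ ε₁ := by
    rw [noiseBound_eq γ (by omega), hs, mul_div_assoc, ← Real.exp_sub]
    refine le_of_eq_of_le ?_ h1
    congr 2
    ring
  rw [J.card_idx, det_shifted_gram, norm_prod] at h3
  have h5 : (1 + noiseBound γ N / √τ) ^ (2 * N) ≤ Real.exp (2 * ε₁ * N) := by
    have hnb : 0 ≤ noiseBound γ N / √τ := by
      rw [noiseBound_eq γ (by omega)]; positivity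
    calc (1 + noiseBound γ N / √τ) ^ (2 * N) ≤ (Real.exp ε₁) ^ (2 * N) :=
          pow_le_pow_left₀ (by linarith) (by linarith [Real.add_one_le_exp ε₁]) _
      _ = _ := by rw [← Real.exp_nat_mul]; congr 1; push_cast; ring
  have h6 : ∏ i, ‖(gramDet (‖z - J.eig i‖ ^ 2) τ (J.dim i) : ℂ)‖ ≤
      ∏ i, Real.exp (2 * (J.dim i * Real.log (max ‖z - J.eig i‖ (J.radius γ i))) +
        2 * ε₁ * J.dim i + K + 8 * δ * (J.dim i * max 0 (-Real.log ‖z - J.eig i‖))) := by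
    refine Finset.prod_le_prod (fun _ _ => norm_nonneg _) fun i _ => ?_
    have hg := gramDet_nonneg (sq_nonneg ‖z - J.eig i‖) (Real.exp_pos _).le (J.dim i) (τ := τ)
    rw [Complex.norm_real, Real.norm_of_nonneg hg]
    exact gramDet_le_exp (J.dim_pos i) (norm_pos_iff.2 (sub_ne_zero.2 (hz i)))
      (J.radius_pos γ i) hL0 (J.dim_mul_log_radius γ hN i) (by positivity) hβδ hε₁0
      (by simp only [hε₁]; linarith) h2
  rw [← Real.exp_sum] at h6
  have h7 : ‖(J.shifted z + E).det‖ ^ 2 ≤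
      Real.exp (J.logPot γ z + ε * (N + J.logPlus z)) ^ 2 := by
    refine h3.trans ((mul_le_mul h5 h6 (Finset.prod_nonneg fun _ _ => norm_nonneg _)
      (Real.exp_pos _).le).trans ?_)
    rw [← Real.exp_add, ← Real.exp_nat_mul]
    refine Real.exp_le_exp.2 ?_
    simp only [Finset.sum_add_distrib, ← Finset.mul_sum, Finset.sum_const, Finset.card_univ,
      Fintype.card_fin, nsmul_eq_mul, J.sum_dim_real]
    change 2 * ε₁ * N + (2 * J.logPot γ z + 2 * ε₁ * N + J.numBlocks * K + 8 * δ * J.logPlus z) ≤ _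
    have h8 : J.numBlocks * K ≤ ε * N := by
      calc J.numBlocks * K ≤ ε / K * N * K := mul_le_mul_of_nonneg_right hJ hK0.le
        _ = ε * N := by field_simp
    push_cast
    simp only [hε₁, hδ]
    linarith
  exact le_of_sq_le_sq h7 (Real.exp_pos _).le

end UpperBound

section SmallBall

open Matrix
open scoped Matrix.Norms.L2Operator

theorem negMomentConst_pos {σ : ℝ} (hσ : σ ≠ 0) (k : ℕ) : 0 < negMomentConst σ k := by
  have : 0 < |σ| := abs_pos.2 hσ
  exact Finset.prod_pos fun _ _ => by positivity

theorem log_negMomentConst {σ : ℝ} (hσ : σ ≠ 0) (k : ℕ) :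
    Real.log (negMomentConst σ k) =
      k * Real.log 10 - k / 2 * Real.log |σ| - 1 / 4 * Real.log (k.factorial : ℝ) := by
  have h0 : 0 < |σ| := abs_pos.2 hσ
  induction k with
  | zero => simp [negMomentConst]
  | succ k ih =>
    have h1 : negMomentConst σ (k + 1) = negMomentConst σ k *
        (10 * |σ| ^ (-1 / 2 : ℝ) * ((k + 1 : ℕ) : ℝ) ^ (-1 / 4 : ℝ)) := by
      rw [negMomentConst, Finset.prod_range_succ, negMomentConst]
    have h2 : (0 : ℝ) < ((k + 1 : ℕ) : ℝ) := by positivity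
    have h3 : (0 : ℝ) < (k.factorial : ℝ) := by exact_mod_cast k.factorial_pos
    rw [h1, Real.log_mul (negMomentConst_pos hσ k).ne' (by positivity),
      Real.log_mul (by positivity) (by positivity), Real.log_mul (by norm_num) (by positivity),
      Real.log_rpow h0, Real.log_rpow h2, ih, Nat.factorial_succ, Nat.cast_mul,
      Real.log_mul h2.ne' h3.ne']
    push_cast
    ring

theorem le_log_factorial (k : ℕ) {y : ℝ} (hy : 0 < y) :
    k * Real.log y - y ≤ Real.log (k.factorial : ℝ) := by
  have h1 := Real.pow_div_factorial_le_exp y hy.le k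
  have h3 : (0 : ℝ) < (k.factorial : ℝ) := by exact_mod_cast k.factorial_pos
  rw [div_le_iff₀ h3] at h1
  have h2 := Real.log_le_log (pow_pos hy k) h1
  rw [Real.log_pow, Real.log_mul (Real.exp_pos _).ne' h3.ne', Real.log_exp] at h2
  linarith

variable {ι : Type*} [Fintype ι] [DecidableEq ι]

/-- The diagonal projection that deletes the rows in `I`. -/
def deleteRows (I : Finset ι) : Matrix ι ι ℂ := Matrix.diagonal fun p => if p ∈ I then 0 else 1

theorem norm_deleteRows_le (I : Finset ι) : ‖deleteRows I‖ ≤ 1 := by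
  rw [deleteRows, l2_opNorm_diagonal]
  refine (pi_norm_le_iff_of_nonneg zero_le_one).2 fun p => ?_
  split_ifs <;> simp

theorem rowNoise_const {ι : Type*} (A : Matrix ι ι ℂ) (s : ℝ) (X : ι → ι → ℝ) :
    rowNoise A (fun _ => s) X = A + (s : ℂ) • complexify X := by
  ext p q
  simp [rowNoise, complexify]

theorem unitRows_add (I : Finset ι) (π : Equiv.Perm ι) (A E : Matrix ι ι ℂ) :
    unitRows I π (A + E) = unitRows I π A + deleteRows I * E := by
  ext p q
  rw [Matrix.add_apply, deleteRows, diagonal_mul]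
  by_cases hp : p ∈ I <;> simp [unitRows, hp]

/-- A small ball estimate for the determinant of a matrix perturbed by a Gaussian matrix. -/
theorem stdGaussianMatrix_norm_det_lt {A : Matrix ι ι ℂ} {s : ℝ} (hs : s ≠ 0) {I : Finset ι}
    {π : Equiv.Perm ι} {e m θ : ℝ} (hm : 0 < m) (hθ : 0 < θ)
    (h : ∀ X : ι → ι → ℝ, ‖deleteRows I * complexify X‖ ≤ e →
      m ≤ ‖(unitRows I π (A + (s : ℂ) • complexify X)).det‖) :
    stdGaussianMatrix ι {X | ‖complexify X‖ ≤ e ∧ ‖(A + (s : ℂ) • complexify X).det‖ < θ} ≤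
      ENNReal.ofReal (θ ^ (1 / 2 : ℝ) * (negMomentConst s I.card * m ^ (-1 / 2 : ℝ))) := by
  set f : (ι → ι → ℝ) → ℝ≥0∞ := fun X =>
    ‖(rowNoise A (fun _ => s) X).det‖ₑ ^ (-1 / 2 : ℝ) with hf
  have hfm : Measurable f := (measurable_det_rowNoise A _).enorm.pow_const _
  set G : Set (ι → ι → ℝ) := {X | ‖deleteRows I * complexify X‖ ≤ e} with hG
  have hGm : MeasurableSet G := by
    refine measurableSet_le (Continuous.measurable ?_) measurable_const
    exact (continuous_const.matrix_mul continuous_complexify).norm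
  set c : ℝ≥0∞ := ENNReal.ofReal (negMomentConst s I.card * m ^ (-1 / 2 : ℝ)) with hc
  have h1 : ∫⁻ X, G.indicator f X ∂(stdGaussianMatrix ι) ≤ c := by
    have hloc : ∀ (X : ι → ι → ℝ) (y : I → ι → ℝ),
        (Function.updateFinset X I y ∈ G ↔ X ∈ G) := by
      intro X y
      have : deleteRows I * complexify (Function.updateFinset X I y) =
          deleteRows I * complexify X := by
        ext p q
        rw [deleteRows, diagonal_mul, diagonal_mul]
        by_cases hp : p ∈ I
        · simp [hp]
        · simp [complexify, Function.updateFinset, hp]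
      simp only [hG, Set.mem_ofPred_eq, this]
    have h2 : lmarginal (fun _ => stdGaussianRow ι) I (G.indicator f) ≤ fun _ => c := by
      intro X
      by_cases hX : X ∈ G
      · have h3 : lmarginal (fun _ => stdGaussianRow ι) I (G.indicator f) X ≤
            lmarginal (fun _ => stdGaussianRow ι) I f X :=
          lmarginal_mono (Set.indicator_le_self _ _) X
        refine h3.trans ((lmarginal_det_rowNoise_le hs I A (fun _ => s) (fun _ _ => rfl) π X).trans
          ?_)
        rw [rowNoise_const, hc, ENNReal.ofReal_mul (negMomentConst_nonneg _ _)]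
        refine mul_le_mul' le_rfl ?_
        have h4 := h X hX
        have h5 : (unitRows I π (A + (s : ℂ) • complexify X)).det ≠ 0 := by
          rw [← norm_pos_iff]; exact hm.trans_le h4
        rw [enorm_rpow_eq_ofReal h5]
        exact ENNReal.ofReal_le_ofReal
          (Real.rpow_le_rpow_of_nonpos hm h4 (by norm_num))
      · have h3 : lmarginal (fun _ => stdGaussianRow ι) I (G.indicator f) X = 0 := by
          rw [lmarginal]
          simp [Set.indicator, hloc, hX]
        rw [h3]; exact bot_le
    calc ∫⁻ X, G.indicator f X ∂(stdGaussianMatrix ι)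
        ≤ ∫⁻ _X, c ∂(stdGaussianMatrix ι) := by
          refine lintegral_le_of_lmarginal_le I (hfm.indicator hGm) measurable_const ?_
          refine h2.trans fun X => ?_
          rw [lmarginal]
          simp
      _ = c := by simp
  have h2 : {X | ‖complexify X‖ ≤ e ∧ ‖(A + (s : ℂ) • complexify X).det‖ < θ} ⊆
      {X | ENNReal.ofReal (θ ^ (-1 / 2 : ℝ)) ≤ G.indicator f X} := by
    rintro X ⟨hX, hdet⟩
    have hXG : X ∈ G := by
      refine (l2_opNorm_mul _ _).trans ?_
      calc ‖deleteRows I‖ * ‖complexify X‖ ≤ 1 * ‖complexify X‖ :=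
            mul_le_mul_of_nonneg_right (norm_deleteRows_le I) (norm_nonneg _)
        _ ≤ e := by rw [one_mul]; exact hX
    rw [Set.mem_ofPred_eq, Set.indicator_of_mem hXG, hf]
    dsimp only
    rw [rowNoise_const, ← ENNReal.ofReal_rpow_of_pos hθ]
    refine enorm_rpow_neg_anti ?_
    rw [← ofReal_norm]
    exact ENNReal.ofReal_le_ofReal hdet.le
  have h3 := meas_ge_le_lintegral_div (μ := stdGaussianMatrix ι) (f := G.indicator f)
    (hfm.indicator hGm).aemeasurable (ε := ENNReal.ofReal (θ ^ (-1 / 2 : ℝ)))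
    (by rw [Ne, ENNReal.ofReal_eq_zero, not_le]; positivity) ENNReal.ofReal_ne_top
  refine (measure_mono h2).trans (h3.trans ?_)
  refine (ENNReal.div_le_div_right h1 _).trans (le_of_eq ?_)
  rw [hc, ← ENNReal.ofReal_div_of_pos (by positivity)]
  congr 1
  rw [show (-1 / 2 : ℝ) = -(1 / 2) by norm_num, Real.rpow_neg hθ.le, div_inv_eq_mul, mul_comm]

end SmallBall

section LowerBound

open Matrix
open scoped Matrix.Norms.L2Operator

namespace JordanData

variable {N : ℕ} (J : JordanData N)

/-- The last rows of the blocks in `S`. -/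
def lastRows (S : Finset (Fin J.numBlocks)) : Finset J.Idx :=
  S.map ⟨fun i => ⟨i, ⟨J.dim i - 1, Nat.sub_lt (J.dim_pos i) one_pos⟩⟩, fun i j h => by
    simpa using congrArg Sigma.fst h⟩

theorem mem_lastRows {S : Finset (Fin J.numBlocks)} {p : J.Idx} :
    p ∈ J.lastRows S ↔ p.1 ∈ S ∧ (p.2 : ℕ) + 1 = J.dim p.1 := by
  rw [lastRows, Finset.mem_map]
  constructor
  · rintro ⟨i, hi, rfl⟩
    have := J.dim_pos i
    refine ⟨hi, ?_⟩
    change J.dim i - 1 + 1 = J.dim i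
    omega
  · rintro ⟨h1, h2⟩
    refine ⟨p.1, h1, ?_⟩
    obtain ⟨i, q⟩ := p
    refine Sigma.ext rfl (heq_of_eq (Fin.ext ?_))
    change J.dim i - 1 = q
    simp only at h2
    omega

/-- The permutation that interchanges the first and the last index of every block. -/
def swapEnds : Equiv.Perm J.Idx :=
  Equiv.sigmaCongrRight fun i => Equiv.swap ⟨0, J.dim_pos i⟩
    ⟨J.dim i - 1, Nat.sub_lt (J.dim_pos i) one_pos⟩

/-- The blocks of `z - M`, the last row being replaced by the first unit vector in the blocks
in `S`. -/
noncomputable def cutBlock (S : Finset (Fin J.numBlocks)) (z : ℂ) (i : Fin J.numBlocks) :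
    Matrix (Fin (J.dim i)) (Fin (J.dim i)) ℂ :=
  if i ∈ S then bidiagCyc (J.dim i) (z - J.eig i) else bidiag (J.dim i) (z - J.eig i)

theorem unitRows_shifted (S : Finset (Fin J.numBlocks)) (z : ℂ) :
    unitRows (J.lastRows S) J.swapEnds (J.shifted z) = blockDiagonal' (J.cutBlock S z) := by
  ext ⟨i, p⟩ ⟨j, q⟩
  simp only [unitRows, Matrix.of_apply, mem_lastRows]
  by_cases hij : i = j
  · subst hij
    rw [blockDiagonal'_apply_eq]
    by_cases h : i ∈ S ∧ (p : ℕ) + 1 = J.dim i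
    · have hp : p = ⟨J.dim i - 1, Nat.sub_lt (J.dim_pos i) one_pos⟩ :=
        Fin.ext (by simp only; omega)
      have h1 : J.swapEnds ⟨i, p⟩ = ⟨i, ⟨0, J.dim_pos i⟩⟩ := by
        simp only [swapEnds, Equiv.sigmaCongrRight_apply]
        rw [hp, Equiv.swap_apply_right]
      rw [if_pos h, h1, cutBlock, if_pos h.1, bidiagCyc, Matrix.of_apply, if_pos h.2]
      by_cases hq : (q : ℕ) = 0
      · have : (⟨0, J.dim_pos i⟩ : Fin (J.dim i)) = q := Fin.ext hq.symm
        simp [this, hq]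
      · have : (⟨0, J.dim_pos i⟩ : Fin (J.dim i)) ≠ q := fun h => hq (by rw [← h])
        simp [this, hq]
    · rw [if_neg h, shifted, blockDiagonal'_apply_eq, cutBlock]
      by_cases hS : i ∈ S
      · have : ¬ ((p : ℕ) + 1 = J.dim i) := fun h' => h ⟨hS, h'⟩
        rw [if_pos hS, bidiagCyc, Matrix.of_apply, if_neg this]
      · rw [if_neg hS]
  · rw [blockDiagonal'_apply_ne _ _ _ hij]
    split_ifs with h1 h2
    · exact absurd (congrArg Sigma.fst h2) hij
    · rfl
    · rw [shifted, blockDiagonal'_apply_ne _ _ _ hij]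

theorem norm_det_cutBlock (S : Finset (Fin J.numBlocks)) (z : ℂ) :
    ‖(blockDiagonal' (J.cutBlock S z)).det‖ =
      ∏ i, if i ∈ S then 1 else ‖z - J.eig i‖ ^ J.dim i := by
  rw [det_blockDiagonal'_eq_prod, norm_prod]
  refine Finset.prod_congr rfl fun i _ => ?_
  rw [cutBlock]
  split_ifs
  · exact norm_det_bidiagCyc (J.dim_pos i) _
  · rw [det_bidiag, norm_pow]

theorem le_norm_det_unitRows {S : Finset (Fin J.numBlocks)} {z : ℂ} {κ e : ℝ} (hκ : 0 ≤ κ)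
    (hB : ∀ i, ∀ v : Fin (J.dim i) → ℂ,
      ‖WithLp.toLp 2 v‖ ≤ κ * ‖WithLp.toLp 2 (J.cutBlock S z i *ᵥ v)‖)
    (he : κ * e ≤ 1) {E : Matrix J.Idx J.Idx ℂ} (hE : ‖deleteRows (J.lastRows S) * E‖ ≤ e) :
    (∏ i, if i ∈ S then 1 else ‖z - J.eig i‖ ^ J.dim i) * (1 - κ * e) ^ N ≤
      ‖(unitRows (J.lastRows S) J.swapEnds (J.shifted z + E)).det‖ := by
  rw [unitRows_add, unitRows_shifted, ← norm_det_cutBlock]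
  have h := le_norm_det_add hκ (norm_le_blockDiagonal'_mulVec hκ hB) hE he
  rwa [J.card_idx] at h

/-- The blocks whose smallest singular value is dominated by the noise, together with the long
blocks with eigenvalue near `z`. -/
noncomputable def noisyBlocks (β δ : ℝ) (z : ℂ) : Finset (Fin J.numBlocks) := by
  classical
  exact Finset.univ.filter fun i =>
    ((J.dim i : ℝ) ≤ Real.exp (δ * Real.log N) ∧
      ‖z - J.eig i‖ ^ J.dim i < Real.exp (-(β - 3 * δ) * Real.log N)) ∨
    (Real.exp (δ * Real.log N) < J.dim i ∧ ‖z - J.eig i‖ < 1)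

theorem mem_noisyBlocks {β δ : ℝ} {z : ℂ} {i : Fin J.numBlocks} :
    i ∈ J.noisyBlocks β δ z ↔ ((J.dim i : ℝ) ≤ Real.exp (δ * Real.log N) ∧
      ‖z - J.eig i‖ ^ J.dim i < Real.exp (-(β - 3 * δ) * Real.log N)) ∨
    (Real.exp (δ * Real.log N) < J.dim i ∧ ‖z - J.eig i‖ < 1) := by
  simp [noisyBlocks]

theorem norm_lt_one_of_mem_noisyBlocks {β δ : ℝ} (hβ : 0 ≤ β - 3 * δ) {z : ℂ}
    {i : Fin J.numBlocks} (hi : i ∈ J.noisyBlocks β δ z) : ‖z - J.eig i‖ < 1 := by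
  rcases J.mem_noisyBlocks.1 hi with ⟨-, h⟩ | ⟨-, h⟩
  · by_contra hc
    have h1 : 1 ≤ ‖z - J.eig i‖ ^ J.dim i := one_le_pow₀ (not_lt.1 hc)
    have h2 : Real.exp (-(β - 3 * δ) * Real.log N) ≤ 1 := by
      rw [Real.exp_le_one_iff]
      have := mul_nonneg hβ (Real.log_natCast_nonneg N)
      linarith
    linarith
  · exact h

/-- The condition that `z` keeps away from the unit circles around the eigenvalues of the very
long blocks. -/
def AwayFromCircles (δ : ℝ) (z : ℂ) : Prop :=
  ∀ i, Real.exp (1 / 2 * Real.log N) ≤ J.dim i →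
    Real.exp (-(1 / 2 + δ) * Real.log N) ≤ |‖z - J.eig i‖ - 1|

theorem norm_le_cutBlock_mulVec {β δ : ℝ} (hδ : 0 < δ) (hβ : 1 / 2 + 3 * δ ≤ β) {z : ℂ}
    (hz : ∀ i, z ≠ J.eig i) (hc : J.AwayFromCircles δ z) (i : Fin J.numBlocks)
    (v : Fin (J.dim i) → ℂ) :
    ‖WithLp.toLp 2 v‖ ≤ Real.exp ((β - 2 * δ) * Real.log N) *
      ‖WithLp.toLp 2 (J.cutBlock (J.noisyBlocks β δ z) z i *ᵥ v)‖ := by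
  set L := Real.log N with hL
  have hL0 : 0 ≤ L := Real.log_natCast_nonneg N
  set w := ‖z - J.eig i‖ with hw
  have hw0 : 0 < w := norm_pos_iff.2 (sub_ne_zero.2 (hz i))
  have hexp : ∀ {a b : ℝ}, a ≤ b → Real.exp (a * L) ≤ Real.exp (b * L) := fun h =>
    Real.exp_le_exp.2 (mul_le_mul_of_nonneg_right h hL0)
  have hgap : Real.exp (1 / 2 * L) ≤ J.dim i →
      (|w - 1|)⁻¹ ≤ Real.exp ((β - 2 * δ) * L) ∧ w ≠ 1 := by
    intro hd
    have h1 := hc i hd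
    have h2 : 0 < |w - 1| := (Real.exp_pos _).trans_le h1
    refine ⟨?_, fun h => by rw [h] at h2; simp at h2⟩
    have h3 := inv_anti₀ (Real.exp_pos _) h1
    rw [← Real.exp_neg] at h3
    refine h3.trans ?_
    rw [neg_mul, neg_neg]
    exact hexp (by linarith)
  have hfin : ∀ {c : ℝ} {u : Fin (J.dim i) → ℂ}, c ≤ Real.exp ((β - 2 * δ) * L) →
      ‖WithLp.toLp 2 v‖ ≤ c * ‖WithLp.toLp 2 u‖ →
      ‖WithLp.toLp 2 v‖ ≤ Real.exp ((β - 2 * δ) * L) * ‖WithLp.toLp 2 u‖ := fun h1 h2 =>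
    h2.trans (mul_le_mul_of_nonneg_right h1 (norm_nonneg _))
  have hmed : ¬ Real.exp (1 / 2 * L) ≤ J.dim i → (J.dim i : ℝ) ≤ Real.exp ((β - 2 * δ) * L) :=
    fun h => (not_le.1 h).le.trans (hexp (by linarith))
  rw [cutBlock]
  by_cases hS : i ∈ J.noisyBlocks β δ z
  · have hw1 : w < 1 := J.norm_lt_one_of_mem_noisyBlocks (by linarith) hS
    rw [if_pos hS]
    by_cases hd : Real.exp (1 / 2 * L) ≤ J.dim i
    · refine hfin ?_ (norm_le_bidiagCyc_mulVec_of_lt_one (J.dim_pos i) hw1 v)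
      have := (hgap hd).1
      rwa [abs_sub_comm, abs_of_pos (by linarith)] at this
    · exact hfin (hmed hd) (norm_le_bidiagCyc_mulVec (J.dim_pos i) hw1.le v)
  · rw [if_neg hS]
    rw [mem_noisyBlocks, not_or, not_and, not_and, not_lt, not_lt] at hS
    by_cases hw1 : 1 ≤ w
    · by_cases hd : Real.exp (1 / 2 * L) ≤ J.dim i
      · have h1 := hgap hd
        have hw2 : 1 < w := lt_of_le_of_ne hw1 (Ne.symm h1.2)
        refine hfin ?_ (norm_le_bidiag_mulVec_of_one_lt hw2 v)
        have := h1.1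
        rwa [abs_of_pos (by linarith)] at this
      · refine hfin (hmed hd) ?_
        have := norm_le_bidiag_mulVec one_pos le_rfl hw1 v
        simpa using this
    · have hd : (J.dim i : ℝ) ≤ Real.exp (δ * L) := by
        by_contra hd
        exact hw1 (hS.2 (not_le.1 hd))
      refine hfin ?_ (norm_le_bidiag_mulVec hw0 (not_le.1 hw1).le le_rfl v)
      have h1 := inv_anti₀ (Real.exp_pos _) (hS.1 hd)
      rw [← Real.exp_neg] at h1
      calc (w ^ J.dim i)⁻¹ * J.dim i ≤ Real.exp (-(-(β - 3 * δ) * L)) * Real.exp (δ * L) :=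
            mul_le_mul h1 hd (Nat.cast_nonneg _) (Real.exp_pos _).le
        _ = _ := by rw [← Real.exp_add]; congr 1; ring

/-- The comparison of a block with its contribution to the potential. -/
theorem dim_mul_log_max_le {γ δ : ℝ} (hN : 2 ≤ N) (hδ : 0 < δ) (hβ : 1 / 4 ≤ γ - 1 / 2 - 3 * δ)
    {z : ℂ} (hz : ∀ i, z ≠ J.eig i) (i : Fin J.numBlocks) :
    J.dim i * Real.log (max ‖z - J.eig i‖ (J.radius γ i)) ≤
      (if i ∈ J.noisyBlocks (γ - 1 / 2) δ z then -(γ - 1 / 2) * Real.log N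
        else J.dim i * Real.log ‖z - J.eig i‖) +
      (12 * δ * (J.dim i * max 0 (-Real.log ‖z - J.eig i‖)) +
        J.dim i * ((γ - 1 / 2) * Real.log N * Real.exp (-δ * Real.log N))) := by
  set β := γ - 1 / 2 with hβdef
  set L := Real.log N with hL
  have hL0 : 0 ≤ L := Real.log_natCast_nonneg N
  set w := ‖z - J.eig i‖ with hw
  have hw0 : 0 < w := norm_pos_iff.2 (sub_ne_zero.2 (hz i))
  have hr0 := J.radius_pos γ i
  have hr : (J.dim i : ℝ) * Real.log (J.radius γ i) = -β * L := J.dim_mul_log_radius γ hN i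
  have hd0 : (0 : ℝ) < J.dim i := by exact_mod_cast J.dim_pos i
  have hpl : 0 ≤ J.dim i * max 0 (-Real.log w) := mul_nonneg hd0.le (le_max_left _ _)
  have hpl2 : J.dim i * (-Real.log w) ≤ J.dim i * max 0 (-Real.log w) :=
    mul_le_mul_of_nonneg_left (le_max_right _ _) hd0.le
  have hβ0 : 0 ≤ β := by linarith
  have hlong : 0 ≤ J.dim i * (β * L * Real.exp (-δ * L)) := by positivity
  have hmaxle : ∀ {c : ℝ}, J.dim i * Real.log w ≤ c → -β * L ≤ c →
      J.dim i * Real.log (max w (J.radius γ i)) ≤ c := by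
    intro c h1 h2
    rcases le_total w (J.radius γ i) with h | h
    · rw [max_eq_right h, hr]; exact h2
    · rw [max_eq_left h]; exact h1
  have hδpl : 0 ≤ 12 * δ * (J.dim i * max 0 (-Real.log w)) := mul_nonneg (by linarith) hpl
  have hpow : w ^ J.dim i = Real.exp (J.dim i * Real.log w) := by
    rw [← Real.exp_log (pow_pos hw0 _), Real.log_pow]
  split_ifs with hS
  · rcases J.mem_noisyBlocks.1 hS with ⟨-, h⟩ | ⟨h, hw1⟩
    · rw [← hw, hpow, Real.exp_lt_exp] at h
      refine hmaxle ?_ (by linarith)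
      have h1 : (β - 3 * δ) * L ≤ J.dim i * max 0 (-Real.log w) := by linarith
      have h2 := mul_le_mul_of_nonneg_right hβ hL0
      have h3 : L ≤ 4 * (J.dim i * max 0 (-Real.log w)) := by linarith
      have h4 := mul_le_mul_of_nonneg_left h3 hδ.le
      linarith
    · have h1 : β * L ≤ J.dim i * (β * L * Real.exp (-δ * L)) := by
        have h2 : 1 ≤ J.dim i * Real.exp (-δ * L) := by
          rw [neg_mul, Real.exp_neg, ← div_eq_mul_inv, one_le_div (Real.exp_pos _)]
          exact h.le
        have h3 := mul_le_mul_of_nonneg_left h2 (mul_nonneg hβ0 hL0)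
        linarith
      have h4 : J.dim i * Real.log w ≤ 0 :=
        mul_nonpos_of_nonneg_of_nonpos hd0.le (Real.log_nonpos hw0.le (le_of_lt hw1))
      exact hmaxle (by linarith) (by linarith)
  · rw [mem_noisyBlocks, not_or, not_and, not_and, not_lt, not_lt] at hS
    refine hmaxle (by linarith) ?_
    have h5 : -β * L ≤ J.dim i * Real.log w := by
      by_cases hd : (J.dim i : ℝ) ≤ Real.exp (δ * L)
      · have h1 := hS.1 hd
        rw [← hw, hpow, Real.exp_le_exp] at h1
        have := mul_nonneg hδ.le hL0
        linarith
      · have h1 := hS.2 (not_le.1 hd)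
        have h2 : 0 ≤ J.dim i * Real.log w := mul_nonneg hd0.le (Real.log_nonneg h1)
        have := mul_nonneg hβ0 hL0
        linarith
    linarith

end JordanData

/-- The determinant of `z - M` plus a small Gaussian perturbation is rarely much smaller than
predicted. -/
theorem stdGaussianMatrix_norm_det_shifted_lt {γ : ℝ} (hγ : 1 < γ) {ε : ℝ} (hε : 0 < ε)
    (hε1 : ε < 1) :
    ∃ κ > 0, ∃ δ > 0, ∀ᶠ N : ℕ in atTop, ∀ J : JordanData N, (J.numBlocks : ℝ) ≤ κ * N →
      ∀ s : ℝ, |s| = (N : ℝ) ^ (-γ) → ∀ z : ℂ, (∀ i, z ≠ J.eig i) → J.AwayFromCircles δ z →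
        stdGaussianMatrix J.Idx {X | ‖complexify X‖ ≤ 120 * √N ∧
          ‖(J.shifted z + (s : ℂ) • complexify X).det‖ <
            Real.exp (J.logPot γ z - ε * (N + J.logPlus z))} ≤
          ENNReal.ofReal (Real.exp (-(ε / 4) * N)) := by
  set β := γ - 1 / 2 with hβ
  set δ := min (ε / 12) ((γ - 1) / 3) with hδ
  have hδ0 : 0 < δ := lt_min (by positivity) (by linarith)
  have hδ1 : 12 * δ ≤ ε := by have := min_le_left (ε / 12) ((γ - 1) / 3); linarith
  have hδ2 : 1 / 2 + 3 * δ ≤ β := by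
    have := min_le_right (ε / 12) ((γ - 1) / 3)
    simp only [hβ]; linarith
  have hδ3 : 1 / 4 ≤ β - 3 * δ := by simp only [hβ]; linarith
  set C := 2 * Real.log 10 + 1 / 2 * (-Real.log (ε / 4)) with hC
  have hC0 : 0 < C := by
    have h1 : 0 < Real.log 10 := Real.log_pos (by norm_num)
    have h2 : Real.log (ε / 4) < 0 := Real.log_neg (by positivity) (by linarith)
    simp only [hC]; linarith
  refine ⟨ε / 8 / C, by positivity, δ, hδ0, ?_⟩
  have t1 : Tendsto (fun N : ℕ => 120 * Real.exp (-(2 * δ) * Real.log N)) atTop (𝓝 0) := by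
    simpa using (tendsto_exp_neg_mul_log (c := 2 * δ) (by positivity)).const_mul 120
  have t2 : Tendsto (fun N : ℕ => β * Real.log N * Real.exp (-δ * Real.log N)) atTop (𝓝 0) := by
    have h1 : Tendsto (fun x : ℝ => x ^ 1 * Real.exp (-δ * x)) atTop (𝓝 0) := by
      have := Real.tendsto_pow_mul_exp_neg_atTop_nhds_zero 1
      have h2 := (this.comp (tendsto_id.const_mul_atTop hδ0)).const_mul δ⁻¹
      rw [mul_zero] at h2
      refine h2.congr fun x => ?_
      simp only [Function.comp, id_eq, pow_one, neg_mul]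
      field_simp
    have h2 := (h1.comp (Real.tendsto_log_atTop.comp tendsto_natCast_atTop_atTop)).const_mul β
    rw [mul_zero] at h2
    refine h2.congr fun N => ?_
    simp only [Function.comp, pow_one]
    ring
  have hε80 : 0 < ε / 16 := by positivity
  filter_upwards [t1.eventually (ge_mem_nhds hε80), t2.eventually (ge_mem_nhds hε80),
    eventually_ge_atTop 2] with N h1 h2 hN J hJ s hs z hz hc
  set L := Real.log N with hL
  have hN0 : (0 : ℝ) < N := by positivity
  have hL0 : 0 ≤ L := Real.log_natCast_nonneg N
  have hs0 : 0 < |s| := by rw [hs]; positivity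
  have hlogs : Real.log |s| = -γ * L := by rw [hs, Real.log_rpow hN0]
  set S := J.noisyBlocks β δ z with hS
  set k := (J.lastRows S).card with hk
  have hkS : k = S.card := by rw [hk, JordanData.lastRows, Finset.card_map]
  have hkℓ : (k : ℝ) ≤ J.numBlocks := by
    rw [hkS]; exact_mod_cast (Finset.card_le_univ S).trans_eq (Fintype.card_fin _)
  set κ := Real.exp ((β - 2 * δ) * L) with hκ
  have hκe : κ * (|s| * (120 * √N)) = 120 * Real.exp (-(2 * δ) * L) := by
    have := noiseBound_eq γ (show 0 < N by omega)
    rw [noiseBound] at this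
    rw [hs, this, hκ, mul_left_comm, ← Real.exp_add]
    congr 2
    simp only [hβ]; ring
  have hκe1 : κ * (|s| * (120 * √N)) ≤ ε / 16 := by rw [hκe]; exact h1
  set m := (∏ i, if i ∈ S then 1 else ‖z - J.eig i‖ ^ J.dim i) *
    (1 - κ * (|s| * (120 * √N))) ^ N with hm
  have hw0 : ∀ i, 0 < ‖z - J.eig i‖ := fun i => norm_pos_iff.2 (sub_ne_zero.2 (hz i))
  have hprodpos : 0 < ∏ i, if i ∈ S then 1 else ‖z - J.eig i‖ ^ J.dim i := by
    refine Finset.prod_pos fun i _ => ?_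
    split_ifs
    · exact one_pos
    · exact pow_pos (hw0 i) _
  have hm0 : 0 < m := mul_pos hprodpos (pow_pos (by linarith) _)
  set θ := Real.exp (J.logPot γ z - ε * (N + J.logPlus z)) with hθ
  have key := stdGaussianMatrix_norm_det_lt (A := J.shifted z) (s := s) (I := J.lastRows S)
    (π := J.swapEnds) (e := 120 * √N) (m := m) (θ := θ) (abs_pos.1 hs0) hm0 (Real.exp_pos _)
    fun X hX => by
      refine J.le_norm_det_unitRows (Real.exp_pos _).le
        (J.norm_le_cutBlock_mulVec hδ0 hδ2 hz hc) (by linarith) ?_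
      rw [Matrix.mul_smul, norm_smul, Complex.norm_real, Real.norm_eq_abs]
      exact mul_le_mul_of_nonneg_left hX (abs_nonneg s)
  refine key.trans (ENNReal.ofReal_le_ofReal ?_)
  have hM0 := negMomentConst_pos (abs_pos.1 hs0) k
  have hbpos : 0 < θ ^ (1 / 2 : ℝ) * (negMomentConst s k * m ^ (-1 / 2 : ℝ)) := by positivity
  rw [← Real.log_le_iff_le_exp hbpos]
  rw [Real.log_mul (by positivity) (by positivity), Real.log_mul hM0.ne' (by positivity),
    Real.log_rpow (Real.exp_pos _), Real.log_rpow hm0, Real.log_exp,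
    log_negMomentConst (abs_pos.1 hs0), hlogs]
  have hfac := le_log_factorial k (y := ε / 4 * N) (by positivity)
  rw [Real.log_mul (by positivity) hN0.ne'] at hfac
  have hlogm : Real.log m = (∑ i, if i ∈ S then 0 else J.dim i * Real.log ‖z - J.eig i‖) +
      N * Real.log (1 - κ * (|s| * (120 * √N))) := by
    rw [hm, Real.log_mul hprodpos.ne' (pow_pos (by linarith) _).ne', Real.log_pow,
      Real.log_prod]
    · congr 1
      refine Finset.sum_congr rfl fun i _ => ?_
      split_ifs
      · exact Real.log_one
      · exact Real.log_pow _ _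
    · intro i _
      split_ifs
      · exact one_ne_zero
      · exact (pow_pos (hw0 i) _).ne'
  have hlog1 : -(ε / 8) ≤ Real.log (1 - κ * (|s| * (120 * √N))) := by
    have h3 : 1 - ε / 16 ≤ 1 - κ * (|s| * (120 * √N)) := by linarith
    refine le_trans ?_ (Real.log_le_log (by linarith) h3)
    have h4 := Real.one_sub_inv_le_log_of_pos (show 0 < 1 - ε / 16 by linarith)
    refine le_trans ?_ h4
    have h5 : (1 - ε / 16)⁻¹ ≤ 1 + ε / 8 := by
      rw [inv_le_comm₀ (by linarith) (by linarith), inv_le_iff_one_le_mul₀ (by linarith)]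
      nlinarith
    linarith
  have hpot : J.logPot γ z ≤ k * (-β * L) +
      (∑ i, if i ∈ S then 0 else J.dim i * Real.log ‖z - J.eig i‖) +
      (12 * δ * J.logPlus z + N * (β * L * Real.exp (-δ * L))) := by
    have h3 : J.logPot γ z ≤ ∑ i, ((if i ∈ S then -β * L else J.dim i * Real.log ‖z - J.eig i‖) +
        (12 * δ * (J.dim i * max 0 (-Real.log ‖z - J.eig i‖)) +
        J.dim i * (β * L * Real.exp (-δ * L)))) :=
      Finset.sum_le_sum fun i _ => J.dim_mul_log_max_le hN hδ0 hδ3 hz i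
    refine h3.trans (le_of_eq ?_)
    rw [Finset.sum_add_distrib, Finset.sum_add_distrib, ← Finset.mul_sum, ← Finset.sum_mul,
      J.sum_dim_real]
    congr 1
    have h4 : ∀ i, (if i ∈ S then -β * L else J.dim i * Real.log ‖z - J.eig i‖) =
        (if i ∈ S then -β * L else 0) +
          (if i ∈ S then 0 else J.dim i * Real.log ‖z - J.eig i‖) := by
      intro i; split_ifs <;> simp
    simp_rw [h4]
    rw [Finset.sum_add_distrib, Finset.sum_ite_mem, Finset.univ_inter, Finset.sum_const,
      nsmul_eq_mul, hkS]
  have hkC : k * C ≤ ε / 8 * N := by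
    calc k * C ≤ (ε / 8 / C * N) * C := mul_le_mul_of_nonneg_right (hkℓ.trans hJ) hC0.le
      _ = _ := by field_simp
  have hpl := J.logPlus_nonneg z
  have hpl2 : 12 * δ * J.logPlus z ≤ ε * J.logPlus z := mul_le_mul_of_nonneg_right hδ1 hpl
  have hb1 := mul_le_mul_of_nonneg_left hlog1 hN0.le
  have hb2 := mul_le_mul_of_nonneg_left h2 hN0.le
  rw [hlogm]
  simp only [hC] at hkC
  have hkγ : (k : ℝ) * (γ * L) = k * (β * L) + k * L / 2 := by rw [hβ]; ring
  rw [← hL] at hfac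
  linarith only [hkγ, hfac, hpot, hpl2, hb1, hb2, hkC, mul_nonneg hε.le hN0.le]

end LowerBound

section LogPotential

open Metric

/-- The square of the `L²` norm of `log ‖z‖` on the disc of radius `R`. -/
noncomputable def logSqIntegral (R : ℝ) : ℝ≥0∞ :=
  ∫⁻ z in ball (0 : ℂ) R, ‖Real.log ‖z‖‖ₑ ^ 2

theorem mul_sq_log_eq {y : ℝ} (hy : 0 ≤ y) :
    y * Real.log y ^ 2 = 4 * (√y * Real.log √y) ^ 2 := by
  rw [Real.log_sqrt hy, mul_pow, Real.sq_sqrt hy]; ring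

theorem logSqIntegral_lt_top (R : ℝ) : logSqIntegral R < ⊤ := by
  have h : IntegrableOn (fun z : ℂ => Real.log ‖z‖ ^ 2) (ball (0 : ℂ) R) := by
    rw [integrableOn_fun_norm_addHaar (μ := volume) (f := fun y : ℝ => Real.log y ^ 2),
      Complex.finrank_real_complex]
    have h1 : Continuous fun y : ℝ => 4 * (√y * Real.log √y) ^ 2 :=
      ((Real.continuous_mul_log.comp Real.continuous_sqrt).pow 2).const_mul 4
    refine IntegrableOn.congr_fun (f := fun y : ℝ => 4 * (√y * Real.log √y) ^ 2)
      ((h1.integrableOn_Icc (a := 0) (b := R)).mono_set Set.Ioo_subset_Icc_self) (fun y hy => ?_)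
      measurableSet_Ioo
    simp only [smul_eq_mul, Nat.add_one_sub_one, pow_one]
    exact (mul_sq_log_eq hy.1.le).symm
  refine lt_of_eq_of_lt ?_ h.2
  rw [logSqIntegral]
  refine lintegral_congr fun z => ?_
  rw [enorm_pow]

theorem ENNReal.le_add_inv_mul_sq {K : ℝ≥0} (hK : K ≠ 0) (x : ℝ≥0∞) :
    x ≤ K + (K : ℝ≥0∞)⁻¹ * x ^ 2 := by
  rcases le_total x K with h | h
  · exact h.trans le_self_add
  · refine le_trans ?_ le_add_self
    calc x = (K : ℝ≥0∞)⁻¹ * (K * x) := by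
          rw [← mul_assoc, ENNReal.inv_mul_cancel (by simpa using hK) (by simp), one_mul]
      _ ≤ (K : ℝ≥0∞)⁻¹ * (x * x) := by gcongr
      _ = _ := by rw [sq]

theorem lintegral_enorm_log_sub_le {R R₀ : ℝ} {A : Set ℂ} (hA : A ⊆ ball 0 R) {w : ℂ}
    (hw : ‖w‖ ≤ R₀) {K : ℝ≥0} (hK : K ≠ 0) :
    ∫⁻ z in A, ‖Real.log ‖w - z‖‖ₑ ≤
      K * volume A + (K : ℝ≥0∞)⁻¹ * logSqIntegral (R + R₀) := by
  have hm : Measurable fun z : ℂ => ‖Real.log ‖w - z‖‖ₑ := by fun_prop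
  calc ∫⁻ z in A, ‖Real.log ‖w - z‖‖ₑ
      ≤ ∫⁻ z in A, (K + (K : ℝ≥0∞)⁻¹ * ‖Real.log ‖w - z‖‖ₑ ^ 2) :=
        lintegral_mono fun z => ENNReal.le_add_inv_mul_sq hK _
    _ = K * volume A + (K : ℝ≥0∞)⁻¹ * ∫⁻ z in A, ‖Real.log ‖w - z‖‖ₑ ^ 2 := by
        rw [lintegral_add_left measurable_const, setLIntegral_const,
          lintegral_const_mul _ (hm.pow_const 2)]
    _ ≤ _ := by
        gcongr
        rw [logSqIntegral, ← lintegral_indicator measurableSet_ball,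
          ← lintegral_sub_left_eq_self (μ := volume) _ w]
        refine (lintegral_mono_set hA).trans ?_
        rw [← lintegral_indicator measurableSet_ball]
        refine lintegral_mono fun z => ?_
        by_cases hz : z ∈ ball (0 : ℂ) R
        · rw [Set.indicator_of_mem hz, Set.indicator_of_mem]
          rw [mem_ball_zero_iff] at hz ⊢
          calc ‖w - z‖ ≤ ‖w‖ + ‖z‖ := norm_sub_le _ _
            _ < R + R₀ := by linarith
        · rw [Set.indicator_of_notMem hz]
          exact bot_le

/-- The kernel `q z * log ‖a t - z‖` is integrable. -/
theorem integrable_mul_log_norm_sub {T : Type*} [MeasurableSpace T] {τ : Measure T}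
    [IsFiniteMeasure τ] {a : T → ℂ} (ha : Measurable a) {R₀ : ℝ} (ha0 : ∀ᵐ t ∂τ, ‖a t‖ ≤ R₀)
    {q : ℂ → ℝ} (hq : Continuous q) {C R : ℝ} (hC : ∀ z, |q z| ≤ C)
    (hR : ∀ z, R ≤ ‖z‖ → q z = 0) :
    Integrable (fun p : T × ℂ => q p.2 * Real.log ‖a p.1 - p.2‖) (τ.prod volume) := by
  have hm : Measurable (fun p : T × ℂ => q p.2 * Real.log ‖a p.1 - p.2‖) := by
    have := hq.measurable
    fun_prop
  refine ⟨hm.aestronglyMeasurable, ?_⟩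
  rw [HasFiniteIntegral, lintegral_prod _ hm.enorm.aemeasurable]
  have hb : ∀ᵐ t ∂τ, ∫⁻ z, ‖q z * Real.log ‖a t - z‖‖ₑ ≤
      ENNReal.ofReal C * (volume (ball (0 : ℂ) R) + logSqIntegral (R + R₀)) := by
    filter_upwards [ha0] with t ht
    calc ∫⁻ z, ‖q z * Real.log ‖a t - z‖‖ₑ
        ≤ ∫⁻ z, (ball (0 : ℂ) R).indicator
            (fun z => ENNReal.ofReal C * ‖Real.log ‖a t - z‖‖ₑ) z := by
          refine lintegral_mono fun z => ?_
          by_cases hz : z ∈ ball (0 : ℂ) R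
          · rw [Set.indicator_of_mem hz, enorm_mul]
            gcongr
            rw [← ofReal_norm]
            exact ENNReal.ofReal_le_ofReal (hC z)
          · rw [mem_ball_zero_iff, not_lt] at hz
            simp [hR z hz]
      _ = ENNReal.ofReal C * ∫⁻ z in ball (0 : ℂ) R, ‖Real.log ‖a t - z‖‖ₑ := by
          rw [lintegral_indicator measurableSet_ball, lintegral_const_mul _ (by fun_prop)]
      _ ≤ _ := by
          gcongr
          simpa using lintegral_enorm_log_sub_le (le_refl (ball (0 : ℂ) R)) ht one_ne_zero
  refine (lintegral_mono_ae hb).trans_lt ?_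
  rw [lintegral_const]
  exact ENNReal.mul_lt_top (ENNReal.mul_lt_top ENNReal.ofReal_lt_top
    (ENNReal.add_lt_top.2 ⟨measure_ball_lt_top, logSqIntegral_lt_top _⟩)) (measure_lt_top _ _)

/-- The logarithmic potential of a measure on the plane. -/
noncomputable def logPotential (ν : Measure ℂ) (z : ℂ) : ℝ := ∫ w, Real.log ‖w - z‖ ∂ν

theorem measurable_logPotential (ν : Measure ℂ) [SFinite ν] : Measurable (logPotential ν) := by
  have h : Measurable fun p : ℂ × ℂ => Real.log ‖p.2 - p.1‖ := by fun_prop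
  exact h.stronglyMeasurable.integral_prod_right.measurable

theorem lintegral_enorm_logPotential_le {ν : Measure ℂ} [IsProbabilityMeasure ν] {R R₀ : ℝ}
    (hν : ∀ᵐ w ∂ν, ‖w‖ ≤ R₀) {A : Set ℂ} (hA : A ⊆ ball 0 R) {K : ℝ≥0} (hK : K ≠ 0) :
    ∫⁻ z in A, ‖logPotential ν z‖ₑ ≤
      K * volume A + (K : ℝ≥0∞)⁻¹ * logSqIntegral (R + R₀) := by
  have hm : Measurable fun p : ℂ × ℂ => ‖Real.log ‖p.2 - p.1‖‖ₑ := by fun_prop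
  calc ∫⁻ z in A, ‖logPotential ν z‖ₑ
      ≤ ∫⁻ z in A, ∫⁻ w, ‖Real.log ‖w - z‖‖ₑ ∂ν :=
        lintegral_mono fun z => enorm_integral_le_lintegral_enorm _
    _ = ∫⁻ w, (∫⁻ z in A, ‖Real.log ‖w - z‖‖ₑ) ∂ν :=
        lintegral_lintegral_swap (f := fun z w => ‖Real.log ‖w - z‖‖ₑ) hm.aemeasurable
    _ ≤ ∫⁻ _, (K * volume A + (K : ℝ≥0∞)⁻¹ * logSqIntegral (R + R₀)) ∂ν :=
        lintegral_mono_ae (hν.mono fun w hw => lintegral_enorm_log_sub_le hA hw hK)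
    _ = _ := by simp

theorem integral_integral_mul_log {ν : Measure ℂ} [IsFiniteMeasure ν] {R₀ : ℝ}
    (hν : ∀ᵐ w ∂ν, ‖w‖ ≤ R₀) {q : ℂ → ℝ} (hq : Continuous q) {C R : ℝ} (hC : ∀ z, |q z| ≤ C)
    (hR : ∀ z, R ≤ ‖z‖ → q z = 0) :
    Integrable (fun w => ∫ z, q z * Real.log ‖w - z‖) ν ∧
    Integrable (fun z => q z * logPotential ν z) ∧
    ∫ w, (∫ z, q z * Real.log ‖w - z‖) ∂ν = ∫ z, q z * logPotential ν z := by
  have h := integrable_mul_log_norm_sub measurable_id hν hq hC hR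
  have h2 := h.swap
  refine ⟨h.integral_prod_left, ?_, ?_⟩
  · refine h2.integral_prod_left.congr (Eventually.of_forall fun z => ?_)
    exact integral_const_mul (q z) fun w => Real.log ‖w - z‖
  · refine (integral_integral_swap (f := fun w z => q z * Real.log ‖w - z‖) h).trans
      (integral_congr_ae (Eventually.of_forall fun z => ?_))
    exact integral_const_mul (q z) fun w => Real.log ‖w - z‖

/-- The average of `log ‖w - z‖` for `w` on a circle. -/
theorem integral_circleUniform_log (c z : ℂ) {r : ℝ} (hr : 0 < r) :
    ∫ w, Real.log ‖w - z‖ ∂(circleUniform c r) = Real.log (max ‖z - c‖ r) := by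
  have h1 := circleAverage_log_norm_sub_const_eq_log_radius_add_posLog (c := c) (a := z) hr.ne'
  have h2 : Real.log r + Real.posLog (r⁻¹ * ‖c - z‖) = Real.log (max ‖z - c‖ r) := by
    rw [norm_sub_rev c z]
    rcases le_total ‖z - c‖ r with h | h
    · rw [max_eq_right h, Real.posLog_eq_zero_iff _ |>.2, add_zero]
      rw [abs_of_nonneg (by positivity), inv_mul_le_iff₀ hr, mul_one]
      exact h
    · have h0 : 0 < ‖z - c‖ := hr.trans_le h
      rw [max_eq_left h, Real.posLog_eq_log, Real.log_mul (by positivity) h0.ne', Real.log_inv]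
      · ring
      · rw [abs_of_nonneg (by positivity), le_inv_mul_iff₀ hr, mul_one]
        exact h
  rw [← h2, ← h1, circleUniform, integral_map (continuous_circleMap c r).aemeasurable
    (by fun_prop : Measurable fun w : ℂ => Real.log ‖w - z‖).aestronglyMeasurable,
    ProbabilityTheory.cond,
    integral_smul_measure, Real.circleAverage_def,
    intervalIntegral.integral_of_le (by positivity), Real.volume_Ioc, sub_zero,
    ENNReal.toReal_inv, ENNReal.toReal_ofReal (by positivity)]

theorem ae_circleUniform_norm_le {r : ℝ} (hr : 0 ≤ r) : ∀ᵐ u ∂(circleUniform 0 r), ‖u‖ ≤ r := by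
  rw [circleUniform, ae_map_iff (continuous_circleMap 0 r).aemeasurable
    (measurableSet_le measurable_norm measurable_const)]
  refine Eventually.of_forall fun θ => ?_
  rw [norm_circleMap_zero, abs_of_nonneg hr]

/-- Circular means of `g`. -/
noncomputable def circularMean (g : ℂ → ℝ) (r : ℝ) (z : ℂ) : ℝ :=
  ∫ u, g (z + u) ∂(circleUniform 0 r)

theorem continuous_circularMean {g : ℂ → ℝ} (hg : Continuous g) {C : ℝ} (hC : ∀ z, |g z| ≤ C)
    (r : ℝ) : Continuous (circularMean g r) := by
  refine continuous_of_dominated (bound := fun _ => C)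
    (fun z => (hg.comp (continuous_const_add z)).aestronglyMeasurable)
    (fun z => Eventually.of_forall fun u => hC _) (integrable_const _)
    (Eventually.of_forall fun u => hg.comp (continuous_add_const u))

theorem abs_circularMean_le {g : ℂ → ℝ} {C : ℝ} (hC : ∀ z, |g z| ≤ C) (r : ℝ) (z : ℂ) : |circularMean g r z| ≤ C := by
  have := norm_integral_le_of_norm_le_const (μ := circleUniform 0 r) (C := C)
    (f := fun u => g (z + u)) (Eventually.of_forall fun u => hC _)
  simpa [circularMean] using this

theorem circularMean_eq_zero {g : ℂ → ℝ} {R : ℝ} (hR : ∀ z, R ≤ ‖z‖ → g z = 0) {r : ℝ}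
    (hr : 0 ≤ r) {z : ℂ} (hz : R + r ≤ ‖z‖) :
    circularMean g r z = 0 := by
  rw [circularMean, integral_congr_ae (g := fun _ => 0), integral_zero]
  filter_upwards [ae_circleUniform_norm_le hr] with u hu
  refine hR _ ?_
  have := norm_sub_norm_le z (-u)
  rw [sub_neg_eq_add, norm_neg] at this
  linarith

theorem integral_circularMean_mul_log {g : ℂ → ℝ} (hg : Continuous g) {C R : ℝ}
    (hC : ∀ z, |g z| ≤ C) (hR : ∀ z, R ≤ ‖z‖ → g z = 0) {r : ℝ} (hr : 0 < r) (w : ℂ) :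
    Integrable (fun z => circularMean g r z * Real.log ‖w - z‖) ∧
    Integrable (fun z => g z * Real.log (max ‖z - w‖ r)) ∧
    ∫ z, circularMean g r z * Real.log ‖w - z‖ = ∫ z, g z * Real.log (max ‖z - w‖ r) := by
  set σ := circleUniform 0 r
  have hF : Integrable (fun p : ℂ × ℂ => g p.2 * Real.log ‖w + p.1 - p.2‖) (σ.prod volume) :=
    integrable_mul_log_norm_sub (a := fun u => w + u) (by fun_prop) (R₀ := ‖w‖ + r)
      ((ae_circleUniform_norm_le hr.le).mono fun u hu =>
        (norm_add_le _ _).trans (by linarith)) hg hC hR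
  have hinner : ∀ z, ∫ u, g z * Real.log ‖w + u - z‖ ∂σ = g z * Real.log (max ‖z - w‖ r) := by
    intro z
    rw [integral_const_mul]
    have := integral_circleUniform_log 0 (z - w) hr
    rw [sub_zero] at this
    rw [← this]
    congr 1
    refine integral_congr_ae (Eventually.of_forall fun u => ?_)
    simp only
    congr 2
    ring
  have hG : Integrable (fun p : ℂ × ℂ => g (p.2 + p.1) * Real.log ‖w - p.2‖) (σ.prod volume) := by
    have h := (measurePreserving_prod_add σ (volume : Measure ℂ)).integrable_comp_of_integrable hF
    refine h.congr (Eventually.of_forall fun p => ?_)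
    simp only [Function.comp]
    rw [add_comm p.1 p.2]
    congr 3
    ring
  have hinner2 : ∀ z, ∫ u, g (z + u) * Real.log ‖w - z‖ ∂σ =
      circularMean g r z * Real.log ‖w - z‖ := fun z => integral_mul_const _ _
  refine ⟨hG.swap.integral_prod_left.congr (Eventually.of_forall hinner2),
    hF.swap.integral_prod_left.congr (Eventually.of_forall hinner), ?_⟩
  calc ∫ z, circularMean g r z * Real.log ‖w - z‖
      = ∫ z, (∫ u, g (z + u) * Real.log ‖w - z‖ ∂σ) := by simp_rw [hinner2]
    _ = ∫ u, (∫ z, g (z + u) * Real.log ‖w - z‖) ∂σ :=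
        (integral_integral_swap (f := fun u z => g (z + u) * Real.log ‖w - z‖) hG).symm
    _ = ∫ u, (∫ z, g z * Real.log ‖w + u - z‖) ∂σ := by
        refine integral_congr_ae (Eventually.of_forall fun u => ?_)
        simp only
        rw [← integral_add_right_eq_self (fun z => g z * Real.log ‖w + u - z‖) u]
        refine integral_congr_ae (Eventually.of_forall fun z => ?_)
        simp only
        congr 3
        ring
    _ = ∫ z, (∫ u, g z * Real.log ‖w + u - z‖ ∂σ) :=
        integral_integral_swap (f := fun u z => g z * Real.log ‖w + u - z‖) hF
    _ = _ := by simp_rw [hinner]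

/-- A continuous bump function: the difference of two truncated logarithms. -/
noncomputable def logBump (s : ℝ) (w : ℂ) : ℝ :=
  Real.log (max ‖w‖ (2 * s)) - Real.log (max ‖w‖ s)

theorem logBump_nonneg {s : ℝ} (hs : 0 < s) (w : ℂ) : 0 ≤ logBump s w :=
  sub_nonneg.2 (Real.log_le_log (lt_max_of_lt_right hs) (max_le_max_left _ (by linarith)))

theorem logBump_eq_zero {s : ℝ} (hs : 0 < s) {w : ℂ} (hw : 2 * s ≤ ‖w‖) : logBump s w = 0 := by
  rw [logBump, max_eq_left hw, max_eq_left (by linarith), sub_self]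

theorem continuous_logBump {s : ℝ} (hs : 0 < s) : Continuous (logBump s) := by
  have h : ∀ t : ℝ, 0 < t → Continuous fun w : ℂ => Real.log (max ‖w‖ t) := fun t ht =>
    (continuous_norm.max continuous_const).log fun w => (lt_max_of_lt_right ht).ne'
  exact (h _ (by linarith)).sub (h _ hs)

theorem hasCompactSupport_logBump {s : ℝ} (hs : 0 < s) : HasCompactSupport (logBump s) :=
  HasCompactSupport.intro (isCompact_closedBall (0 : ℂ) (2 * s)) fun w hw =>
    logBump_eq_zero hs (by
      rw [mem_closedBall_zero_iff, not_le] at hw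
      exact hw.le)

theorem integral_logBump_pos {s : ℝ} (hs : 0 < s) : 0 < ∫ w, logBump s w := by
  refine (continuous_logBump hs).integral_pos_of_hasCompactSupport_nonneg_nonzero
    (hasCompactSupport_logBump hs) (logBump_nonneg hs) (x := 0) ?_
  have : Real.log s < Real.log (2 * s) := Real.log_lt_log hs (by linarith)
  rw [logBump, norm_zero, max_eq_right (by linarith), max_eq_right hs.le]
  linarith

/-- Every continuous function is, on a given disc, close to the logarithmic potential of a continuous
density of compact support. -/
theorem exists_integral_mul_log_near (f : ℂ →ᵇ ℝ) (R₀ : ℝ) {η : ℝ} (hη : 0 < η) :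
    ∃ q : ℂ → ℝ, Continuous q ∧ ∃ C R : ℝ, (∀ z, |q z| ≤ C) ∧ (∀ z, R ≤ ‖z‖ → q z = 0) ∧
      ∀ w, ‖w‖ ≤ R₀ → |(∫ z, q z * Real.log ‖w - z‖) - f w| ≤ η := by
  set g : ℂ → ℝ := fun z => f z * max 0 (min 1 (R₀ + 1 - ‖z‖)) with hgdef
  have hg : Continuous g := by
    have := f.continuous
    fun_prop
  have hχ : ∀ z : ℂ, |max 0 (min 1 (R₀ + 1 - ‖z‖))| ≤ 1 := fun z => by
    rw [abs_of_nonneg (le_max_left _ _)]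
    exact max_le zero_le_one (min_le_left _ _)
  have hC : ∀ z, |g z| ≤ ‖f‖ := fun z => by
    rw [hgdef, abs_mul]
    have h1 : |f z| ≤ ‖f‖ := f.norm_coe_le_norm z
    calc _ ≤ ‖f‖ * 1 := mul_le_mul h1 (hχ z) (abs_nonneg _) (norm_nonneg _)
      _ = _ := mul_one _
  have hR : ∀ z, R₀ + 1 ≤ ‖z‖ → g z = 0 := fun z hz => by
    simp only [hgdef]
    rw [min_eq_right (by linarith), max_eq_left (by linarith), mul_zero]
  have hgf : ∀ w, ‖w‖ ≤ R₀ → g w = f w := fun w hw => by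
    simp only [hgdef]
    rw [min_eq_left (by linarith), max_eq_right zero_le_one, mul_one]
  have hcs : HasCompactSupport g :=
    HasCompactSupport.intro (isCompact_closedBall (0 : ℂ) (R₀ + 1)) fun w hw =>
      hR w (by
        rw [mem_closedBall_zero_iff, not_le] at hw
        exact hw.le)
  obtain ⟨t, ht, hunif⟩ := Metric.uniformContinuous_iff.1
    (hcs.uniformContinuous_of_continuous hg) η hη
  set s := t / 2 with hs
  have hs0 : 0 < s := by positivity
  set κ := ∫ w, logBump s w with hκ
  have hκ0 : 0 < κ := integral_logBump_pos hs0
  refine ⟨fun z => κ⁻¹ * (circularMean g (2 * s) z - circularMean g s z),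
    continuous_const.mul ((continuous_circularMean hg hC _).sub (continuous_circularMean hg hC _)),
    κ⁻¹ * (‖f‖ + ‖f‖), R₀ + 1 + 2 * s, fun z => ?_, fun z hz => ?_, fun w hw => ?_⟩
  · rw [abs_mul, abs_of_pos (inv_pos.2 hκ0)]
    exact mul_le_mul_of_nonneg_left ((abs_sub _ _).trans
      (add_le_add (abs_circularMean_le hC _ _) (abs_circularMean_le hC _ _)))
      (inv_pos.2 hκ0).le
  · simp only
    rw [circularMean_eq_zero hR (by positivity) hz,
      circularMean_eq_zero hR hs0.le (by linarith), sub_zero, mul_zero]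
  · obtain ⟨i1, j1, e1⟩ := integral_circularMean_mul_log hg hC hR (r := 2 * s) (by positivity) w
    obtain ⟨i2, j2, e2⟩ := integral_circularMean_mul_log hg hC hR hs0 w
    have e3 : ∫ z, κ⁻¹ * (circularMean g (2 * s) z - circularMean g s z) * Real.log ‖w - z‖ =
        κ⁻¹ * ∫ z, g z * logBump s (z - w) := by
      simp_rw [mul_assoc, integral_const_mul, sub_mul, logBump, mul_sub]
      rw [integral_sub i1 i2, integral_sub j1 j2, e1, e2, mul_sub]
    have hint : Integrable fun z => logBump s (z - w) :=
      ((continuous_logBump hs0).integrable_of_hasCompactSupport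
        (hasCompactSupport_logBump hs0)).comp_sub_right w
    have hκw : ∫ z, logBump s (z - w) = κ := integral_sub_right_eq_self _ w
    have e4 : g w = κ⁻¹ * ∫ z, g w * logBump s (z - w) := by
      rw [integral_const_mul, hκw]
      field_simp
    have j3 : Integrable fun z => g z * logBump s (z - w) := by
      simp_rw [logBump, mul_sub]
      exact j1.sub j2
    rw [e3, ← hgf w hw, e4, ← mul_sub, ← integral_sub j3 (hint.const_mul _), abs_mul,
      abs_of_pos (inv_pos.2 hκ0), inv_mul_le_iff₀ hκ0]
    calc |∫ z, (g z * logBump s (z - w) - g w * logBump s (z - w))|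
        ≤ ∫ z, η * logBump s (z - w) := by
          rw [← Real.norm_eq_abs]
          refine norm_integral_le_of_norm_le (hint.const_mul η) (Eventually.of_forall fun z => ?_)
          rw [← sub_mul, norm_mul, Real.norm_eq_abs (logBump _ _),
            abs_of_nonneg (logBump_nonneg hs0 _)]
          by_cases hz : dist z w < t
          · exact mul_le_mul_of_nonneg_right (hunif hz).le (logBump_nonneg hs0 _)
          · rw [logBump_eq_zero hs0, mul_zero, mul_zero]
            rw [not_lt, dist_eq_norm] at hz
            simp only [hs]; linarith
      _ = κ * η := by rw [integral_const_mul, hκw, mul_comm]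

/-- The integrals of `f` with respect to two measures are close if their logarithmic potentials are
close. -/
theorem exists_integral_sub_le_logPotential (f : ℂ →ᵇ ℝ) (R₀ : ℝ) {η : ℝ} (hη : 0 < η) :
    ∃ C R : ℝ, ∀ ν₁ ν₂ : Measure ℂ, IsProbabilityMeasure ν₁ → IsProbabilityMeasure ν₂ →
      (∀ᵐ w ∂ν₁, ‖w‖ ≤ R₀) → (∀ᵐ w ∂ν₂, ‖w‖ ≤ R₀) →
      ENNReal.ofReal |(∫ w, f w ∂ν₁) - ∫ w, f w ∂ν₂| ≤ ENNReal.ofReal (2 * η) +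
        ENNReal.ofReal C * ∫⁻ z in ball (0 : ℂ) R, ‖logPotential ν₁ z - logPotential ν₂ z‖ₑ := by
  obtain ⟨q, hq, C, R, hC, hR, hf⟩ := exists_integral_mul_log_near f R₀ hη
  refine ⟨C, R, fun ν₁ ν₂ _ _ h1 h2 => ?_⟩
  have key : ∀ ν : Measure ℂ, IsProbabilityMeasure ν → (∀ᵐ w ∂ν, ‖w‖ ≤ R₀) →
      |(∫ z, q z * logPotential ν z) - ∫ w, f w ∂ν| ≤ η := by
    intro ν _ hν
    obtain ⟨i1, i2, i3⟩ := integral_integral_mul_log hν hq hC hR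
    rw [← i3, ← integral_sub i1 (f.integrable ν)]
    have := norm_integral_le_of_norm_le_const (μ := ν) (C := η)
      (f := fun w => (∫ z, q z * Real.log ‖w - z‖) - f w) (hν.mono fun w hw => hf w hw)
    simpa using this
  have k1 := key ν₁ inferInstance h1
  have k2 := key ν₂ inferInstance h2
  obtain ⟨-, i1, -⟩ := integral_integral_mul_log h1 hq hC hR
  obtain ⟨-, i2, -⟩ := integral_integral_mul_log h2 hq hC hR
  have k3 : |(∫ w, f w ∂ν₁) - ∫ w, f w ∂ν₂| ≤ 2 * η +
      |∫ z, q z * (logPotential ν₁ z - logPotential ν₂ z)| := by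
    have e : ∫ z, q z * (logPotential ν₁ z - logPotential ν₂ z) =
        (∫ z, q z * logPotential ν₁ z) - ∫ z, q z * logPotential ν₂ z := by
      rw [← integral_sub i1 i2]
      simp_rw [mul_sub]
    rw [e]
    rw [abs_le] at k1 k2 ⊢
    have := le_abs_self ((∫ z, q z * logPotential ν₁ z) - ∫ z, q z * logPotential ν₂ z)
    have := neg_abs_le ((∫ z, q z * logPotential ν₁ z) - ∫ z, q z * logPotential ν₂ z)
    constructor <;> linarith
  refine (ENNReal.ofReal_le_ofReal k3).trans ?_
  rw [ENNReal.ofReal_add (by positivity) (abs_nonneg _)]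
  gcongr
  rw [← Real.norm_eq_abs, ofReal_norm]
  refine (enorm_integral_le_lintegral_enorm _).trans ?_
  have hm : Measurable fun z => ‖logPotential ν₁ z - logPotential ν₂ z‖ₑ :=
    ((measurable_logPotential ν₁).sub (measurable_logPotential ν₂)).enorm
  rw [← lintegral_const_mul _ hm, ← lintegral_indicator measurableSet_ball]
  refine lintegral_mono fun z => ?_
  by_cases hz : z ∈ ball (0 : ℂ) R
  · rw [Set.indicator_of_mem hz, enorm_mul]
    gcongr
    rw [← ofReal_norm]
    exact ENNReal.ofReal_le_ofReal (hC z)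
  · rw [mem_ball_zero_iff, not_lt] at hz
    simp [hR z hz]

end LogPotential

section SpectralMeasure

theorem integral_sum_map_dirac (s : Multiset ℂ) (f : ℂ → ℝ) :
    Integrable f (s.map Measure.dirac).sum ∧
      ∫ w, f w ∂(s.map Measure.dirac).sum = (s.map f).sum := by
  induction s using Multiset.induction with
  | empty => simp
  | cons a s ih =>
    have h : Integrable f (Measure.dirac a) := integrable_dirac enorm_lt_top
    simp only [Multiset.map_cons, Multiset.sum_cons]
    exact ⟨h.add_measure ih.1, by rw [integral_add_measure h ih.1, integral_dirac, ih.2]⟩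

theorem sum_map_dirac_univ (s : Multiset ℂ) : (s.map Measure.dirac).sum Set.univ = s.card := by
  induction s using Multiset.induction with
  | empty => simp
  | cons a s ih =>
    simp only [Multiset.map_cons, Multiset.sum_cons, Measure.add_apply, ih, measure_univ,
      Multiset.card_cons, Nat.cast_add, Nat.cast_one, add_comm]

theorem ae_sum_map_dirac {s : Multiset ℂ} {p : ℂ → Prop} (h : ∀ w ∈ s, p w) :
    ∀ᵐ w ∂(s.map Measure.dirac).sum, p w := by
  induction s using Multiset.induction with
  | empty => simp
  | cons a s ih =>
    simp only [Multiset.map_cons, Multiset.sum_cons, ae_add_measure_iff, ae_dirac_eq,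
      eventually_pure]
    exact ⟨h a (Multiset.mem_cons_self a s), ih fun w hw => h w (Multiset.mem_cons_of_mem hw)⟩

theorem isProbabilityMeasure_empiricalSpectralMeasure {N : ℕ} (hN : 0 < N)
    (A : Matrix (Fin N) (Fin N) ℂ) : IsProbabilityMeasure (empiricalSpectralMeasure A) := by
  refine ⟨?_⟩
  rw [empiricalSpectralMeasure, Measure.smul_apply, sum_map_dirac_univ, A.card_roots_charpoly,
    Fintype.card_fin, smul_eq_mul, ENNReal.inv_mul_cancel (by simpa using hN.ne') (by simp)]

theorem ae_empiricalSpectralMeasure {N : ℕ} {A : Matrix (Fin N) (Fin N) ℂ} {p : ℂ → Prop}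
    (h : ∀ w ∈ A.charpoly.roots, p w) : ∀ᵐ w ∂(empiricalSpectralMeasure A), p w :=
  Measure.ae_smul_measure (ae_sum_map_dirac h) _

/-- The potential of the spectral measure is given by the characteristic polynomial. -/
theorem logPotential_empiricalSpectralMeasure {N : ℕ} {A : Matrix (Fin N) (Fin N) ℂ} {z : ℂ}
    (hz : (Matrix.scalar (Fin N) z - A).det ≠ 0) :
    logPotential (empiricalSpectralMeasure A) z =
      (N : ℝ)⁻¹ * Real.log ‖(Matrix.scalar (Fin N) z - A).det‖ := by
  rw [logPotential, empiricalSpectralMeasure, integral_smul_measure,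
    (integral_sum_map_dirac _ _).2, A.eval_charpoly_eq_prod, ENNReal.toReal_inv,
    ENNReal.toReal_natCast, smul_eq_mul]
  rw [A.eval_charpoly_eq_prod] at hz
  congr 1
  generalize A.charpoly.roots = s at hz
  induction s using Multiset.induction with
  | empty => simp
  | cons a s ih =>
    simp only [Multiset.map_cons, Multiset.sum_cons, Multiset.prod_cons] at hz ⊢
    rw [norm_mul, Real.log_mul (norm_ne_zero_iff.2 (left_ne_zero_of_mul hz))
      (norm_ne_zero_iff.2 (right_ne_zero_of_mul hz)), ih (right_ne_zero_of_mul hz), norm_sub_rev]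

namespace JordanData

variable {N : ℕ} (J : JordanData N)

theorem dim_div_toReal (i : Fin J.numBlocks) :
    ((J.dim i : ℝ≥0∞) / (N : ℝ≥0∞)).toReal = (J.dim i : ℝ) / N := by
  rw [ENNReal.toReal_div, ENNReal.toReal_natCast, ENNReal.toReal_natCast]

theorem isProbabilityMeasure_mixture (hN : 0 < N) (γ : ℝ) :
    IsProbabilityMeasure (J.mixture γ) := by
  refine ⟨?_⟩
  simp only [mixture, Measure.finsetSum_apply, Measure.smul_apply, measure_univ, smul_eq_mul,
    mul_one, div_eq_mul_inv]
  rw [← Finset.sum_mul, ← Nat.cast_sum, J.sum_dim,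
    ENNReal.mul_inv_cancel (by simpa using hN.ne') (by simp)]

theorem integrable_log_circleUniform (c z : ℂ) (r : ℝ) :
    Integrable (fun w => Real.log ‖w - z‖) (circleUniform c r) := by
  have h := circleIntegrable_log_norm_sub_const (c := c) (a := z) r
  rw [CircleIntegrable, intervalIntegrable_iff_integrableOn_Ioc_of_le (by positivity)] at h
  rw [circleUniform, integrable_map_measure
    (by fun_prop : Measurable fun w : ℂ => Real.log ‖w - z‖).aestronglyMeasurable
    (continuous_circleMap c r).aemeasurable]
  exact h.smul_measure (by simp [Real.pi_pos])

theorem logPotential_mixture (hN : 0 < N) (γ : ℝ) (z : ℂ) :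
    logPotential (J.mixture γ) z = (N : ℝ)⁻¹ * J.logPot γ z := by
  have hN' : (N : ℝ≥0∞) ≠ 0 := by simpa using hN.ne'
  rw [logPotential, mixture, integral_finsetSum_measure, logPot, Finset.mul_sum]
  · refine Finset.sum_congr rfl fun i _ => ?_
    rw [integral_smul_measure, integral_circleUniform_log _ _ (J.radius_pos γ i), J.dim_div_toReal,
      smul_eq_mul]
    ring
  · exact fun i _ => (integrable_log_circleUniform _ _ _).smul_measure
      (ENNReal.div_ne_top (by simp) hN')

theorem radius_le_one {γ : ℝ} (hγ : 1 < γ) (i : Fin J.numBlocks) : J.radius γ i ≤ 1 := by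
  rw [radius, Real.exp_le_one_iff]
  refine div_nonpos_of_nonpos_of_nonneg (by linarith) ?_
  exact div_nonneg (Nat.cast_nonneg _) (Real.log_natCast_nonneg N)

theorem norm_eig_le {γ : ℝ} (hγ : 1 < γ) {K : Set ℂ} (hK : J.mixture γ Kᶜ = 0) {R : ℝ}
    (hR : ∀ w ∈ K, ‖w‖ ≤ R) (i : Fin J.numBlocks) : ‖J.eig i‖ ≤ R + 1 := by
  have h1 : circleUniform (J.eig i) (J.radius γ i) Kᶜ = 0 := by
    rw [mixture, Measure.finsetSum_apply, Finset.sum_eq_zero_iff] at hK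
    have := hK i (Finset.mem_univ i)
    rw [Measure.smul_apply, smul_eq_mul, mul_eq_zero] at this
    refine this.resolve_left (ENNReal.div_ne_zero.2 ⟨?_, by simp⟩)
    exact_mod_cast (J.dim_pos i).ne'
  have h2 : ∀ᵐ θ ∂(volume[|Set.Ioc (0 : ℝ) (2 * Real.pi)]),
      circleMap (J.eig i) (J.radius γ i) θ ∈ K :=
    ae_of_ae_map (continuous_circleMap _ _).aemeasurable h1
  have h3 : IsProbabilityMeasure (volume[|Set.Ioc (0 : ℝ) (2 * Real.pi)]) := by
    apply cond_isProbabilityMeasure_of_finite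
    · simp [Real.pi_pos]
    · exact measure_Ioc_lt_top.ne
  obtain ⟨θ, hθ⟩ := h2.exists
  have h4 : ‖circleMap (J.eig i) (J.radius γ i) θ - J.eig i‖ ≤ 1 := by
    rw [circleMap_sub_center, norm_circleMap_zero, abs_of_pos (J.radius_pos γ i)]
    exact J.radius_le_one hγ i
  calc ‖J.eig i‖ ≤ ‖circleMap (J.eig i) (J.radius γ i) θ‖ +
        ‖circleMap (J.eig i) (J.radius γ i) θ - J.eig i‖ := by
        have := norm_sub_norm_le (J.eig i) (circleMap (J.eig i) (J.radius γ i) θ)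
        rw [norm_sub_rev] at this
        linarith
    _ ≤ R + 1 := add_le_add (hR _ hθ) h4

/-- The identification of the rows of a family of Jordan blocks with the rows of the matrix. -/
def rowEquiv : J.Idx ≃ Fin N := finSigmaFinEquiv.trans (finCongr J.sum_dim)

/-- A matrix seen as a function on the index type of the family of Jordan blocks. -/
def pullback (G : Matrix (Fin N) (Fin N) ℝ) : J.Idx → J.Idx → ℝ :=
  fun p q => G (J.rowEquiv p) (J.rowEquiv q)

theorem det_scalar_sub_perturb (γ : ℝ) (G : Matrix (Fin N) (Fin N) ℝ) (z : ℂ) :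
    (Matrix.scalar (Fin N) z - perturb γ J.toMatrix G).det =
      (J.shifted z + ((-(N : ℝ) ^ (-γ) : ℝ) : ℂ) • complexify (J.pullback G)).det := by
  rw [← Matrix.det_reindex_self J.rowEquiv.symm]
  congr 1
  ext p q
  have h1 : (Matrix.scalar (Fin N) z) (J.rowEquiv p) (J.rowEquiv q) =
      Matrix.scalar J.Idx z p q := by
    simp [Matrix.scalar_apply, Matrix.diagonal_apply]
  have h2 : J.shifted z = Matrix.scalar J.Idx z -
      Matrix.blockDiagonal' fun i => jordanBlock (J.dim i) (J.eig i) := by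
    simp only [shifted, ← scalar_sub_jordanBlock, Matrix.scalar_apply]
    have h : (Matrix.diagonal fun _ : J.Idx => z) =
        Matrix.blockDiagonal' fun i => Matrix.diagonal fun _ : Fin (J.dim i) => z :=
      (Matrix.blockDiagonal'_diagonal fun _ _ => z).symm
    rw [h, ← Matrix.blockDiagonal'_sub]
    rfl
  have h3 : J.toMatrix (J.rowEquiv p) (J.rowEquiv q) =
      Matrix.blockDiagonal' (fun i => jordanBlock (J.dim i) (J.eig i)) p q := by
    simp only [toMatrix, Matrix.reindex_apply, Matrix.submatrix_apply]
    change Matrix.blockDiagonal' _ (J.rowEquiv.symm (J.rowEquiv p))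
      (J.rowEquiv.symm (J.rowEquiv q)) = _
    rw [Equiv.symm_apply_apply, Equiv.symm_apply_apply]
  simp only [Matrix.reindex_apply, Equiv.symm_symm, Matrix.submatrix_apply, Matrix.sub_apply,
    perturb, Matrix.add_apply, Matrix.smul_apply, Matrix.map_apply, h1, h2, h3, complexify,
    Matrix.of_apply, pullback, smul_eq_mul]
  push_cast
  ring

end JordanData

theorem IsStdGaussianMatrix.map_pullback {Ω : Type*} [MeasurableSpace Ω] {N : ℕ}
    {G : Ω → Matrix (Fin N) (Fin N) ℝ} {P : Measure Ω} (hG : IsStdGaussianMatrix G P)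
    (J : JordanData N) :
    HasLaw (fun ω => J.pullback (G ω)) (stdGaussianMatrix J.Idx) P := by
  have h1 : iIndepFun (fun (p : J.Idx × J.Idx) ω => G ω (J.rowEquiv p.1) (J.rowEquiv p.2)) P :=
    hG.indep.precomp (g := fun p : J.Idx × J.Idx => (J.rowEquiv p.1, J.rowEquiv p.2))
      (J.rowEquiv.injective.prodMap J.rowEquiv.injective)
  have h2 := h1.hasLaw_pi fun p => hG.hasLaw _ _
  have h3 : (Measure.pi fun _ : J.Idx × J.Idx => gaussianReal 0 1).map
      (MeasurableEquiv.curry J.Idx J.Idx ℝ) = stdGaussianMatrix J.Idx := by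
    rw [← Measure.infinitePi_eq_pi, Measure.infinitePi_map_curry (fun _ _ => gaussianReal 0 1)]
    simp only [stdGaussianMatrix, stdGaussianRow, Measure.infinitePi_eq_pi]
  have h4 : (fun ω => J.pullback (G ω)) = MeasurableEquiv.curry J.Idx J.Idx ℝ ∘
      fun ω (p : J.Idx × J.Idx) => G ω (J.rowEquiv p.1) (J.rowEquiv p.2) := rfl
  refine ⟨?_, ?_⟩
  · rw [h4]
    exact (MeasurableEquiv.measurable _).comp_aemeasurable h2.aemeasurable
  · rw [h4, ← AEMeasurable.map_map_of_aemeasurable (MeasurableEquiv.measurable _).aemeasurable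
      h2.aemeasurable, h2.map_eq, h3]

end SpectralMeasure

section Convergence

open Metric
open scoped Matrix.Norms.L2Operator

theorem volume_annulus_le (c : ℂ) {h : ℝ} (h0 : 0 < h) (h1 : h ≤ 1) :
    volume {z : ℂ | |‖z - c‖ - 1| < h} ≤ ENNReal.ofReal (4 * Real.pi * h) := by
  have hsub : {z : ℂ | |‖z - c‖ - 1| < h} ⊆ ball c (1 + h) \ closedBall c (1 - h) := by
    intro z hz
    rw [Set.mem_ofPred_eq, abs_lt] at hz
    rw [Set.mem_sdiff, mem_ball, mem_closedBall, dist_eq_norm]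
    constructor <;> linarith
  have hpi : ∀ r : ℝ, 0 ≤ r →
      ENNReal.ofReal r ^ 2 * NNReal.pi = ENNReal.ofReal (r ^ 2 * Real.pi) := by
    intro r hr
    rw [ENNReal.ofReal_mul (by positivity), ENNReal.ofReal_pow hr, ← NNReal.coe_real_pi,
      ENNReal.ofReal_coe_nnreal]
  refine (measure_mono hsub).trans ?_
  rw [measure_sdiff (closedBall_subset_ball' (by rw [dist_self]; linarith))
    measurableSet_closedBall.nullMeasurableSet measure_closedBall_lt_top.ne]
  · rw [Complex.volume_ball, Complex.volume_closedBall, hpi _ (by linarith), hpi _ (by linarith),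
      ← ENNReal.ofReal_sub _ (by positivity)]
    exact ENNReal.ofReal_le_ofReal (le_of_eq (by ring))

namespace JordanData

variable {N : ℕ} (J : JordanData N)

theorem volume_not_awayFromCircles_le (hN : 0 < N) {δ : ℝ} (hδ : 0 < δ) :
    volume {z | ¬ J.AwayFromCircles δ z} ≤
      ENNReal.ofReal (4 * Real.pi * Real.exp (-δ * Real.log N)) := by
  classical
  set L := Real.log N with hL
  have hL0 : 0 ≤ L := Real.log_natCast_nonneg N
  set h := Real.exp (-(1 / 2 + δ) * L) with hh
  have hh1 : h ≤ 1 := by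
    rw [hh, Real.exp_le_one_iff]
    have : 0 ≤ (1 / 2 + δ) * L := by positivity
    linarith
  set F := Finset.univ.filter fun i => Real.exp (1 / 2 * L) ≤ J.dim i with hF
  have hcard : (F.card : ℝ) ≤ Real.exp (1 / 2 * L) := by
    have h1 : F.card * Real.exp (1 / 2 * L) ≤ N := by
      rw [← J.sum_dim_real, ← nsmul_eq_mul, ← Finset.sum_const]
      refine (Finset.sum_le_sum fun i hi => (Finset.mem_filter.1 hi).2).trans ?_
      exact Finset.sum_le_sum_of_subset_of_nonneg (Finset.subset_univ _)
        fun _ _ _ => Nat.cast_nonneg _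
    have h2 : (N : ℝ) = Real.exp (1 / 2 * L) * Real.exp (1 / 2 * L) := by
      rw [← Real.exp_add, ← Real.exp_log (show (0 : ℝ) < N by exact_mod_cast hN)]
      congr 1
      rw [← hL]; ring
    rw [h2] at h1
    exact le_of_mul_le_mul_right h1 (Real.exp_pos _)
  have hsub : {z | ¬ J.AwayFromCircles δ z} ⊆ ⋃ i ∈ F, {z : ℂ | |‖z - J.eig i‖ - 1| < h} := by
    intro z hz
    rw [Set.mem_ofPred_eq, AwayFromCircles] at hz
    push Not at hz
    obtain ⟨i, h1, h2⟩ := hz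
    exact Set.mem_iUnion₂.2 ⟨i, Finset.mem_filter.2 ⟨Finset.mem_univ i, h1⟩, h2⟩
  calc volume {z | ¬ J.AwayFromCircles δ z}
      ≤ ∑ i ∈ F, volume {z : ℂ | |‖z - J.eig i‖ - 1| < h} :=
        (measure_mono hsub).trans (measure_biUnion_finset_le _ _)
    _ ≤ ∑ i ∈ F, ENNReal.ofReal (4 * Real.pi * h) :=
        Finset.sum_le_sum fun i _ => volume_annulus_le _ (Real.exp_pos _) hh1
    _ = ENNReal.ofReal (F.card * (4 * Real.pi * h)) := by
        rw [Finset.sum_const, nsmul_eq_mul, ENNReal.ofReal_mul (Nat.cast_nonneg _),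
          ENNReal.ofReal_natCast]
    _ ≤ _ := by
        refine ENNReal.ofReal_le_ofReal ?_
        calc F.card * (4 * Real.pi * h) ≤ Real.exp (1 / 2 * L) * (4 * Real.pi * h) := by
              gcongr
          _ = 4 * Real.pi * (Real.exp (1 / 2 * L) * h) := by ring
          _ = _ := by
              rw [hh, ← Real.exp_add]
              congr 2
              ring

/-- The points in the disc of radius `R` at which the determinant is much smaller than predicted. -/
def badSet (γ δ ε R : ℝ) (X : J.Idx → J.Idx → ℝ) : Set ℂ :=
  {z | z ∈ ball (0 : ℂ) R ∧ (∀ i, z ≠ J.eig i) ∧ J.AwayFromCircles δ z ∧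
    ‖(J.shifted z + ((-(N : ℝ) ^ (-γ) : ℝ) : ℂ) • complexify X).det‖ <
      Real.exp (J.logPot γ z - ε * (N + J.logPlus z))}

theorem continuous_shifted : Continuous J.shifted := by
  refine Continuous.matrix_blockDiagonal' (continuous_pi fun i => ?_)
  refine continuous_matrix fun p q => ?_
  simp only [bidiag, Matrix.of_apply]
  split_ifs <;> fun_prop

theorem measurable_logPot (γ : ℝ) : Measurable (J.logPot γ) := by
  unfold logPot
  fun_prop

theorem measurable_logPlus : Measurable J.logPlus := by
  unfold logPlus
  fun_prop

theorem measurableSet_awayFromCircles (δ : ℝ) : MeasurableSet {z | J.AwayFromCircles δ z} := by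
  simp only [AwayFromCircles, Set.ofPred_forall]
  refine MeasurableSet.iInter fun i => MeasurableSet.iInter fun _ => ?_
  exact measurableSet_le measurable_const (by fun_prop)

theorem measurableSet_badSet (γ δ ε R : ℝ) :
    MeasurableSet {p : (J.Idx → J.Idx → ℝ) × ℂ |
      ‖complexify p.1‖ ≤ 120 * √N ∧ p.2 ∈ J.badSet γ δ ε R p.1} := by
  have h1 : Measurable fun X : J.Idx → J.Idx → ℝ => ‖complexify X‖ :=
    (continuous_norm.comp continuous_complexify).measurable
  have h2 : Measurable fun p : (J.Idx → J.Idx → ℝ) × ℂ =>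
      ‖(J.shifted p.2 + ((-(N : ℝ) ^ (-γ) : ℝ) : ℂ) • complexify p.1).det‖ := by
    refine (continuous_norm.comp (Continuous.matrix_det ?_)).measurable
    exact (J.continuous_shifted.comp continuous_snd).add
      ((continuous_complexify.comp continuous_fst).const_smul ((-(N : ℝ) ^ (-γ) : ℝ) : ℂ))
  have h3 := J.measurable_logPot γ
  have h4 := J.measurable_logPlus
  simp only [badSet, Set.mem_ofPred_eq]
  refine (measurableSet_le (h1.comp measurable_fst) measurable_const).inter
    ((measurable_snd measurableSet_ball).inter (.inter ?_
      ((measurable_snd (J.measurableSet_awayFromCircles δ)).inter (measurableSet_lt h2 ?_))))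
  · refine measurable_snd (t := {z | ∀ i, z ≠ J.eig i}) ?_
    simp only [Set.ofPred_forall]
    exact MeasurableSet.iInter fun i => (measurableSet_singleton _).compl
  · fun_prop

/-- The area of the bad set is rarely large. -/
theorem stdGaussianMatrix_volume_badSet_ge {γ δ ε R : ℝ} {b : ℝ≥0∞}
    (hb : ∀ z, (∀ i, z ≠ J.eig i) → J.AwayFromCircles δ z →
      stdGaussianMatrix J.Idx {X | ‖complexify X‖ ≤ 120 * √N ∧
          ‖(J.shifted z + ((-(N : ℝ) ^ (-γ) : ℝ) : ℂ) • complexify X).det‖ <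
            Real.exp (J.logPot γ z - ε * (N + J.logPlus z))} ≤ b)
    {t : ℝ≥0∞} (ht : t ≠ 0) (ht' : t ≠ ⊤) :
    stdGaussianMatrix J.Idx {X | ‖complexify X‖ ≤ 120 * √N ∧
      t ≤ volume (J.badSet γ δ ε R X)} ≤ volume (ball (0 : ℂ) R) * b / t := by
  set S := {p : (J.Idx → J.Idx → ℝ) × ℂ |
      ‖complexify p.1‖ ≤ 120 * √N ∧ p.2 ∈ J.badSet γ δ ε R p.1} with hS
  have hSm : MeasurableSet S := J.measurableSet_badSet γ δ ε R
  set Q := stdGaussianMatrix J.Idx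
  have hQ : IsProbabilityMeasure Q := by unfold Q stdGaussianMatrix; infer_instance
  have h1 : {X | ‖complexify X‖ ≤ 120 * √N ∧ t ≤ volume (J.badSet γ δ ε R X)} ⊆
      {X | t ≤ volume (Prod.mk X ⁻¹' S)} := by
    rintro X ⟨h1, h2⟩
    refine h2.trans (measure_mono fun z hz => ?_)
    exact ⟨h1, hz⟩
  refine (measure_mono h1).trans ((meas_ge_le_lintegral_div
    (measurable_measure_prodMk_left hSm).aemeasurable ht ht').trans ?_)
  gcongr
  rw [← Measure.prod_apply hSm, Measure.prod_apply_symm hSm]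
  calc ∫⁻ z, Q ((fun X => (X, z)) ⁻¹' S)
      ≤ ∫⁻ z, (ball (0 : ℂ) R).indicator (fun _ => b) z := by
        refine lintegral_mono fun z => ?_
        by_cases hz : z ∈ ball (0 : ℂ) R ∧ (∀ i, z ≠ J.eig i) ∧ J.AwayFromCircles δ z
        · rw [Set.indicator_of_mem hz.1]
          refine (measure_mono fun X hX => ?_).trans (hb z hz.2.1 hz.2.2)
          exact ⟨hX.1, hX.2.2.2.2⟩
        · have : (fun X => (X, z)) ⁻¹' S = ∅ :=
            Set.eq_empty_of_forall_notMem fun X hX => hz ⟨hX.2.1, hX.2.2.1, hX.2.2.2.1⟩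
          rw [this, measure_empty]
          exact bot_le
    _ = volume (ball (0 : ℂ) R) * b := by
        rw [lintegral_indicator measurableSet_ball, setLIntegral_const, mul_comm]

theorem lintegral_logPlus_le (hN : 0 < N) {R R₀ : ℝ} (hR₀ : ∀ i, ‖J.eig i‖ ≤ R₀) :
    ∫⁻ z in ball (0 : ℂ) R, ENNReal.ofReal ((N : ℝ)⁻¹ * J.logPlus z) ≤
      volume (ball (0 : ℂ) R) + logSqIntegral (R + R₀) := by
  have hN' : (0 : ℝ) < N := by exact_mod_cast hN
  calc ∫⁻ z in ball (0 : ℂ) R, ENNReal.ofReal ((N : ℝ)⁻¹ * J.logPlus z)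
      ≤ ∫⁻ z in ball (0 : ℂ) R, ∑ i, ENNReal.ofReal ((N : ℝ)⁻¹ * J.dim i) *
          ‖Real.log ‖J.eig i - z‖‖ₑ := by
        refine lintegral_mono fun z => ?_
        rw [logPlus, Finset.mul_sum, ENNReal.ofReal_sum_of_nonneg fun i _ => by positivity]
        refine Finset.sum_le_sum fun i _ => ?_
        rw [← mul_assoc, ENNReal.ofReal_mul (by positivity), ← ofReal_norm (Real.log _),
          norm_sub_rev, Real.norm_eq_abs]
        gcongr
        exact max_le (abs_nonneg _) (neg_le_abs _)
    _ = ∑ i, ENNReal.ofReal ((N : ℝ)⁻¹ * J.dim i) *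
          ∫⁻ z in ball (0 : ℂ) R, ‖Real.log ‖J.eig i - z‖‖ₑ := by
        rw [lintegral_finsetSum _ fun i _ => by fun_prop]
        refine Finset.sum_congr rfl fun i _ => ?_
        rw [lintegral_const_mul _ (by fun_prop)]
    _ ≤ ∑ i, ENNReal.ofReal ((N : ℝ)⁻¹ * J.dim i) *
          (volume (ball (0 : ℂ) R) + logSqIntegral (R + R₀)) := by
        gcongr with i
        simpa using lintegral_enorm_log_sub_le (le_refl (ball (0 : ℂ) R)) (hR₀ i) one_ne_zero
    _ = _ := by
        rw [← Finset.sum_mul, ← ENNReal.ofReal_sum_of_nonneg fun i _ => by positivity,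
          ← Finset.mul_sum, J.sum_dim_real, inv_mul_cancel₀ hN'.ne', ENNReal.ofReal_one, one_mul]

/-- Away from the disc of radius `R₀ + 4` there are no eigenvalues. -/
theorem det_shifted_add_ne_zero {R₀ e : ℝ} (hR₀ : ∀ i, ‖J.eig i‖ ≤ R₀) {z : ℂ}
    (hz : R₀ + 4 < ‖z‖) {E : Matrix J.Idx J.Idx ℂ} (hE : ‖E‖ ≤ e) (he : e < 1) :
    (J.shifted z + E).det ≠ 0 := by
  have hw : ∀ i, 4 < ‖z - J.eig i‖ := fun i => by
    have := norm_sub_norm_le z (J.eig i)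
    have := hR₀ i
    linarith
  have hB : ∀ i, ∀ v : Fin (J.dim i) → ℂ,
      ‖WithLp.toLp 2 v‖ ≤ 1 * ‖WithLp.toLp 2 ((bidiag (J.dim i) (z - J.eig i)).mulVec v)‖ := by
    intro i v
    refine (norm_le_bidiag_mulVec_of_one_lt (x := z - J.eig i) (by linarith [hw i]) v).trans ?_
    have : (‖z - J.eig i‖ - 1)⁻¹ ≤ 1 := inv_le_one_of_one_le₀ (by linarith [hw i])
    gcongr
  have h := Matrix.le_norm_det_add zero_le_one (norm_le_blockDiagonal'_mulVec zero_le_one hB) hE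
    (by linarith)
  have h2 : (Matrix.blockDiagonal' fun i => bidiag (J.dim i) (z - J.eig i)).det ≠ 0 := by
    rw [Matrix.det_blockDiagonal'_eq_prod]
    refine Finset.prod_ne_zero_iff.2 fun i _ => ?_
    rw [det_bidiag]
    exact pow_ne_zero _ (norm_pos_iff.1 (by linarith [hw i]))
  rw [← norm_pos_iff]
  refine lt_of_lt_of_le ?_ h
  have : 0 < 1 - 1 * e := by linarith
  positivity

/-- On the good event the two potentials are close outside the bad set. -/
theorem abs_logPotential_sub_le (hN : 0 < N) {γ ε : ℝ} {G : Matrix (Fin N) (Fin N) ℝ} {z : ℂ}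
    (hlow : Real.exp (J.logPot γ z - ε * (N + J.logPlus z)) ≤
      ‖(J.shifted z + ((-(N : ℝ) ^ (-γ) : ℝ) : ℂ) • complexify (J.pullback G)).det‖)
    (hup : ‖(J.shifted z + ((-(N : ℝ) ^ (-γ) : ℝ) : ℂ) • complexify (J.pullback G)).det‖ ≤
      Real.exp (J.logPot γ z + ε * (N + J.logPlus z))) :
    |logPotential (empiricalSpectralMeasure (perturb γ J.toMatrix G)) z -
      logPotential (J.mixture γ) z| ≤ ε * (1 + (N : ℝ)⁻¹ * J.logPlus z) := by
  have hN' : (0 : ℝ) < N := by exact_mod_cast hN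
  have h0 := (Real.exp_pos _).trans_le hlow
  rw [← J.det_scalar_sub_perturb] at hlow hup h0
  rw [logPotential_empiricalSpectralMeasure (norm_pos_iff.1 h0), J.logPotential_mixture hN,
    ← mul_sub, abs_mul, abs_of_pos (inv_pos.2 hN'), inv_mul_le_iff₀ hN', abs_le]
  have h1 := (Real.le_log_iff_exp_le h0).2 hlow
  have h2 := (Real.log_le_iff_le_exp h0).2 hup
  have h3 : (N : ℝ) * (ε * (1 + (N : ℝ)⁻¹ * J.logPlus z)) = ε * (N + J.logPlus z) := by
    field_simp
  rw [h3]
  constructor <;> linarith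

/-- The potentials are close in mean if the bad set is small. -/
theorem lintegral_logPotential_sub_le (hN : 0 < N) {γ δ ε R R₀ : ℝ} (hδ : 0 < δ) (hε : 0 < ε)
    (hR₀ : ∀ i, ‖J.eig i‖ ≤ R₀)
    (hmix : ∀ᵐ w ∂(J.mixture γ), ‖w‖ ≤ R₀) {G : Matrix (Fin N) (Fin N) ℝ}
    (hroots : ∀ w ∈ (perturb γ J.toMatrix G).charpoly.roots, ‖w‖ ≤ R₀)
    (hup : ∀ z, (∀ i, z ≠ J.eig i) →
      ‖(J.shifted z + ((-(N : ℝ) ^ (-γ) : ℝ) : ℂ) • complexify (J.pullback G)).det‖ ≤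
      Real.exp (J.logPot γ z + ε * (N + J.logPlus z))) {K : ℝ≥0} (hK : K ≠ 0) :
    ∫⁻ z in ball (0 : ℂ) R, ‖logPotential (empiricalSpectralMeasure (perturb γ J.toMatrix G)) z -
      logPotential (J.mixture γ) z‖ₑ ≤
      ENNReal.ofReal ε * (volume (ball (0 : ℂ) R) +
        (volume (ball (0 : ℂ) R) + logSqIntegral (R + R₀))) +
      2 * (K * (ENNReal.ofReal (4 * Real.pi * Real.exp (-δ * Real.log N)) +
        volume (J.badSet γ δ ε R (J.pullback G))) +
        (K : ℝ≥0∞)⁻¹ * logSqIntegral (R + R₀)) := by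
  set ν₁ := empiricalSpectralMeasure (perturb γ J.toMatrix G)
  set ν₂ := J.mixture γ
  have hν₁ : IsProbabilityMeasure ν₁ := isProbabilityMeasure_empiricalSpectralMeasure hN _
  have hν₂ : IsProbabilityMeasure ν₂ := J.isProbabilityMeasure_mixture hN γ
  have hν₁' : ∀ᵐ w ∂ν₁, ‖w‖ ≤ R₀ := ae_empiricalSpectralMeasure hroots
  set B := J.badSet γ δ ε R (J.pullback G)
  set A := ball (0 : ℂ) R ∩ (({z | ¬ J.AwayFromCircles δ z} ∪ B) ∪ Set.range J.eig) with hA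
  have hAR : A ⊆ ball 0 R := Set.inter_subset_left
  have hAvol : volume A ≤ ENNReal.ofReal (4 * Real.pi * Real.exp (-δ * Real.log N)) +
      volume B := by
    refine (measure_mono Set.inter_subset_right).trans ((measure_union_le _ _).trans ?_)
    rw [(Set.finite_range J.eig).measure_zero, add_zero]
    refine (measure_union_le _ _).trans ?_
    gcongr
    exact J.volume_not_awayFromCircles_le hN hδ
  have hm := J.measurable_logPlus
  have hpt : ∀ z ∈ ball (0 : ℂ) R, ‖logPotential ν₁ z - logPotential ν₂ z‖ₑ ≤
      ENNReal.ofReal ε * (1 + ENNReal.ofReal ((N : ℝ)⁻¹ * J.logPlus z)) +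
      A.indicator (fun z => ‖logPotential ν₁ z - logPotential ν₂ z‖ₑ) z := by
    intro z hz
    by_cases hzA : z ∈ A
    · rw [Set.indicator_of_mem hzA]
      exact le_add_self
    · rw [Set.indicator_of_notMem hzA, add_zero]
      have h1 : z ∉ ({z | ¬ J.AwayFromCircles δ z} ∪ B) ∪ Set.range J.eig := fun h =>
        hzA ⟨hz, h⟩
      rw [Set.mem_union, Set.mem_union, not_or, not_or, Set.mem_ofPred_eq, not_not] at h1
      obtain ⟨⟨h2, h3⟩, h4⟩ := h1
      have h5 : ∀ i, z ≠ J.eig i := fun i h => h4 ⟨i, h.symm⟩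
      have h6 := J.abs_logPotential_sub_le hN
        (not_lt.1 fun h => h3 ⟨hz, h5, h2, h⟩) (hup z h5)
      have hpl := J.logPlus_nonneg z
      rw [← ofReal_norm, Real.norm_eq_abs, ← ENNReal.ofReal_one,
        ← ENNReal.ofReal_add zero_le_one (by positivity), ← ENNReal.ofReal_mul hε.le]
      exact ENNReal.ofReal_le_ofReal h6
  refine (setLIntegral_mono' measurableSet_ball hpt).trans ?_
  rw [lintegral_add_left (by fun_prop), lintegral_const_mul _ (by fun_prop),
    lintegral_add_left measurable_const, setLIntegral_const, one_mul]
  gcongr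
  · exact J.lintegral_logPlus_le hN hR₀
  · calc ∫⁻ z in ball (0 : ℂ) R, A.indicator (fun z => ‖logPotential ν₁ z - logPotential ν₂ z‖ₑ) z
        ≤ ∫⁻ z in A, ‖logPotential ν₁ z - logPotential ν₂ z‖ₑ :=
          (setLIntegral_le_lintegral _ _).trans (lintegral_indicator_le _ _)
      _ ≤ ∫⁻ z in A, (‖logPotential ν₁ z‖ₑ + ‖logPotential ν₂ z‖ₑ) :=
          lintegral_mono fun z => enorm_sub_le
      _ = (∫⁻ z in A, ‖logPotential ν₁ z‖ₑ) + ∫⁻ z in A, ‖logPotential ν₂ z‖ₑ :=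
          lintegral_add_left (measurable_logPotential ν₁).enorm _
      _ ≤ (K * volume A + (K : ℝ≥0∞)⁻¹ * logSqIntegral (R + R₀)) +
          (K * volume A + (K : ℝ≥0∞)⁻¹ * logSqIntegral (R + R₀)) :=
          add_le_add (lintegral_enorm_logPotential_le hν₁' hAR hK)
            (lintegral_enorm_logPotential_le hmix hAR hK)
      _ ≤ _ := by
          rw [← two_mul]
          gcongr

end JordanData

end Convergence

section Convergence

open Metric
open scoped Matrix.Norms.L2Operator

theorem tendsto_noiseBound {γ : ℝ} (hγ : 1 < γ) : Tendsto (noiseBound γ) atTop (𝓝 0) := by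
  have h := (tendsto_exp_neg_mul_log (c := γ - 1 / 2) (by linarith)).const_mul 120
  rw [mul_zero] at h
  refine h.congr' ?_
  filter_upwards [eventually_gt_atTop 0] with N hN
  rw [noiseBound_eq γ hN]

theorem tendsto_exp_neg_mul_natCast {c : ℝ} (hc : 0 < c) :
    Tendsto (fun N : ℕ => ENNReal.ofReal (Real.exp (-c * N))) atTop (𝓝 0) := by
  have h : Tendsto (fun N : ℕ => -c * (N : ℝ)) atTop atBot :=
    tendsto_natCast_atTop_atTop.const_mul_atTop_of_neg (by linarith)
  have h2 := ENNReal.tendsto_ofReal (Real.tendsto_exp_atBot.comp h)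
  rwa [ENNReal.ofReal_zero] at h2

/-- With high probability the spectrum is bounded and the potential of the empirical spectral
measure is close to the potential of the mixture. -/
theorem stdGaussianMatrix_logPotential_close {γ : ℝ} (hγ : 1 < γ) (R R₀ : ℝ) {τ ρ : ℝ≥0∞}
    (hτ : τ ≠ 0) (hρ : ρ ≠ 0) :
    ∃ κ > 0, ∀ᶠ N : ℕ in atTop, ∀ J : JordanData N, (J.numBlocks : ℝ) ≤ κ * N →
      (∀ i, ‖J.eig i‖ ≤ R₀) → (∀ᵐ w ∂(J.mixture γ), ‖w‖ ≤ R₀ + 4) →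
      stdGaussianMatrix J.Idx {X | ∃ G, J.pullback G = X ∧
        ¬ ((∀ w ∈ (perturb γ J.toMatrix G).charpoly.roots, ‖w‖ ≤ R₀ + 4) ∧
          ∫⁻ z in ball (0 : ℂ) R,
            ‖logPotential (empiricalSpectralMeasure (perturb γ J.toMatrix G)) z -
              logPotential (J.mixture γ) z‖ₑ ≤ τ)} ≤ ρ := by
  have hV : volume (ball (0 : ℂ) R) ≠ ⊤ := measure_ball_lt_top.ne
  have hB : logSqIntegral (R + (R₀ + 4)) ≠ ⊤ := (logSqIntegral_lt_top _).ne
  set V := volume (ball (0 : ℂ) R)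
  set B := logSqIntegral (R + (R₀ + 4))
  have hW : V + (V + B) ≠ ⊤ := ENNReal.add_ne_top.2 ⟨hV, ENNReal.add_ne_top.2 ⟨hV, hB⟩⟩
  have hτ2 : τ / 2 ≠ 0 := (ENNReal.half_pos hτ).ne'
  have hτ4 : τ / 2 / 2 ≠ 0 := (ENNReal.half_pos hτ2).ne'
  obtain ⟨ε', hε'0, hε'⟩ := ENNReal.exists_nnreal_pos_mul_lt hW hτ2
  obtain ⟨K', hK'0, hK'⟩ := ENNReal.exists_nnreal_pos_mul_lt
    (ENNReal.mul_ne_top (by simp : (2 : ℝ≥0∞) ≠ ⊤) hB) hτ4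
  set K := K'⁻¹ with hKdef
  have hK0 : K ≠ 0 := inv_ne_zero hK'0.ne'
  obtain ⟨t', ht'0, ht'⟩ := ENNReal.exists_nnreal_pos_mul_lt
    (ENNReal.mul_ne_top (by simp : (2 : ℝ≥0∞) ≠ ⊤) (ENNReal.coe_ne_top (r := K)))
    hτ4
  set ε : ℝ := min ε' (1 / 2) with hεdef
  have hε0 : 0 < ε := lt_min (by exact_mod_cast hε'0) (by norm_num)
  have hε1 : ε < 1 := (min_le_right _ _).trans_lt (by norm_num)
  obtain ⟨κ₁, hκ₁, hup⟩ := norm_det_shifted_add_le hγ hε0 hε1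
  obtain ⟨κ₂, hκ₂, δ, hδ, hlow⟩ := stdGaussianMatrix_norm_det_shifted_lt hγ hε0 hε1
  set t : ℝ≥0∞ := (t' : ℝ≥0∞) / 2 with ht
  have ht0 : t ≠ 0 := (ENNReal.half_pos (by simpa using ht'0.ne')).ne'
  have htt : t ≠ ⊤ := ENNReal.div_ne_top ENNReal.coe_ne_top (by simp)
  refine ⟨min κ₁ κ₂, lt_min hκ₁ hκ₂, ?_⟩
  have l1 : Tendsto (fun N : ℕ => ENNReal.ofReal (Real.exp (-1 * (N : ℝ))) +
      V * ENNReal.ofReal (Real.exp (-(ε / 4) * N)) / t) atTop (𝓝 0) := by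
    have h1 := tendsto_exp_neg_mul_natCast one_pos
    have h2 := ENNReal.Tendsto.div_const (b := t) (ENNReal.Tendsto.const_mul (a := V)
      (tendsto_exp_neg_mul_natCast (c := ε / 4) (by positivity)) (Or.inr hV)) (Or.inr ht0)
    simpa using h1.add h2
  have l2 : Tendsto (fun N : ℕ => ENNReal.ofReal (4 * Real.pi * Real.exp (-δ * Real.log N)))
      atTop (𝓝 0) := by
    have h := ENNReal.tendsto_ofReal ((tendsto_exp_neg_mul_log hδ).const_mul (4 * Real.pi))
    rwa [mul_zero, ENNReal.ofReal_zero] at h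
  filter_upwards [hup, hlow, l1.eventually (ge_mem_nhds (pos_iff_ne_zero.2 hρ)),
    l2.eventually (ge_mem_nhds (pos_iff_ne_zero.2 ht0)),
    (tendsto_noiseBound hγ).eventually (gt_mem_nhds one_pos), eventually_gt_atTop 0]
    with N hup hlow h1 h2 h3 hN J hJ hR₀ hmix
  have hN' : (0 : ℝ) < N := by exact_mod_cast hN
  have hJ1 : (J.numBlocks : ℝ) ≤ κ₁ * N := hJ.trans (by gcongr; exact min_le_left _ _)
  have hJ2 : (J.numBlocks : ℝ) ≤ κ₂ * N := hJ.trans (by gcongr; exact min_le_right _ _)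
  have hs : |-(N : ℝ) ^ (-γ)| = (N : ℝ) ^ (-γ) := by
    rw [abs_neg, abs_of_pos (by positivity)]
  have hvol := J.stdGaussianMatrix_volume_badSet_ge (γ := γ) (δ := δ) (ε := ε) (R := R)
    (fun z hz hc => hlow J hJ2 _ hs z hz hc) ht0 htt
  have htail := stdGaussianMatrix_norm_complexify_tail (ι := J.Idx)
  rw [J.card_idx] at htail
  refine le_trans ?_ ((add_le_add htail hvol).trans (by rwa [neg_one_mul] at h1))
  refine (measure_mono ?_).trans (measure_union_le _ _)
  rintro _ ⟨G, rfl, hG⟩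
  by_contra hX
  rw [Set.mem_union, not_or, Set.mem_ofPred_eq, Set.mem_ofPred_eq, not_lt, not_and, not_le] at hX
  obtain ⟨hX1, hX2⟩ := hX
  have hE : ‖((-(N : ℝ) ^ (-γ) : ℝ) : ℂ) • complexify (J.pullback G)‖ ≤ noiseBound γ N := by
    rw [norm_smul, Complex.norm_real, Real.norm_eq_abs, hs, noiseBound]
    gcongr
  have hroots : ∀ w ∈ (perturb γ J.toMatrix G).charpoly.roots, ‖w‖ ≤ R₀ + 4 := by
    intro w hw
    by_contra hlt
    refine J.det_shifted_add_ne_zero hR₀ (not_le.1 hlt) hE h3 ?_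
    rw [← J.det_scalar_sub_perturb, Matrix.eval_charpoly_eq_prod]
    exact Multiset.prod_eq_zero (Multiset.mem_map.2 ⟨w, hw, sub_self w⟩)
  refine hG ⟨hroots, ?_⟩
  refine (J.lintegral_logPotential_sub_le hN hδ hε0 (fun i => (hR₀ i).trans (by linarith)) hmix
    hroots (fun z hz => hup J hJ1 z hz _ hE) hK0).trans ?_
  calc _ ≤ (ε' : ℝ≥0∞) * (V + (V + B)) + 2 * (K * (t + t) + (K : ℝ≥0∞)⁻¹ * B) := by
        gcongr
        · rw [← ENNReal.ofReal_coe_nnreal]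
          exact ENNReal.ofReal_le_ofReal (min_le_left _ _)
        · exact (hX2 hX1).le
    _ = (ε' : ℝ≥0∞) * (V + (V + B)) + (t' * (2 * K) + K' * (2 * B)) := by
        rw [ht, ENNReal.add_halves, hKdef, ENNReal.coe_inv hK'0.ne', inv_inv]
        ring
    _ ≤ τ / 2 + (τ / 2 / 2 + τ / 2 / 2) := by gcongr
    _ = τ := by rw [ENNReal.add_halves, ENNReal.add_halves]

end Convergence

theorem theorem1p1 {Ω : Type*} [MeasurableSpace Ω] (P : Measure Ω) [IsProbabilityMeasure P]
    (γ : ℝ) (hγ : 1 < γ)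
    (J : ∀ N : ℕ, JordanData N)
    (hℓ : (fun N : ℕ => ((J N).numBlocks : ℝ)) =o[atTop] (fun N : ℕ => (N : ℝ)))
    (G : ∀ N : ℕ, Ω → Matrix (Fin N) (Fin N) ℝ)
    (hG : ∀ N : ℕ, IsStdGaussianMatrix (G N) P)
    (K : Set ℂ) (hK : IsCompact K)
    (hsupp : ∀ N : ℕ, 2 ≤ N → (J N).mixture γ Kᶜ = 0)
    (μ : ProbabilityMeasure ℂ)
    (hμ : Tendsto (fun N : ℕ => (J N).mixtureFM γ) atTop (𝓝 μ.toFiniteMeasure)) :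
    TendstoWeaklyInProbability P
      (fun N ω => empiricalSpectralMeasure (perturb γ (J N).toMatrix (G N ω))) (μ : Measure ℂ) := by
  intro f
  refine tendstoInMeasure_of_ne_top fun a ha ha' => ?_
  obtain ⟨R₁, hR₁⟩ := hK.isBounded.exists_norm_le
  set η := a.toReal / 8 with hη
  have ha0 : 0 < a.toReal := ENNReal.toReal_pos ha.ne' ha'
  have hη0 : 0 < η := by positivity
  obtain ⟨C, R, hCR⟩ := exists_integral_sub_le_logPotential f (R₁ + 1 + 4) hη0
  obtain ⟨τ, hτ0, hτ⟩ := ENNReal.exists_nnreal_pos_mul_lt (ENNReal.ofReal_ne_top (r := C))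
    (show ENNReal.ofReal η ≠ 0 by simpa using hη0)
  rw [ENNReal.tendsto_nhds_zero]
  intro ρ hρ
  obtain ⟨κ, hκ, hclose⟩ := stdGaussianMatrix_logPotential_close hγ R (R₁ + 1)
    (τ := τ) (ρ := ρ) (by simpa using hτ0.ne') hρ.ne'
  have hmix := (FiniteMeasure.tendsto_iff_forall_integral_tendsto.1 hμ f)
  have hmix2 := (Metric.tendsto_nhds.1 hmix) η hη0
  filter_upwards [hclose, hℓ.bound hκ, hmix2, eventually_ge_atTop 2] with N hN hnum hfμ hN2
  have hsupp' : ∀ᵐ w ∂((J N).mixture γ), ‖w‖ ≤ R₁ + 1 + 4 := by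
    have : ∀ᵐ w ∂((J N).mixture γ), w ∈ K := hsupp N hN2
    exact this.mono fun w hw => (hR₁ w hw).trans (by linarith)
  have hnum' : ((J N).numBlocks : ℝ) ≤ κ * N := by simpa using hnum
  have hbad := hN (J N) hnum' ((J N).norm_eig_le hγ (hsupp N hN2) hR₁) hsupp'
  have hlaw := (hG N).map_pullback (J N)
  refine le_trans ?_ hbad
  rw [← hlaw.map_eq]
  refine (measure_mono ?_).trans (Measure.le_map_apply hlaw.aemeasurable _)
  intro ω hω
  refine ⟨G N ω, rfl, fun ⟨hroots, hint⟩ => ?_⟩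
  have hprob1 := isProbabilityMeasure_empiricalSpectralMeasure (by omega : 0 < N)
    (perturb γ (J N).toMatrix (G N ω))
  have hprob2 := (J N).isProbabilityMeasure_mixture (by omega : 0 < N) γ
  have h1 := hCR _ _ hprob1 hprob2 (ae_empiricalSpectralMeasure hroots) hsupp'
  have h2 : ENNReal.ofReal |(∫ w, f w ∂(empiricalSpectralMeasure
      (perturb γ (J N).toMatrix (G N ω)))) - ∫ w, f w ∂((J N).mixture γ)| ≤
      ENNReal.ofReal (3 * η) := by
    refine h1.trans ?_
    have h3 : (3 : ℝ) * η = 2 * η + η := by ring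
    rw [h3, ENNReal.ofReal_add (by positivity) hη0.le]
    gcongr
    refine le_trans ?_ hτ.le
    rw [mul_comm]
    gcongr
  rw [ENNReal.ofReal_le_ofReal_iff (by positivity)] at h2
  have h4 : |(∫ w, f w ∂((J N).mixture γ)) - ∫ w, f w ∂(μ : Measure ℂ)| < η := by
    rw [← Real.dist_eq]
    exact hfμ
  rw [Set.mem_ofPred_eq, edist_dist, Real.dist_eq,
    ENNReal.le_ofReal_iff_toReal_le ha' (abs_nonneg _)] at hω
  have h5 := abs_sub_le (∫ w, f w ∂(empiricalSpectralMeasure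
      (perturb γ (J N).toMatrix (G N ω)))) (∫ w, f w ∂((J N).mixture γ)) (∫ w, f w ∂(μ : Measure ℂ))
  linarith
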